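/- Let $p$ be an odd prime, $h=(p-1)/2$, and for $N\ge 0$ let $H^*(BE^N)=E(x_1,\dots,x_N)\otimes P(y_1,\dots,y_N)$ be the mod $p$ cohomology of an elementary abelian $p$-group of rank $N$ (exterior algebra on $x_i$ of degree $1$, polynomial algebra on $y_i=\beta x_i$ of degree $2$, over $\mathbb Z/p$). **Steenrod operations.** Let $\mathcal A_*=E(\tau_0,\tau_1,\dots)\otimes P(\xi_1,\xi_2,\dots)$ be the dual of the mod $p$ Steenrod algebra. For $S=(s_1<\dots<s_t)$ and $R=(r_1,\dots,r_m)$, let $St^{S,R}$ be the dual of $\tau_S\xi^R=\tau_{s_1}\cdots\tau_{s_t}\xi_1^{r_1}\cdots\xi_m^{r_m}$ with respect to the monomial basis of $\mathcal A_*$. On $H^*(BE^N)$ it is determined by $\lambda(z)=\sum_{S,R}\tau_S\xi^R\otimes St^{S,R}z$, where $\lambda$ is the multiplicative (with the usual signs) coaction with $\lambda(x_j)=1\otimes x_j+\sum_{i\ge0}\tau_i\otimes y_j^{p^i}$ and $\lambda(y_j)=1\otimes y_j+\sum_{i\ge1}\xi_i\otimes y_j^{p^i}$. **Invariants.** In $H^*(BE^N)$,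 for $k\le N$, put $[e_1,\dots,e_k]=\det(y_i^{p^{e_j}})_{1\le i,j\le k}$, and let $[1;e_2,\dots,e_k]$ be the determinant with first row $(x_1,\dots,x_k)$ and further rows $(y_1^{p^{e_j}},\dots,y_k^{p^{e_j}})$, $2\le j\le k$. Put $L_{k,s}=[0,\dots,\hat s,\dots,k]$ for $0\le s\le k$, $L_k=L_{k,k}$ (so $L_0=1$), $M_{k,s}=[1;0,\dots,\hat s,\dots,k-1]$ for $0\le s<k$, and $$\tilde L_k=L_k^h,\quad Q_{k,s}=L_{k,s}/L_k,\quad \tilde M_{k,s}=M_{k,s}L_k^{h-1}\ (0\le s<k),\quad \tilde M_{k,-1}=\tilde L_k,$$ $$U_{k+1}=M_{k+1,k}L_k^{h-1},\qquad V_{k+1}=L_{k+1}/L_k .$$ For $S=(s_1<\dots<s_t)$ with $0\le s_i<m$ and $H=(h_0,\dots,h_{m-1})$, $h_i\ge0$, put $$\tilde M_S\tilde Q^H=\tilde M_{m,s_1}\cdots\tilde M_{m,s_t}\,\tilde L_m^{h_0}Q_{m,1}^{h_1}\cdots Q_{m,m-1}^{h_{m-1}} .$$ **Duals.** For fixed $k$,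 the monomials $\tilde M_S\tilde Q^H U_{k+1}^eV_{k+1}^j$ ($e\in\{0,1\}$, $j\ge0$; $m=k$) in $H^*(BE^{k+1})$ are the tensor product of the monomial bases of $E(\tilde M_{k,0},\dots,\tilde M_{k,k-1})\otimes P(\tilde L_k,Q_{k,1},\dots,Q_{k,k-1})$ and $E(U_{k+1})\otimes P(V_{k+1})$. Let $\tilde m_S\tilde q_H$ and $u_{k+1}^e\gamma_j(v_{k+1})$ be the dual basis elements of $\tilde M_S\tilde Q^H$ and $U_{k+1}^eV_{k+1}^j$; tensor products are paired with the usual sign $\langle f\otimes g,a\otimes b\rangle=(-1)^{|g||a|}\langle f,a\rangle\langle g,b\rangle$. By convention $\tilde m_S\tilde q_H=0$ if an entry of $H$ is negative, and $\gamma_{1/p}(v_{k+1})=u_{k+1}$. For $q\in\mathbb Z$ and $R=(r_1,\dots,r_m)$ put $R^*_q=(q-2(r_1+\dots+r_m),r_1,\dots,r_{m-1})$ (the empty sequence if $m=0$), and let $[a]$ be the integral part of a rational number $a$ (so $[-2p^{-1}]=-1$). **Statement.** Let $n,k\ge0$, $\delta\in\{0,1\}$, $s\in\mathbb Z$ with $-\delta\le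 s\le n-\delta$, $S=(s_1<\dots<s_t)$ with $0\le s_i<k$, and $R=(r_1,\dots,r_k)$ with $r_i\ge0$. Then the monomials $\tilde M_{S'}\tilde Q^{H'}$ (with $m=n$) in $H^*(BE^n)$ are linearly independent, and so are the monomials $\tilde M_S\tilde Q^HU_{k+1}^eV_{k+1}^j$ (with $m=k$) in $H^*(BE^{k+1})$; the span of the latter contains $St^{S',R'}(U_{k+1}^\delta V_{k+1}^{1-\delta})$ for all $S'=(s'_1<\dots<s'_{t'})$ with $0\le s'_i<n$ and all $R'=(r'_1,\dots,r'_n)$ with $r'_i\ge0$, so that $$C_{S',R'}=\big\langle\tilde m_S\tilde q_{R^*_{(2-\delta)p^n+[-2p^s]-t}}\otimes\gamma_{p^s}(v_{k+1}),\ St^{S',R'}\big(U_{k+1}^\delta V_{k+1}^{1-\delta}\big)\big\rangle\in\mathbb Z/p$$ is defined; and $$St^{S,R}\big(\tilde M_{n,s}^\delta Q_{n,s}^{1-\delta}\big)=\sum_{S',R'}(-1)^\sigma C_{S',R'}\,\tilde M_{S'}\tilde Q^{{R'}^*_{(2-\delta)p^k-t'}} ,$$ where the sum is over all such $(S',R')$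 with $t'+2(r'_1+\dots+r'_n)\le(2-\delta)p^k$, and $$\sigma=r(S,R)+r(S',R')+s+\delta+(t+[-2p^s])t'+nhk\delta,\qquad r(S,R)=t+s_1+\dots+s_t+r_1+2r_2+\dots+kr_k$$ (and likewise $r(S',R')$). -/

import Mathlib

open scoped TensorProduct

noncomputable section

namespace ModularInvariants

/-! ### The free graded commutative algebras `E(I) ⊗ P(I)` over `𝔽_p` -/

/-- `E(o_i : i ∈ I) ⊗ P(w_i : i ∈ I)`, the tensor product over `𝔽_p` of the exterior algebra on
odd generators `o_i` and the polynomial algebra on even generators `w_i`.  No sign is needed in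
the product of this tensor product, because the polynomial factor is concentrated in even
degrees. -/
abbrev FreeGC (p : ℕ) (I : Type) : Type :=
  ExteriorAlgebra (ZMod p) (I → ZMod p) ⊗[ZMod p] MvPolynomial I (ZMod p)

/-- The embedding of the polynomial factor. -/
def poly {p : ℕ} {I : Type} (f : MvPolynomial I (ZMod p)) : FreeGC p I :=
  1 ⊗ₜ[ZMod p] f

/-- The odd generator `o_i`. -/
def odd (p : ℕ) {I : Type} [DecidableEq I] (i : I) : FreeGC p I :=
  ExteriorAlgebra.ι (ZMod p) (Pi.single i (1 : ZMod p)) ⊗ₜ[ZMod p] 1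

/-- The monomial basis of `E(I) ⊗ P(I)`: the element with index `(A, b)` is the product of the
`o_i`, `i ∈ A`, in increasing order, times `∏ w_i ^ b_i`. -/
def monomialBasis (p : ℕ) (I : Type) [LinearOrder I] [Fintype I] :
    Module.Basis (Finset I × (I →₀ ℕ)) (ZMod p) (FreeGC p I) :=
  ((Pi.basisFun (ZMod p) I).ExteriorAlgebra).tensorProduct
    (MvPolynomial.basisMonomials I (ZMod p))

/-- `H^*(BE^N; 𝔽_p) = E(x_1, …, x_N) ⊗ P(y_1, …, y_N)`, where the indices start at `0`. -/
abbrev H (p N : ℕ) : Type := FreeGC p (Fin N)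

/-! ### The Milnor operations `St^{S,R}` -/

/-- The tensor product of `E(τ_0, …, τ_{m-1}) ⊗ P(ξ_1, …, ξ_m)` (the dual Steenrod algebra
modulo the generators `τ_i`, `i ≥ m`, and `ξ_i`, `i > m`) with `H^*(BE^N)`, as graded commutative
algebras, that is
`E(τ_0, …, τ_{m-1}, x_1, …, x_N) ⊗ P(ξ_1, …, ξ_m, y_1, …, y_N)`.
The index `inl i` stands for `τ_i` (odd) and `ξ_{i+1}` (even); `inr j` stands for `x_j`, `y_j`. -/
abbrev CoactionTarget (p m N : ℕ) : Type := FreeGC p (Fin m ⊕ₗ Fin N)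

/-- The linear part of the coaction on `E(x_1, …, x_N)`, before the inclusion of the generators in
the exterior algebra: `x_j ↦ x_j ⊗ 1 + ∑_{i < m} τ_i ⊗ y_j ^ (p ^ i)`. -/
def coactionX (p m N : ℕ) : (Fin N → ZMod p) →ₗ[ZMod p]
    ((Fin m ⊕ₗ Fin N) → ZMod p) ⊗[ZMod p] MvPolynomial (Fin m ⊕ₗ Fin N) (ZMod p) :=
  Fintype.linearCombination (ZMod p) fun j : Fin N =>
    (Pi.single (toLex (Sum.inr j)) (1 : ZMod p)) ⊗ₜ[ZMod p] 1
      + ∑ i : Fin m, (Pi.single (toLex (Sum.inl i)) (1 : ZMod p)) ⊗ₜ[ZMod p]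
          (MvPolynomial.X (toLex (Sum.inr j)) ^ p ^ (i : ℕ))

/-- The coaction on `P(y_1, …, y_N)`:
`y_j ↦ y_j + ∑_{1 ≤ i ≤ m} ξ_i y_j ^ (p ^ i)`. -/
def coactionY (p m N : ℕ) :
    MvPolynomial (Fin N) (ZMod p) →ₐ[ZMod p] MvPolynomial (Fin m ⊕ₗ Fin N) (ZMod p) :=
  MvPolynomial.aeval fun j : Fin N =>
    MvPolynomial.X (toLex (Sum.inr j))
      + ∑ i : Fin m, MvPolynomial.X (toLex (Sum.inl i)) *
          MvPolynomial.X (toLex (Sum.inr j)) ^ p ^ ((i : ℕ) + 1)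

/-- The inclusion of the span of the odd generators, with polynomial coefficients. -/
def oddPart (p : ℕ) (I : Type) :
    (I → ZMod p) ⊗[ZMod p] MvPolynomial I (ZMod p) →ₗ[ZMod p] FreeGC p I :=
  TensorProduct.map (ExteriorAlgebra.ι (ZMod p)) LinearMap.id

theorem oddPart_anticomm (p : ℕ) (I : Type)
    (a b : (I → ZMod p) ⊗[ZMod p] MvPolynomial I (ZMod p)) :
    oddPart p I a * oddPart p I b + oddPart p I b * oddPart p I a = 0 := by
  induction a using TensorProduct.induction_on with
  | zero => simp
  | add a₁ a₂ h₁ h₂ =>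
    rw [map_add, add_mul, mul_add]
    calc _ = (oddPart p I a₁ * oddPart p I b + oddPart p I b * oddPart p I a₁)
        + (oddPart p I a₂ * oddPart p I b + oddPart p I b * oddPart p I a₂) := by abel
      _ = 0 := by rw [h₁, h₂, add_zero]
  | tmul v q =>
    induction b using TensorProduct.induction_on with
    | zero => simp
    | add b₁ b₂ h₁ h₂ =>
      rw [map_add, add_mul, mul_add]
      calc _ = (oddPart p I (v ⊗ₜ q) * oddPart p I b₁ + oddPart p I b₁ * oddPart p I (v ⊗ₜ q))
          + (oddPart p I (v ⊗ₜ q) * oddPart p I b₂ + oddPart p I b₂ * oddPart p I (v ⊗ₜ q)) := by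
            abel
        _ = 0 := by rw [h₁, h₂, add_zero]
    | tmul w r =>
      simp only [oddPart, TensorProduct.map_tmul, LinearMap.id_coe, id_eq,
        Algebra.TensorProduct.tmul_mul_tmul]
      rw [mul_comm r q, ← TensorProduct.add_tmul, ExteriorAlgebra.ι_add_mul_swap,
        TensorProduct.zero_tmul]

theorem oddPart_sq (p : ℕ) (I : Type)
    (a : (I → ZMod p) ⊗[ZMod p] MvPolynomial I (ZMod p)) :
    oddPart p I a * oddPart p I a = 0 := by
  induction a using TensorProduct.induction_on with
  | zero => simp
  | add a₁ a₂ h₁ h₂ =>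
    rw [map_add, add_mul, mul_add, mul_add, h₁, h₂, zero_add, add_zero]
    exact oddPart_anticomm p I a₁ a₂
  | tmul v q =>
    simp [oddPart, TensorProduct.map_tmul, Algebra.TensorProduct.tmul_mul_tmul]

theorem commute_poly {p : ℕ} {I : Type} (z : FreeGC p I) (f : MvPolynomial I (ZMod p)) :
    Commute z (poly f) := by
  induction z using TensorProduct.induction_on with
  | zero => exact Commute.zero_left _
  | add a b ha hb => exact ha.add_left hb
  | tmul w q => simp [Commute, SemiconjBy, poly, Algebra.TensorProduct.tmul_mul_tmul, mul_comm]

/-- Milnor's coaction of the dual Steenrod algebra on `H^*(BE^N)`, modulo the generators `τ_i`,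
`i ≥ m`, and `ξ_i`, `i > m`: the homomorphism of algebras given by
`x_j ↦ x_j + ∑_i τ_i y_j ^ (p ^ i)` and `y_j ↦ y_j + ∑_{i ≥ 1} ξ_i y_j ^ (p ^ i)`. -/
def coaction (p m N : ℕ) : H p N →ₐ[ZMod p] CoactionTarget p m N :=
  Algebra.TensorProduct.lift
    (ExteriorAlgebra.lift (ZMod p)
      ⟨(oddPart p (Fin m ⊕ₗ Fin N)).comp (coactionX p m N), fun _ => oddPart_sq p _ _⟩)
    (Algebra.TensorProduct.includeRight.comp (coactionY p m N))
    (fun _ f => commute_poly _ (coactionY p m N f))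

/-- The index of the monomial `τ_S ξ^R · x_A y^b`, for the index `(A, b)` of the monomial
`x_A y^b`. -/
def joinIndex {m N : ℕ} (S : Finset (Fin m)) (R : Fin m → ℕ)
    (c : Finset (Fin N) × (Fin N →₀ ℕ)) :
    Finset (Fin m ⊕ₗ Fin N) × ((Fin m ⊕ₗ Fin N) →₀ ℕ) :=
  ((S.disjSum c.1).map toLex.toEmbedding,
    Finsupp.equivFunOnFinite.symm fun i => Sum.elim R c.2 (ofLex i))

theorem joinIndex_injective {m N : ℕ} (S : Finset (Fin m)) (R : Fin m → ℕ) :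
    Function.Injective (joinIndex (N := N) S R) := by
  rintro ⟨A, b⟩ ⟨A', b'⟩ h
  rw [joinIndex, joinIndex, Prod.mk.injEq] at h
  obtain ⟨h₁, h₂⟩ := h
  have h₃ := Finset.map_injective _ h₁
  have h₄ := Finsupp.equivFunOnFinite.symm.injective h₂
  refine Prod.ext ?_ ?_
  · ext a
    have := congrArg (fun s => Sum.inr a ∈ s) h₃
    simpa using this
  · ext a
    simpa using congrFun h₄ (toLex (Sum.inr a))

/-- The Milnor operation `St^{S,R}` on `H^*(BE^N)`, the dual of `τ_S ξ^R` with respect to the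
monomial basis of the dual Steenrod algebra, for `S ⊆ {0, …, m-1}` and `R = (r_1, …, r_m)`
(`R i` is `r_{i+1}`): `St^{S,R} z` is the coefficient, in `H^*(BE^N)`, of `τ_S ξ^R` in the
coaction `∑_{S,R} τ_S ξ^R ⊗ St^{S,R} z` on `z`.  The generators `τ_i`, `i ≥ m`, and `ξ_i`, `i > m`,
do not occur in `τ_S ξ^R`, so that working modulo them does not affect this coefficient. -/
def St {p m N : ℕ} (S : Finset (Fin m)) (R : Fin m → ℕ) (z : H p N) : H p N :=
  (monomialBasis p (Fin N)).repr.symm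
    (((monomialBasis p (Fin m ⊕ₗ Fin N)).repr (coaction p m N z)).comapDomain (joinIndex S R)
      (joinIndex_injective S R).injOn)

/-! ### The invariants of Dickson and Mùi -/

/-- The sequence `0, 1, …, ŝ, …` with `s` omitted. -/
def skip (s j : ℕ) : ℕ := if j < s then j else j + 1

/-- The position, among `k` columns, of the column `b` after deletion of the column `i`. -/
def skipCol {k : ℕ} (i : Fin k) (b : Fin (k - 1)) : Fin k :=
  ⟨skip i b, by have := b.isLt; unfold skip; split <;> omega⟩

/-- `[e_1, …, e_k] = det (y_i ^ (p ^ e_j))`, in the first `k` of `N` variables. -/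
def bracket (p : ℕ) {k N : ℕ} (hk : k ≤ N) (e : Fin k → ℕ) : MvPolynomial (Fin N) (ZMod p) :=
  Matrix.det (Matrix.of fun j i : Fin k => MvPolynomial.X (Fin.castLE hk i) ^ p ^ e j)

/-- `[1; e_2, …, e_k]`, the determinant with first row `(x_1, …, x_k)` and further rows
`(y_1 ^ (p ^ e_j), …, y_k ^ (p ^ e_j))`, expanded along the first row. -/
def bracketOne (p : ℕ) {k N : ℕ} (hk : k ≤ N) (e : Fin (k - 1) → ℕ) : H p N :=
  ∑ i : Fin k, (-1 : ZMod p) ^ (i : ℕ) • (odd p (Fin.castLE hk i) *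
    poly (Matrix.det (Matrix.of fun a b : Fin (k - 1) =>
      MvPolynomial.X (Fin.castLE hk (skipCol i b)) ^ p ^ e a)))

/-- `h = (p - 1) / 2`. -/
def half (p : ℕ) : ℕ := (p - 1) / 2

/-- `L_{k,s} = [0, …, ŝ, …, k]`. -/
def Ls (p : ℕ) {k N : ℕ} (hk : k ≤ N) (s : ℕ) : MvPolynomial (Fin N) (ZMod p) :=
  bracket p hk fun j => skip s j

/-- `L_k = L_{k,k} = [0, …, k-1]`, with `L_0 = 1`. -/
def L (p : ℕ) {k N : ℕ} (hk : k ≤ N) : MvPolynomial (Fin N) (ZMod p) := Ls p hk k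

/-- `M_{k,s} = [1; 0, …, ŝ, …, k-1]`. -/
def Ms (p : ℕ) {k N : ℕ} (hk : k ≤ N) (s : ℕ) : H p N :=
  bracketOne p hk fun j => skip s j

open Classical in
/-- The quotient `a / b` of two polynomials, for `b ≠ 0` dividing `a`. -/
def exactQuot {σ R : Type} [CommRing R] (a b : MvPolynomial σ R) : MvPolynomial σ R :=
  if h : b ∣ a then h.choose else 0

/-- `L̃_k = L_k ^ h`. -/
def Ltil (p : ℕ) {k N : ℕ} (hk : k ≤ N) : MvPolynomial (Fin N) (ZMod p) := L p hk ^ half p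

/-- `Q_{k,s} = L_{k,s} / L_k`, for `0 ≤ s ≤ k`. -/
def Q (p : ℕ) {k N : ℕ} (hk : k ≤ N) (s : ℕ) : MvPolynomial (Fin N) (ZMod p) :=
  exactQuot (Ls p hk s) (L p hk)

/-- `M̃_{k,s} = M_{k,s} L_k ^ (h-1)` for `0 ≤ s < k`, and `M̃_{k,-1} = L̃_k`. -/
def Mtil (p : ℕ) {k N : ℕ} (hk : k ≤ N) (s : ℤ) : H p N :=
  if s = -1 then poly (Ltil p hk) else Ms p hk s.toNat * poly (L p hk ^ (half p - 1))

/-- `U_{k+1} = M_{k+1,k} L_k ^ (h-1)`. -/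
def U (p : ℕ) {k N : ℕ} (hk : k + 1 ≤ N) : H p N :=
  Ms p hk k * poly (L p ((Nat.le_succ k).trans hk) ^ (half p - 1))

/-- `V_{k+1} = L_{k+1} / L_k`. -/
def V (p : ℕ) {k N : ℕ} (hk : k + 1 ≤ N) : MvPolynomial (Fin N) (ZMod p) :=
  exactQuot (L p hk) (L p ((Nat.le_succ k).trans hk))

/-! ### Monomials and dual elements -/

/-- `M̃_S Q̃^H = M̃_{m,s_1} ⋯ M̃_{m,s_t} L̃_m ^ {h_0} Q_{m,1} ^ {h_1} ⋯ Q_{m,m-1} ^ {h_{m-1}}`,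
for `S = {s_1 < ⋯ < s_t}`. -/
def MQ (p : ℕ) {m N : ℕ} (hm : m ≤ N) (S : Finset (Fin m)) (e : Fin m → ℕ) : H p N :=
  ((S.sort (· ≤ ·)).map fun s : Fin m => Mtil p hm ((s : ℕ) : ℤ)).prod *
    poly (∏ i : Fin m, (if (i : ℕ) = 0 then Ltil p hm else Q p hm i) ^ e i)

/-- The monomial `M̃_S Q̃^H U_{k+1} ^ e V_{k+1} ^ j` of
`E(M̃_{k,0}, …, M̃_{k,k-1}) ⊗ P(L̃_k, Q_{k,1}, …, Q_{k,k-1}) ⊗ E(U_{k+1}) ⊗ P(V_{k+1})`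
in `H^*(BE^{k+1})`, for the index `(S, H, e, j)`. -/
def MQUV (p k : ℕ) (c : Finset (Fin k) × (Fin k → ℕ) × Fin 2 × ℕ) : H p (k + 1) :=
  MQ p (Nat.le_succ k) c.1 c.2.1 * U p (le_refl (k + 1)) ^ (c.2.2.1 : ℕ) *
    poly (V p (le_refl (k + 1)) ^ c.2.2.2)

open Classical in
/-- The value at `z` of the element with index `i` of the dual basis of the linearly independent
family `b`, for `z` in the span of `b`. -/
def dualValue {p : ℕ} {ι W : Type} [AddCommGroup W] [Module (ZMod p) W] (b : ι → W) (i : ι)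
    (z : W) : ZMod p :=
  if h : LinearIndependent (ZMod p) b ∧ z ∈ Submodule.span (ZMod p) (Set.range b) then
    h.1.repr ⟨z, h.2⟩ i
  else 0

/-- `R_q^* = (q - 2 (r_1 + ⋯ + r_m), r_1, …, r_{m-1})`. -/
def star {m : ℕ} (q : ℤ) (R : Fin m → ℕ) (i : Fin m) : ℤ :=
  if (i : ℕ) = 0 then q - 2 * ∑ j, (R j : ℤ)
  else R ⟨(i : ℕ) - 1, by have := i.isLt; omega⟩

/-- The pairing `⟨m̃_S q̃_H ⊗ u_{k+1}^e γ_j(v_{k+1}), z⟩`.  A divided power `γ_i` with `i < 0`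
is `0`.  The dual of a tensor product is the tensor product of the duals with the usual sign:
`⟨f ⊗ g, a ⊗ b⟩ = (-1)^{|g||a|} ⟨f, a⟩ ⟨g, b⟩`. -/
def pairing (p k : ℕ) (S : Finset (Fin k)) (e : Fin k → ℤ) (ε : Fin 2) (j : ℕ)
    (z : H p (k + 1)) : ZMod p :=
  if ∀ i, 0 ≤ e i then
    (-1) ^ ((ε : ℕ) * S.card) * dualValue (MQUV p k) (S, fun i => (e i).toNat, ε, j) z
  else 0

/-- `r(S, R) = t + s_1 + ⋯ + s_t + r_1 + 2 r_2 + ⋯ + m r_m`. -/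
def rr {m : ℕ} (S : Finset (Fin m)) (R : Fin m → ℕ) : ℕ :=
  S.card + ∑ s ∈ S, (s : ℕ) + ∑ i : Fin m, ((i : ℕ) + 1) * R i

/-- The integral part `[-2 p^s]`, for an integer `s`; it is `-1` for `s = -1`. -/
def br (p : ℕ) (s : ℤ) : ℤ := ⌊(-2 : ℚ) * (p : ℚ) ^ s⌋

/-- `σ = r(S,R) + r(S',R') + s + δ + (t + [-2p^s]) t' + n h k δ`. -/
def sgnExp (p : ℕ) {n k : ℕ} (δ : ℕ) (s : ℤ) (S : Finset (Fin k)) (R : Fin k → ℕ)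
    (S' : Finset (Fin n)) (R' : Fin n → ℕ) : ℤ :=
  rr S R + rr S' R' + s + δ + (S.card + br p s) * S'.card + n * half p * k * δ

/-- The coefficient `C_{S',R'}`, that is
`⟨m̃_S q̃_{R^*_{(2-δ)p^n + [-2p^s] - t}} ⊗ γ_{p^s}(v_{k+1}), St^{S',R'}(U_{k+1}^δ V_{k+1}^{1-δ})⟩`,
where `γ_{1/p}(v_{k+1}) = u_{k+1}`. -/
def coeffC (p : ℕ) {n k : ℕ} (δ : ℕ) (s : ℤ) (S : Finset (Fin k)) (R : Fin k → ℕ)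
    (S' : Finset (Fin n)) (R' : Fin n → ℕ) : ZMod p :=
  pairing p k S (star ((2 - (δ : ℤ)) * (p : ℤ) ^ n + br p s - S.card) R)
    (if s = -1 then 1 else 0) (if s = -1 then 0 else p ^ s.toNat)
    (St S' R' (U p (le_refl (k + 1)) ^ δ * poly (V p (le_refl (k + 1))) ^ (1 - δ)))

/-- The finite set of all `R' = (r'_1, …, r'_n)` for which the first entry
`(2-δ)p^k - t' - 2(r'_1 + ⋯ + r'_n)` of `R'^*_{(2-δ)p^k - t'}` is nonnegative; the bound
`r'_i ≤ p^k` follows from this condition. -/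
def admissible (p n k δ t' : ℕ) : Finset (Fin n → ℕ) :=
  (Fintype.piFinset fun _ : Fin n => Finset.range (p ^ k + 1)).filter fun R' =>
    t' + 2 * ∑ i, R' i ≤ (2 - δ) * p ^ k

end ModularInvariants

end

/-! Milnor's coaction is a substitution of variables, and for suitable values of its parameters it
is the substitution by Mùi's invariants. Put ℓ = L_n^h, τ_s = (-1)^(s+1) M̃_{n,s}/ℓ and ξ_i = (-1)^i
Q_{n,i}/ℓ². Then x and y are sent to (-1)^n ℓ⁻¹ U_{n+1}(x, y) and (-1)^n ℓ⁻² V_{n+1}(y). Hence the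
value of a class z at the images (U_{n+1}, V_{n+1}) of its variables is the sum of ± M̃_S Q̃^{R*}
St^{S,R} z. The shift from R to R* and the sign r(S,R) appear when the powers of ℓ are cleared
(`ev_uval_vval`, `scalar_identity`).

Apply this to U_{k+1}^δ V_{k+1}^(1-δ). As a polynomial in the last variable, V_{k+1} after V_{n+1}
is the monic additive polynomial whose roots are the 𝔽_p-span of n + k independent elements, so the
two blocks of variables can be exchanged (`vval_vval`). For U the exchange costs the sign (-1)^(nkh)
(`uval_uval`). After the exchange the outer V_{n+1} or U_{n+1} is a signed sum over s of Q_{n,s} or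
M̃_{n,s}, taken at the images under the rank k substitution, times V_{k+1}^{p^s}; for U there is
also the term L̃_n U_{k+1}, which is the case s = -1 (`ev_uval_vval_uvClass`). Each coefficient is
expanded once more by `ev_uval_vval`, now with invariants of rank k.

Equating the two expansions gives an identity in H^*(BE^n) ⊗ H^*(BE^{k+1}) (`sum_MQ_tmul_St`). A
functional dual to a monomial on the left factor isolates one St^{S',R'}(U^δ V^(1-δ)) and shows that
it lies in the asserted span. A functional dual to a monomial on the right factor isolates
St^{S,R}(M̃^δ Q^(1-δ)) and gives the formula (`sum_dualValue_smul_MQ`). The signs then agree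
wherever the coefficient is nonzero, by a parity count (`parity_of_dualValue_ne_zero`,
`even_swap_sub`).

Everything is computed with values in an exterior algebra over a field, where L_n is invertible and
identities between additive polynomials follow by counting roots (`eq_zero_of_additive`). Nothing is
lost at generic values (`ev_injective`, `evProd_injective`). Independence of the monomials comes
from a transcendence degree count for the even invariants and a dimension count for the odd ones. -/

namespace ModularInvariants

/-! ### Evaluation of `E(I) ⊗ P(I)` in an exterior algebra over a field -/

section Wedge

variable (K : Type*) {M I J : Type*} [CommRing K] [AddCommGroup M] [Module K M]
  [LinearOrder I] [LinearOrder J]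

/-- The exterior product of the vectors `X i`, `i ∈ A`, in increasing order. -/
noncomputable def wedge (X : I → M) (A : Finset I) : ExteriorAlgebra K M :=
  ((A.sort (· ≤ ·)).map fun i => ExteriorAlgebra.ι K (X i)).prod

@[simp]
theorem wedge_empty (X : I → M) : wedge K X ∅ = 1 := by simp [wedge]

theorem basis_exteriorAlgebra_apply (b : Module.Basis I K M) (A : Finset I) :
    b.ExteriorAlgebra A = wedge K b A := by
  rw [ExteriorAlgebra.basis_apply]
  change ExteriorAlgebra.ιMulti K A.card (b ∘ A.orderEmbOfFin rfl) = _
  rw [ExteriorAlgebra.ιMulti_apply, wedge, ← Finset.listMap_orderEmbOfFin_finRange A rfl,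
    List.map_map, List.ofFn_eq_map]
  rfl

theorem wedge_comp (f : J ↪o I) (X : I → M) (A : Finset J) :
    wedge K (X ∘ f) A = wedge K X (A.map f.toEmbedding) := by
  have h := (f.strictMono.strictMonoOn (A : Set J)).map_finsetSort (f := f.toEmbedding)
  simp only [RelEmbedding.coe_toEmbedding] at h
  rw [wedge, wedge, ← h, List.map_map]
  rfl

theorem wedge_eq_mul_of_lt (X : I → M) {A B C : Finset I} (hC : ∀ a, a ∈ C ↔ a ∈ A ∨ a ∈ B)
    (h : ∀ a ∈ A, ∀ b ∈ B, a < b) : wedge K X C = wedge K X A * wedge K X B := by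
  unfold wedge
  rw [← List.prod_append, ← List.map_append]
  congr 2
  have hs : ((A.sort (· ≤ ·)) ++ B.sort (· ≤ ·)).Pairwise (· ≤ ·) := by
    rw [List.pairwise_append]
    exact ⟨Finset.pairwise_sort _ _, Finset.pairwise_sort _ _, fun a ha b hb =>
      (h a (by simpa using ha) b (by simpa using hb)).le⟩
  refine List.Perm.eq_of_pairwise' (r := (· ≤ ·)) (Finset.pairwise_sort _ _) hs ?_
  refine (List.perm_ext_iff_of_nodup (Finset.sort_nodup _ _) ?_).2 fun a => by simp [hC]
  rw [List.nodup_append]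
  exact ⟨Finset.sort_nodup _ _, Finset.sort_nodup _ _, fun a ha b hb =>
      (h a (by simpa using ha) b (by simpa using hb)).ne⟩

theorem wedge_smul (c : I → K) (X : I → M) (A : Finset I) :
    wedge K (fun i => c i • X i) A = (∏ i ∈ A, c i) • wedge K X A := by
  have h : ∀ l : List I, (l.map fun i => ExteriorAlgebra.ι K (c i • X i)).prod =
      (l.map c).prod • (l.map fun i => ExteriorAlgebra.ι K (X i)).prod := by
    intro l
    induction l with
    | nil => simp
    | cons a l ih =>
      rw [List.map_cons, List.prod_cons, ih, map_smul, smul_mul_smul_comm, List.map_cons,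
        List.prod_cons, List.map_cons, List.prod_cons]
  rw [wedge, h, wedge, ← Finset.prod_map_toList,
    ((A.sort_perm_toList (· ≤ ·)).map c).prod_eq]

theorem involute_wedge (X : I → M) (A : Finset I) :
    CliffordAlgebra.involute (wedge K X A) = (-1 : K) ^ A.card • wedge K X A := by
  have h : ∀ l : List I,
      CliffordAlgebra.involute ((l.map fun i => ExteriorAlgebra.ι K (X i)).prod) =
      (-1 : K) ^ l.length • (l.map fun i => ExteriorAlgebra.ι K (X i)).prod := by
    intro l
    induction l with
    | nil => simp
    | cons a l ih =>
      have := CliffordAlgebra.involute_ι (Q := (0 : QuadraticForm K M)) (X a)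
      rw [List.map_cons, List.prod_cons, map_mul, ih, List.length_cons, pow_succ']
      -- The exterior algebra is the Clifford algebra of the zero form, and the rewriting has to see
      -- through that definition.
      erw [this]
      simp
  rw [wedge, h, Finset.length_sort]

/-- Graded commutativity with the sign carried by the grading involution, so that `a` need not be
homogeneous. The claim is stable under sums and products in `a`, hence reduces to anticommutation of
vectors. -/
theorem ι_mul_eq_involute_mul (m : M) (a : ExteriorAlgebra K M) :
    ExteriorAlgebra.ι K m * a = CliffordAlgebra.involute a * ExteriorAlgebra.ι K m := by
  induction a using ExteriorAlgebra.induction with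
  | algebraMap r =>
    rw [AlgHom.commutes, Algebra.commutes]
  | ι x =>
    have := CliffordAlgebra.involute_ι (Q := (0 : QuadraticForm K M)) x
    erw [this]
    have h := ExteriorAlgebra.ι_add_mul_swap (R := K) m x
    rw [neg_mul]
    exact eq_neg_of_add_eq_zero_left h
  | mul a b ha hb => rw [map_mul, ← mul_assoc, ha, mul_assoc, hb, mul_assoc]
  | add a b ha hb => rw [map_add, mul_add, add_mul, ha, hb]

/-- Parity is recorded as an eigenvalue of the involution, which is all that a commutation sign
needs. -/
theorem wedge_mul_of_involute (X : I → M) (A : Finset I) (a : ExteriorAlgebra K M) (e : ℕ)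
    (ha : CliffordAlgebra.involute a = (-1 : K) ^ e • a) :
    wedge K X A * a = (-1 : K) ^ (e * A.card) • (a * wedge K X A) := by
  have h : ∀ l : List I, (l.map fun i => ExteriorAlgebra.ι K (X i)).prod * a =
      (-1 : K) ^ (e * l.length) • (a * (l.map fun i => ExteriorAlgebra.ι K (X i)).prod) := by
    intro l
    induction l with
    | nil => simp
    | cons b l ih =>
      rw [List.map_cons, List.prod_cons, mul_assoc, ih, mul_smul_comm, ← mul_assoc,
        ι_mul_eq_involute_mul, ha, smul_mul_assoc, smul_mul_assoc, smul_smul, List.length_cons,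
        mul_assoc, mul_add, mul_one, pow_add]
  rw [wedge, h, Finset.length_sort]

end Wedge

section Ev

variable (p : ℕ) [Fact p.Prime] {K M : Type*} [Field K] [Algebra (ZMod p) K] [AddCommGroup M]
  [Module K M] [Module (ZMod p) M] [IsScalarTower (ZMod p) K M]

/-- The homomorphism `E(I) ⊗ P(I) → Λ_K(M)` with `o_i ↦ X i` and `w_i ↦ y i`. -/
noncomputable def ev {I : Type} [Fintype I] (X : I → M) (y : I → K) :
    FreeGC p I →ₐ[ZMod p] ExteriorAlgebra K M :=
  Algebra.TensorProduct.lift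
    (ExteriorAlgebra.lift (ZMod p)
      ⟨((ExteriorAlgebra.ι K).restrictScalars (ZMod p)).comp
        (Fintype.linearCombination (ZMod p) X), fun _ => ExteriorAlgebra.ι_sq_zero _⟩)
    (((Algebra.ofId K (ExteriorAlgebra K M)).restrictScalars (ZMod p)).comp (MvPolynomial.aeval y))
    (fun _ f => (Algebra.commutes (MvPolynomial.aeval y f) _).symm)

variable {I : Type} [Fintype I]

@[simp]
theorem ev_poly (X : I → M) (y : I → K) (f : MvPolynomial I (ZMod p)) :
    ev p X y (poly f) = algebraMap K _ (MvPolynomial.aeval y f) := by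
  refine (Algebra.TensorProduct.lift_tmul _ _ _ _ _).trans ?_
  rw [map_one, one_mul]
  rfl

theorem ev_ι (X : I → M) (y : I → K) (v : I → ZMod p) :
    ev p X y (ExteriorAlgebra.ι (ZMod p) v ⊗ₜ[ZMod p] 1) =
      ExteriorAlgebra.ι K (∑ i, v i • X i) := by
  refine (Algebra.TensorProduct.lift_tmul _ _ _ _ _).trans ?_
  rw [map_one, mul_one]
  exact ExteriorAlgebra.lift_ι_apply _ _ _ _

@[simp]
theorem ev_odd [DecidableEq I] (X : I → M) (y : I → K) (i : I) :
    ev p X y (odd p i) = ExteriorAlgebra.ι K (X i) := by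
  rw [odd, ev_ι]
  simp [Pi.single_apply]

variable {p} in
theorem freeGC_hom_ext [DecidableEq I] {B : Type*} [Ring B] [Algebra (ZMod p) B]
    {f g : FreeGC p I →ₐ[ZMod p] B} (ho : ∀ i, f (odd p i) = g (odd p i))
    (hw : ∀ i, f (poly (MvPolynomial.X i)) = g (poly (MvPolynomial.X i))) : f = g := by
  refine Algebra.TensorProduct.ext ?_ ?_
  · refine ExteriorAlgebra.hom_ext ?_
    refine (Pi.basisFun (ZMod p) I).ext fun i => ?_
    simpa [odd] using ho i
  · refine MvPolynomial.algHom_ext fun i => ?_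
    simpa [poly] using hw i

theorem ev_monomialBasis [LinearOrder I] (X : I → M) (y : I → K) (c : Finset I × (I →₀ ℕ)) :
    ev p X y (monomialBasis p I c) = (∏ i, y i ^ c.2 i) • wedge K X c.1 := by
  have h1 : (monomialBasis p I c : FreeGC p I) =
      ((Pi.basisFun (ZMod p) I).ExteriorAlgebra c.1 ⊗ₜ[ZMod p] 1) *
        poly (MvPolynomial.monomial c.2 1) := by
    refine (Module.Basis.tensorProduct_apply' _ _ _).trans ?_
    rw [poly, Algebra.TensorProduct.tmul_mul_tmul, mul_one, one_mul, MvPolynomial.coe_basisMonomials]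
  rw [h1, map_mul, ev_poly, basis_exteriorAlgebra_apply]
  have h2 : ∀ l : List I, ev p X y ((l.map fun i => ExteriorAlgebra.ι (ZMod p)
      (Pi.basisFun (ZMod p) I i)).prod ⊗ₜ[ZMod p] 1) =
      (l.map fun i => ExteriorAlgebra.ι K (X i)).prod := by
    intro l
    induction l with
    | nil => simp only [List.map_nil, List.prod_nil]; exact map_one _
    | cons a l ih =>
      rw [List.map_cons, List.prod_cons, List.map_cons, List.prod_cons, ← ih]
      have := ev_odd p X y a
      rw [odd] at this
      rw [← this, ← map_mul, Algebra.TensorProduct.tmul_mul_tmul, mul_one, Pi.basisFun_apply]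
  rw [wedge, h2, ← wedge, ← Algebra.commutes, ← Algebra.smul_def, MvPolynomial.aeval_monomial,
    Finsupp.prod_fintype _ _ (by simp)]
  simp

-- The family is a basis of its span, and over a field the inclusion of a subspace induces an
-- injection of exterior algebras.
omit [Fintype I] in
theorem linearIndependent_wedge [LinearOrder I] {X : I → M} (hX : LinearIndependent K X) :
    LinearIndependent K (wedge K X) := by
  set W := Submodule.span K (Set.range X)
  set b := Module.Basis.span hX
  have h1 := b.ExteriorAlgebra.linearIndependent
  have h2 := h1.map' (ExteriorAlgebra.map W.subtype).toLinearMap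
    (LinearMap.ker_eq_bot.mpr (ExteriorAlgebra.map_injective_field (by simp)))
  have h3 : wedge K X = (ExteriorAlgebra.map W.subtype).toLinearMap ∘ b.ExteriorAlgebra := by
    ext A
    rw [Function.comp_apply, basis_exteriorAlgebra_apply, wedge, wedge, AlgHom.toLinearMap_apply,
      map_list_prod, List.map_map]
    congr 2
    ext i
    simp [b, W, Module.Basis.span_apply]
  rw [h3]
  exact h2

theorem linearIndependent_prod_pow {y : I → K} (hy : AlgebraicIndependent (ZMod p) y) :
    LinearIndependent (ZMod p) (fun b : I →₀ ℕ => ∏ i, y i ^ b i) := by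
  have h1 := (MvPolynomial.basisMonomials I (ZMod p)).linearIndependent
  have h2 := h1.map' (MvPolynomial.aeval y).toLinearMap (LinearMap.ker_eq_bot.mpr hy)
  have h3 : (fun b : I →₀ ℕ => ∏ i, y i ^ b i) = (MvPolynomial.aeval (R := ZMod p) y).toLinearMap ∘
      MvPolynomial.basisMonomials I (ZMod p) := by
    ext b
    simp [MvPolynomial.aeval_monomial, Finsupp.prod_fintype]
  rw [h3]
  exact h2

/-- The scalars y^b are independent over 𝔽_p and the wedges are independent over K, so their
products are independent over 𝔽_p. Identities in E(I) ⊗ P(I) may therefore be tested where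
denominators are available. -/
theorem ev_injective [LinearOrder I] {X : I → M} {y : I → K} (hX : LinearIndependent K X)
    (hy : AlgebraicIndependent (ZMod p) y) :
    Function.Injective (ev p X y : FreeGC p I →ₐ[ZMod p] ExteriorAlgebra K M) := by
  have h := linearIndependent_smul (linearIndependent_prod_pow p hy) (linearIndependent_wedge hX)
  have h3 : LinearIndependent (ZMod p) ((ev p X y).toLinearMap ∘ monomialBasis p I) := by
    have h4 := h.comp (fun c : Finset I × (I →₀ ℕ) => (c.2, c.1)) Prod.swap_injective
    have h5 : (ev p X y).toLinearMap ∘ monomialBasis p I =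
        (fun c : (I →₀ ℕ) × Finset I => (∏ i, y i ^ c.1 i) • wedge K X c.2) ∘
          (fun c : Finset I × (I →₀ ℕ) => (c.2, c.1)) := by
      ext c
      exact ev_monomialBasis p X y c
    rw [h5]
    exact h4
  rw [← AlgHom.coe_toLinearMap, ← LinearMap.ker_eq_bot, LinearMap.ker_eq_bot']
  intro z hz
  rw [← (monomialBasis p I).linearCombination_repr z, Finsupp.apply_linearCombination] at hz
  have := h3 (hz.trans (map_zero _).symm)
  simpa using this

end Ev

/-! ### Bihomogeneous elements -/

section Bihom

variable {p : ℕ} {I : Type} [DecidableEq I]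

omit [DecidableEq I] in
theorem poly_mul (f g : MvPolynomial I (ZMod p)) : poly (f * g) = poly f * poly g :=
  map_mul (Algebra.TensorProduct.includeRight :
      MvPolynomial I (ZMod p) →ₐ[ZMod p] FreeGC p I) f g

omit [DecidableEq I] in
theorem poly_one : poly (1 : MvPolynomial I (ZMod p)) = 1 := rfl

omit [DecidableEq I] in
theorem poly_pow (f : MvPolynomial I (ZMod p)) (k : ℕ) : poly (f ^ k) = poly f ^ k :=
  map_pow (Algebra.TensorProduct.includeRight :
      MvPolynomial I (ZMod p) →ₐ[ZMod p] FreeGC p I) f k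

omit [DecidableEq I] in
theorem poly_sum {ι : Type*} (s : Finset ι) (f : ι → MvPolynomial I (ZMod p)) :
    poly (∑ i ∈ s, f i) = ∑ i ∈ s, poly (f i) :=
  map_sum (Algebra.TensorProduct.includeRight :
      MvPolynomial I (ZMod p) →ₐ[ZMod p] FreeGC p I) f s

/-- The elements of `E(I) ⊗ P(I)` of degree `a` in the odd and of degree `b` in the even
generators. -/
inductive IsBihom : ℕ → ℕ → FreeGC p I → Prop
  | zero (a b : ℕ) : IsBihom a b 0
  | add {a b : ℕ} {z w : FreeGC p I} : IsBihom a b z → IsBihom a b w → IsBihom a b (z + w)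
  | smul {a b : ℕ} {z : FreeGC p I} (c : ZMod p) : IsBihom a b z → IsBihom a b (c • z)
  | one : IsBihom 0 0 1
  | odd (i : I) : IsBihom 1 0 (odd p i)
  | X (i : I) : IsBihom 0 1 (poly (MvPolynomial.X i))
  | mul {a b a' b' : ℕ} {z w : FreeGC p I} : IsBihom a b z → IsBihom a' b' w →
      IsBihom (a + a') (b + b') (z * w)

theorem IsBihom.sum {ι : Type*} {a b : ℕ} (s : Finset ι) (f : ι → FreeGC p I)
    (h : ∀ i ∈ s, IsBihom a b (f i)) : IsBihom a b (∑ i ∈ s, f i) := by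
  classical
  induction s using Finset.induction_on with
  | empty => simpa using IsBihom.zero a b
  | insert i s hi ih =>
    rw [Finset.sum_insert hi]
    exact (h i (by simp)).add (ih fun j hj => h j (by simp [hj]))

theorem IsBihom.pow {a b : ℕ} {z : FreeGC p I} (h : IsBihom a b z) (k : ℕ) :
    IsBihom (k * a) (k * b) (z ^ k) := by
  induction k with
  | zero => simpa using IsBihom.one
  | succ k ih =>
    rw [pow_succ, add_mul, add_mul, one_mul, one_mul]
    exact ih.mul h

theorem IsBihom.poly {f : MvPolynomial I (ZMod p)} {b : ℕ} (hf : f.IsHomogeneous b) :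
    IsBihom 0 b (poly f) := by
  rw [f.as_sum, poly_sum]
  refine IsBihom.sum _ _ fun d hd => ?_
  have hdb : d.degree = b := by
    have := hf (MvPolynomial.mem_support_iff.1 hd)
    rwa [Finsupp.degree_eq_weight_one]
  rw [← hdb]
  have h1 : ModularInvariants.poly (MvPolynomial.monomial d (f.coeff d)) =
      f.coeff d • ModularInvariants.poly (MvPolynomial.monomial d (1 : ZMod p)) := by
    rw [ModularInvariants.poly, ModularInvariants.poly, ← TensorProduct.tmul_smul,
      MvPolynomial.smul_monomial, smul_eq_mul, mul_one]
  rw [h1]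
  refine IsBihom.smul _ ?_
  clear h1 hdb hd hf
  induction d using Finsupp.induction with
  | zero =>
    rw [map_zero]
    exact IsBihom.one
  | single_add i k g hi hk ih =>
    rw [← one_mul (1 : ZMod p), ← MvPolynomial.monomial_mul, poly_mul, map_add]
    have h2 : IsBihom 0 k (ModularInvariants.poly (MvPolynomial.monomial (Finsupp.single i k)
        (1 : ZMod p))) := by
      rw [← MvPolynomial.X_pow_eq_monomial, poly_pow]
      simpa using (IsBihom.X (p := p) i).pow k
    simpa using h2.mul ih

variable [Fact p.Prime] [Fintype I] {K M : Type*} [Field K] [Algebra (ZMod p) K]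
  [AddCommGroup M] [Module K M] [Module (ZMod p) M] [IsScalarTower (ZMod p) K M]

/-- The rescaling between the coaction and the pair (U, V) has different factors on odd and even
generators; this is why a bidegree is used instead of the total degree. -/
theorem IsBihom.ev_smul {a b : ℕ} {z : FreeGC p I} (hz : IsBihom a b z) (c d : K) (X : I → M)
    (y : I → K) :
    ev p (fun i => c • X i) (fun i => d * y i) z = (c ^ a * d ^ b) • ev p X y z := by
  induction hz with
  | zero a b => simp only [map_zero, smul_zero]
  | add _ _ h1 h2 => rw [map_add, map_add, h1, h2, smul_add]
  | smul e _ h => rw [map_smul, map_smul, h, smul_comm]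
  | one => simp only [map_one, pow_zero, mul_one, one_smul]
  | odd i => rw [ev_odd, ev_odd, map_smul, pow_one, pow_zero, mul_one]
  | X i =>
    rw [ev_poly, ev_poly, MvPolynomial.aeval_X, MvPolynomial.aeval_X, map_mul, pow_one, pow_zero,
      one_mul, Algebra.smul_def]
  | mul _ _ h1 h2 =>
    rw [map_mul, map_mul, h1, h2, smul_mul_smul_comm]
    congr 1
    ring

end Bihom

/-! ### Components of the target of the coaction -/

section Components

variable {p : ℕ} [Fact p.Prime] {m N : ℕ}

/-- The coefficient of `τ_S ξ^R`. -/
noncomputable def component (S : Finset (Fin m)) (R : Fin m → ℕ) :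
    CoactionTarget p m N →ₗ[ZMod p] H p N :=
  (monomialBasis p (Fin N)).repr.symm.toLinearMap ∘ₗ
    (Finsupp.lcomapDomain (joinIndex S R) (joinIndex_injective S R)) ∘ₗ
      (monomialBasis p (Fin m ⊕ₗ Fin N)).repr.toLinearMap

theorem St_eq_component (S : Finset (Fin m)) (R : Fin m → ℕ) (z : H p N) :
    St S R z = component S R (coaction p m N z) := rfl

theorem repr_component (S : Finset (Fin m)) (R : Fin m → ℕ) (w : CoactionTarget p m N)
    (c : Finset (Fin N) × (Fin N →₀ ℕ)) :
    (monomialBasis p (Fin N)).repr (component S R w) c =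
      (monomialBasis p (Fin m ⊕ₗ Fin N)).repr w (joinIndex S R c) := by
  simp only [component, LinearMap.comp_apply, LinearEquiv.coe_coe, LinearEquiv.apply_symm_apply]
  rfl

theorem joinIndex_inj {S S' : Finset (Fin m)} {R R' : Fin m → ℕ}
    {c c' : Finset (Fin N) × (Fin N →₀ ℕ)} (h : joinIndex S R c = joinIndex S' R' c') :
    S = S' ∧ R = R' ∧ c = c' := by
  have h' := h
  rw [joinIndex, joinIndex, Prod.mk.injEq] at h
  obtain ⟨h₁, h₂⟩ := h
  have h₃ := Finset.map_injective _ h₁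
  have h₄ := Finsupp.equivFunOnFinite.symm.injective h₂
  have hS : S = S' := by
    ext a
    have := congrArg (fun s => Sum.inl a ∈ s) h₃
    simpa using this
  have hR : R = R' := by
    ext a
    simpa using congrFun h₄ (toLex (Sum.inl a))
  subst hS hR
  exact ⟨rfl, rfl, joinIndex_injective _ _ h'⟩

theorem exists_joinIndex (d : Finset (Fin m ⊕ₗ Fin N) × ((Fin m ⊕ₗ Fin N) →₀ ℕ)) :
    ∃ (S : Finset (Fin m)) (R : Fin m → ℕ) (c : Finset (Fin N) × (Fin N →₀ ℕ)),
      d = joinIndex S R c := by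
  refine ⟨Finset.univ.filter fun i => toLex (Sum.inl i) ∈ d.1, fun i => d.2 (toLex (Sum.inl i)),
    (Finset.univ.filter fun i => toLex (Sum.inr i) ∈ d.1,
      Finsupp.equivFunOnFinite.symm fun i => d.2 (toLex (Sum.inr i))), Prod.ext ?_ ?_⟩
  · ext a
    obtain ⟨a, rfl⟩ := toLex.surjective a
    rcases a with a | a <;> simp [joinIndex]
  · ext a
    obtain ⟨a, rfl⟩ := toLex.surjective a
    rcases a with a | a <;> simp [joinIndex]

theorem component_monomialBasis_self (S : Finset (Fin m)) (R : Fin m → ℕ)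
    (c : Finset (Fin N) × (Fin N →₀ ℕ)) :
    component S R (monomialBasis p (Fin m ⊕ₗ Fin N) (joinIndex S R c)) =
      monomialBasis p (Fin N) c := by
  apply (monomialBasis p (Fin N)).repr.injective
  ext c'
  rw [repr_component, Module.Basis.repr_self, Module.Basis.repr_self, Finsupp.single_apply,
    Finsupp.single_apply]
  simp only [(joinIndex_injective S R).eq_iff]

theorem component_monomialBasis_of_ne {S S' : Finset (Fin m)} {R R' : Fin m → ℕ}
    (c : Finset (Fin N) × (Fin N →₀ ℕ)) (h : (S', R') ≠ (S, R)) :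
    component S' R' (monomialBasis p (Fin m ⊕ₗ Fin N) (joinIndex S R c)) = 0 := by
  apply (monomialBasis p (Fin N)).repr.injective
  ext c'
  rw [repr_component, Module.Basis.repr_self, Finsupp.single_apply, if_neg, map_zero]
  · rfl
  · intro h'
    obtain ⟨h1, h2, -⟩ := joinIndex_inj h'
    exact h (Prod.ext h1.symm h2.symm)

variable {K M : Type*} [Field K] [Algebra (ZMod p) K]
  [AddCommGroup M] [Module K M] [Module (ZMod p) M] [IsScalarTower (ZMod p) K M]

theorem ev_monomialBasis_joinIndex (X : Fin m ⊕ₗ Fin N → M) (y : Fin m ⊕ₗ Fin N → K)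
    (S : Finset (Fin m)) (R : Fin m → ℕ) (c : Finset (Fin N) × (Fin N →₀ ℕ)) :
    ev p X y (monomialBasis p _ (joinIndex S R c)) =
      (∏ i, y (toLex (Sum.inl i)) ^ R i) • (wedge K (fun i => X (toLex (Sum.inl i))) S *
        ev p (fun i => X (toLex (Sum.inr i))) (fun i => y (toLex (Sum.inr i)))
          (monomialBasis p _ c)) := by
  rw [ev_monomialBasis, ev_monomialBasis, mul_smul_comm, smul_smul]
  congr 1
  · rw [← toLex.prod_comp, Fintype.prod_sum_type]
    simp [joinIndex]
  · let fl : Fin m ↪o Fin m ⊕ₗ Fin N :=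
      OrderEmbedding.ofStrictMono (fun i => toLex (Sum.inl i)) fun a b h =>
        Sum.Lex.inl_lt_inl_iff.2 h
    let fr : Fin N ↪o Fin m ⊕ₗ Fin N :=
      OrderEmbedding.ofStrictMono (fun i => toLex (Sum.inr i)) fun a b h =>
        Sum.Lex.inr_lt_inr_iff.2 h
    have hl : ∀ i, fl i = toLex (Sum.inl i) := fun _ => rfl
    have hr : ∀ i, fr i = toLex (Sum.inr i) := fun _ => rfl
    rw [wedge_eq_mul_of_lt K X (A := S.map fl.toEmbedding) (B := c.1.map fr.toEmbedding),
      ← wedge_comp, ← wedge_comp]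
    · rfl
    · intro a
      obtain ⟨a, rfl⟩ := toLex.surjective a
      rcases a with a | a <;> simp [joinIndex, hl, hr]
    · intro a ha b hb
      simp only [Finset.mem_map] at ha hb
      obtain ⟨a, -, rfl⟩ := ha
      obtain ⟨b, -, rfl⟩ := hb
      exact Sum.Lex.inl_lt_inr a b

/-- There are infinitely many possible R, so the decomposition is stated for all sufficiently large
finite index sets; in this form it passes to sums of elements by taking unions. -/
theorem exists_ev_eq_sum_component (X : Fin m ⊕ₗ Fin N → M) (y : Fin m ⊕ₗ Fin N → K)
    (w : CoactionTarget p m N) :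
    ∃ T₀ : Finset (Finset (Fin m) × (Fin m → ℕ)), ∀ T, T₀ ⊆ T → ev p X y w =
      ∑ c ∈ T, (∏ i, y (toLex (Sum.inl i)) ^ c.2 i) •
        (wedge K (fun i => X (toLex (Sum.inl i))) c.1 *
          ev p (fun i => X (toLex (Sum.inr i))) (fun i => y (toLex (Sum.inr i)))
            (component c.1 c.2 w)) := by
  classical
  obtain ⟨f, rfl⟩ := (monomialBasis p (Fin m ⊕ₗ Fin N)).repr.symm.surjective w
  induction f using Finsupp.induction_linear with
  | zero => exact ⟨∅, fun T _ => by simp only [map_zero, mul_zero, smul_zero, Finset.sum_const_zero]⟩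
  | add f g hf hg =>
    obtain ⟨T₁, h₁⟩ := hf
    obtain ⟨T₂, h₂⟩ := hg
    refine ⟨T₁ ∪ T₂, fun T hT => ?_⟩
    rw [map_add, map_add, h₁ T (Finset.union_subset_left hT), h₂ T (Finset.union_subset_right hT),
      ← Finset.sum_add_distrib]
    refine Finset.sum_congr rfl fun c _ => ?_
    rw [map_add, map_add, mul_add, smul_add]
  | single d a =>
    obtain ⟨S, R, c, rfl⟩ := exists_joinIndex d
    refine ⟨{(S, R)}, fun T hT => ?_⟩
    rw [Module.Basis.repr_symm_single, map_smul, ev_monomialBasis_joinIndex,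
      Finset.sum_eq_single (S, R)]
    · simp only
      rw [map_smul, component_monomialBasis_self, map_smul, mul_smul_comm, smul_comm]
    · rintro ⟨S', R'⟩ - hne
      simp only
      rw [map_smul, component_monomialBasis_of_ne c hne, smul_zero, map_zero, mul_zero, smul_zero]
    · exact fun h => absurd (hT (by simp)) h

theorem ev_eq_sum_component (X : Fin m ⊕ₗ Fin N → M) (y : Fin m ⊕ₗ Fin N → K)
    (w : CoactionTarget p m N) (T : Finset (Fin m) → Finset (Fin m → ℕ))
    (hT : ∀ S R, R ∉ T S → component S R w = 0) :
    ev p X y w = ∑ S, ∑ R ∈ T S, (∏ i, y (toLex (Sum.inl i)) ^ R i) •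
        (wedge K (fun i => X (toLex (Sum.inl i))) S *
          ev p (fun i => X (toLex (Sum.inr i))) (fun i => y (toLex (Sum.inr i)))
            (component S R w)) := by
  classical
  obtain ⟨T₀, h⟩ := exists_ev_eq_sum_component X y w
  have hu : T₀ ⊆ T₀ ∪ Finset.univ.biUnion fun S => (T S).image fun R => (S, R) :=
    Finset.subset_union_left
  rw [h _ hu, Finset.sum_sigma']
  symm
  refine Finset.sum_bij_ne_zero (fun c _ _ => (c.1, c.2)) ?_ ?_ ?_ ?_
  · intro c hc _
    simp only [Finset.mem_sigma, Finset.mem_univ, true_and] at hc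
    simp only [Finset.mem_union, Finset.mem_biUnion, Finset.mem_univ, true_and, Finset.mem_image]
    exact Or.inr ⟨c.1, c.2, hc, rfl⟩
  · rintro ⟨S, R⟩ _ _ ⟨S', R'⟩ _ _ h
    simpa using h
  · rintro ⟨S, R⟩ _ hne
    refine ⟨⟨S, R⟩, ?_, hne, rfl⟩
    simp only [Finset.mem_sigma, Finset.mem_univ, true_and]
    by_contra hR
    apply hne
    simp only [hT S R hR, map_zero, mul_zero, smul_zero]
  · intros; rfl

/-- Both sides are algebra homomorphisms in `z` and agree on generators. This turns the generating
function of the operations into a substitution. -/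
theorem ev_coaction (X : Fin m ⊕ₗ Fin N → M) (y : Fin m ⊕ₗ Fin N → K) (z : H p N) :
    ev p X y (coaction p m N z) =
      ev p (fun j : Fin N => X (toLex (Sum.inr j)) +
          ∑ i : Fin m, y (toLex (Sum.inr j)) ^ p ^ (i : ℕ) • X (toLex (Sum.inl i)))
        (fun j : Fin N => y (toLex (Sum.inr j)) + ∑ i : Fin m, y (toLex (Sum.inl i)) *
          y (toLex (Sum.inr j)) ^ p ^ ((i : ℕ) + 1)) z := by
  rw [← AlgHom.comp_apply]
  congr 1
  refine freeGC_hom_ext (fun j => ?_) fun j => ?_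
  · have h1 : coaction p m N (odd p j) = oddPart p _ (coactionX p m N (Pi.single j 1)) := by
      refine (Algebra.TensorProduct.lift_tmul _ _ _ _ _).trans ?_
      rw [map_one, mul_one]
      exact ExteriorAlgebra.lift_ι_apply _ _ _ _
    have h2 : ∀ v q, ev p X y (oddPart p (Fin m ⊕ₗ Fin N) (v ⊗ₜ q)) =
        ExteriorAlgebra.ι K (MvPolynomial.aeval y q • ∑ i, v i • X i) := by
      intro v q
      have h3 : oddPart p (Fin m ⊕ₗ Fin N) (v ⊗ₜ q) =
          (ExteriorAlgebra.ι (ZMod p) v ⊗ₜ[ZMod p] 1) * poly q := by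
        rw [oddPart, TensorProduct.map_tmul, poly, Algebra.TensorProduct.tmul_mul_tmul, mul_one,
          one_mul, LinearMap.id_apply]
      rw [h3, map_mul, ev_ι, ev_poly, ← Algebra.commutes, ← Algebra.smul_def, map_smul]
    rw [AlgHom.comp_apply, h1, ev_odd, coactionX, Fintype.linearCombination_apply_single, one_smul,
      map_add, map_add, h2, map_sum, map_sum, map_add, map_sum]
    congr 1
    · simp [Pi.single_apply]
    · refine Finset.sum_congr rfl fun i _ => ?_
      rw [h2]
      simp [Pi.single_apply]
  · have h1 : coaction p m N (poly (MvPolynomial.X j)) =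
        poly (coactionY p m N (MvPolynomial.X j)) := by
      refine (Algebra.TensorProduct.lift_tmul _ _ _ _ _).trans ?_
      rw [map_one, one_mul]
      rfl
    rw [AlgHom.comp_apply, h1, ev_poly, ev_poly]
    simp [coactionY]

end Components

/-! ### The excess of the operations -/

theorem repr_exteriorAlgebra_eq_zero {R M I : Type*} [CommRing R] [AddCommGroup M] [Module R M]
    [LinearOrder I] (b : Module.Basis I R M) {a : ℕ} {u : ExteriorAlgebra R M}
    (hu : u ∈ ⋀[R]^a M) {A : Finset I} (hA : A.card ≠ a) : b.ExteriorAlgebra.repr u A = 0 := by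
  have h : ∀ x : ⋀[R]^a M, b.ExteriorAlgebra.repr (x : ExteriorAlgebra R M) A = 0 := by
    intro x
    have hx := (b.exteriorPower a).mem_span x
    induction hx using Submodule.span_induction with
    | mem x hx =>
      obtain ⟨s, rfl⟩ := hx
      rw [← ExteriorAlgebra.basis_eq_coe_basis, Module.Basis.repr_self, Finsupp.single_apply,
        if_neg]
      rintro rfl
      exact hA s.2
    | zero => simp
    | add x y _ _ hx hy =>
      rw [Submodule.coe_add, map_add, Finsupp.add_apply, hx, hy, add_zero]
    | smul c x _ hx =>
      rw [Submodule.coe_smul, map_smul, Finsupp.smul_apply, hx, smul_zero]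
  exact h ⟨u, hu⟩

section Excess

variable {p : ℕ} [Fact p.Prime] {m N : ℕ}

/-- The span of the elements of degree `a` in the odd generators and of degree at most `b` in the
`ξ_i`. -/
noncomputable def excessFiltration (p m N a b : ℕ) : Submodule (ZMod p) (CoactionTarget p m N) :=
  Submodule.span (ZMod p) {w | ∃ u ∈ ⋀[ZMod p]^a ((Fin m ⊕ₗ Fin N) → ZMod p),
    ∃ f : MvPolynomial (Fin m ⊕ₗ Fin N) (ZMod p),
      (∀ d ∈ f.support, ∑ i, d (toLex (Sum.inl i)) ≤ b) ∧ w = u ⊗ₜ f}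

theorem mul_mem_excessFiltration {a b a' b' : ℕ} {z w : CoactionTarget p m N}
    (hz : z ∈ excessFiltration p m N a b) (hw : w ∈ excessFiltration p m N a' b') :
    z * w ∈ excessFiltration p m N (a + a') (b + b') := by
  classical
  induction hz using Submodule.span_induction with
  | zero => rw [zero_mul]; exact Submodule.zero_mem _
  | add x y _ _ hx hy => rw [add_mul]; exact Submodule.add_mem _ hx hy
  | smul c x _ hx => rw [smul_mul_assoc]; exact Submodule.smul_mem _ _ hx
  | mem z hz =>
    obtain ⟨u, hu, f, hf, rfl⟩ := hz
    induction hw using Submodule.span_induction with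
    | zero => rw [mul_zero]; exact Submodule.zero_mem _
    | add x y _ _ hx hy => rw [mul_add]; exact Submodule.add_mem _ hx hy
    | smul c x _ hx => rw [mul_smul_comm]; exact Submodule.smul_mem _ _ hx
    | mem w hw =>
      obtain ⟨v, hv, g, hg, rfl⟩ := hw
      rw [Algebra.TensorProduct.tmul_mul_tmul]
      refine Submodule.subset_span ⟨_, ?_, _, fun d hd => ?_, rfl⟩
      · rw [ExteriorAlgebra.exteriorPower, pow_add]
        exact Submodule.mul_mem_mul hu hv
      · obtain ⟨d₁, h₁, d₂, h₂, rfl⟩ := Finset.mem_add.1 (MvPolynomial.support_mul f g hd)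
        simp only [Finsupp.add_apply, Finset.sum_add_distrib]
        exact add_le_add (hf _ h₁) (hg _ h₂)

/-- Every term of the image of x_j contains exactly one odd generator, τ_i or x_j, and no ξ; every
term of the image of y_j contains at most one ξ. Hence the odd degree is exact while the ξ-degree is
only bounded. -/
theorem coaction_mem_excessFiltration {a b : ℕ} {z : H p N} (hz : IsBihom a b z) :
    coaction p m N z ∈ excessFiltration p m N a b := by
  classical
  induction hz with
  | zero a b => rw [map_zero]; exact Submodule.zero_mem _
  | add _ _ h1 h2 => rw [map_add]; exact Submodule.add_mem _ h1 h2
  | smul c _ h => rw [map_smul]; exact Submodule.smul_mem _ _ h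
  | one =>
    rw [map_one]
    refine Submodule.subset_span ⟨1, ?_, 1, fun d hd => ?_, rfl⟩
    · rw [ExteriorAlgebra.exteriorPower, pow_zero]
      exact Submodule.one_le.1 le_rfl
    · have : d = 0 := by
        by_contra h
        exact (MvPolynomial.mem_support_iff.1 hd) (by rw [MvPolynomial.coeff_one, if_neg (Ne.symm h)])
      simp [this]
  | odd j =>
    have h1 : coaction p m N (odd p j) = oddPart p _ (coactionX p m N (Pi.single j 1)) := by
      refine (Algebra.TensorProduct.lift_tmul _ _ _ _ _).trans ?_
      rw [map_one, mul_one]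
      exact ExteriorAlgebra.lift_ι_apply _ _ _ _
    rw [h1, coactionX, Fintype.linearCombination_apply_single, one_smul, map_add, map_sum]
    have hι : ∀ v : (Fin m ⊕ₗ Fin N) → ZMod p, ExteriorAlgebra.ι (ZMod p) v ∈
        ⋀[ZMod p]^1 ((Fin m ⊕ₗ Fin N) → ZMod p) := by
      intro v
      rw [ExteriorAlgebra.exteriorPower, pow_one]
      exact LinearMap.mem_range_self _ _
    refine Submodule.add_mem _ ?_ (Submodule.sum_mem _ fun i _ => ?_)
    · refine Submodule.subset_span ⟨_, hι _, 1, fun d hd => ?_, rfl⟩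
      have : d = 0 := by
        by_contra h
        exact (MvPolynomial.mem_support_iff.1 hd) (by rw [MvPolynomial.coeff_one, if_neg (Ne.symm h)])
      simp [this]
    · refine Submodule.subset_span ⟨_, hι _, _, fun d hd => ?_, rfl⟩
      rw [LinearMap.id_apply, MvPolynomial.X_pow_eq_monomial] at hd
      have := Finset.mem_singleton.1 (MvPolynomial.support_monomial_subset hd)
      simp [this]
  | X j =>
    have h1 : coaction p m N (poly (MvPolynomial.X j)) =
        poly (coactionY p m N (MvPolynomial.X j)) := by
      refine (Algebra.TensorProduct.lift_tmul _ _ _ _ _).trans ?_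
      rw [map_one, one_mul]
      rfl
    rw [h1]
    refine Submodule.subset_span ⟨1, ?_, _, fun d hd => ?_, rfl⟩
    · rw [ExteriorAlgebra.exteriorPower, pow_zero]
      exact Submodule.one_le.1 le_rfl
    · rw [coactionY, MvPolynomial.aeval_X] at hd
      rcases Finset.mem_union.1 (MvPolynomial.support_add hd) with hd | hd
      · rw [MvPolynomial.support_X] at hd
        rw [Finset.mem_singleton.1 hd]
        simp
      · obtain ⟨i, -, hd⟩ := Finset.mem_biUnion.1 (MvPolynomial.support_sum hd)
        rw [MvPolynomial.X_pow_eq_monomial, MvPolynomial.X, MvPolynomial.monomial_mul] at hd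
        rw [Finset.mem_singleton.1 (MvPolynomial.support_monomial_subset hd)]
        simp [Finsupp.single_apply]
  | mul _ _ h1 h2 => rw [map_mul]; exact mul_mem_excessFiltration h1 h2

theorem repr_excessFiltration {a b : ℕ} {w : CoactionTarget p m N}
    (hw : w ∈ excessFiltration p m N a b)
    {d : Finset (Fin m ⊕ₗ Fin N) × ((Fin m ⊕ₗ Fin N) →₀ ℕ)}
    (hd : (monomialBasis p (Fin m ⊕ₗ Fin N)).repr w d ≠ 0) :
    d.1.card = a ∧ ∑ i, d.2 (toLex (Sum.inl i)) ≤ b := by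
  contrapose! hd
  induction hw using Submodule.span_induction with
  | zero => simp
  | add x y _ _ hx hy => rw [map_add, Finsupp.add_apply, hx, hy, add_zero]
  | smul c x _ hx => rw [map_smul, Finsupp.smul_apply, hx, smul_zero]
  | mem w hw =>
    obtain ⟨u, hu, f, hf, rfl⟩ := hw
    have h := Module.Basis.tensorProduct_repr_tmul_apply
      ((Pi.basisFun (ZMod p) (Fin m ⊕ₗ Fin N)).ExteriorAlgebra)
      (MvPolynomial.basisMonomials (Fin m ⊕ₗ Fin N) (ZMod p)) u f d.1 d.2
    refine h.trans ?_
    by_cases h1 : d.1.card = a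
    · have h2 : (MvPolynomial.basisMonomials (Fin m ⊕ₗ Fin N) (ZMod p)).repr f d.2 = 0 := by
        change f.coeff d.2 = 0
        by_contra h3
        exact absurd (hf _ (MvPolynomial.mem_support_iff.2 h3)) (not_le.2 (hd h1))
      rw [h2, zero_smul]
    · rw [repr_exteriorAlgebra_eq_zero _ hu h1, smul_zero]

theorem repr_St {a b : ℕ} {z : H p N} (hz : IsBihom a b z) {S : Finset (Fin m)} {R : Fin m → ℕ}
    {c : Finset (Fin N) × (Fin N →₀ ℕ)} (h : (monomialBasis p (Fin N)).repr (St S R z) c ≠ 0) :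
    S.card + c.1.card = a ∧ ∑ i, R i ≤ b := by
  rw [St_eq_component, repr_component] at h
  have := repr_excessFiltration (coaction_mem_excessFiltration hz) h
  simpa [joinIndex] using this

/-- For a class of degree a + 2b, this is the range in which the exponent of L̃ in the associated
monomial would be negative, so only genuine monomials survive in the expansions. -/
theorem St_eq_zero {a b : ℕ} {z : H p N} (hz : IsBihom a b z) {S : Finset (Fin m)} {R : Fin m → ℕ}
    (h : a + 2 * b < S.card + 2 * ∑ i, R i) : St S R z = 0 := by
  apply (monomialBasis p (Fin N)).repr.injective
  ext c
  rw [map_zero, Finsupp.zero_apply]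
  by_contra hc
  have := repr_St hz hc
  omega

variable {K M : Type*} [Field K] [Algebra (ZMod p) K]
  [AddCommGroup M] [Module K M] [Module (ZMod p) M] [IsScalarTower (ZMod p) K M]

/-- All monomials of St^{S,R} z have degree a - |S| in the x_j; the exponent a + |S| has the same
parity and avoids truncated subtraction. -/
theorem involute_ev_St {a b : ℕ} {z : H p N} (hz : IsBihom a b z) (S : Finset (Fin m))
    (R : Fin m → ℕ) (X : Fin N → M) (y : Fin N → K) :
    CliffordAlgebra.involute (ev p X y (St S R z)) =
      (-1 : K) ^ (a + S.card) • ev p X y (St S R z) := by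
  have h : ∀ w : H p N, (∀ c, (monomialBasis p (Fin N)).repr w c ≠ 0 → S.card + c.1.card = a) →
      CliffordAlgebra.involute (ev p X y w) = (-1 : K) ^ (a + S.card) • ev p X y w := by
    intro w hw
    rw [← (monomialBasis p (Fin N)).linearCombination_repr w, Finsupp.linearCombination_apply,
      Finsupp.sum, map_sum, map_sum, Finset.smul_sum]
    refine Finset.sum_congr rfl fun c hc => ?_
    rw [Finsupp.mem_support_iff] at hc
    have h1 := hw c hc
    rw [map_smul, ev_monomialBasis, ← algebraMap_smul K, map_smul, map_smul, involute_wedge]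
    have h2 : (-1 : K) ^ (a + S.card) = (-1) ^ c.1.card := by
      rw [← h1, add_right_comm, ← two_mul, pow_add, pow_mul]
      simp
    rw [h2, smul_comm ((-1 : K) ^ c.1.card), smul_comm ((-1 : K) ^ c.1.card)]
  exact h _ fun c hc => (repr_St hz hc).1

end Excess

/-! ### Moore determinants and additive polynomials -/

theorem coe_succAbove_eq_skip {n : ℕ} (i : Fin (n + 1)) (a : Fin n) :
    ((i.succAbove a : Fin (n + 1)) : ℕ) = skip i a := by
  unfold skip Fin.succAbove
  simp only [Fin.lt_def, Fin.val_castSucc]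
  split <;> simp

theorem skip_of_lt {s j : ℕ} (h : j < s) : skip s j = j := if_pos h

theorem skipCol_eq_succAbove {n : ℕ} (i : Fin (n + 1)) (b : Fin n) :
    skipCol i b = i.succAbove b := by
  ext
  rw [coe_succAbove_eq_skip]
  rfl

section Moore

variable (p : ℕ) {K M : Type*} [CommRing K] [AddCommGroup M] [Module K M] {n : ℕ}

/-- The value of `L_{n,s}` at `y_1, …, y_n`. -/
def lsval (y : Fin n → K) (s : ℕ) : K :=
  Matrix.det (Matrix.of fun j i : Fin n => y i ^ p ^ skip s j)

/-- The value of `L_n` at `y_1, …, y_n`. -/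
def lval (y : Fin n → K) : K := lsval p y n

/-- The value of `M_{n,s}` at `(x_1, y_1), …, (x_n, y_n)`. -/
def msval (X : Fin n → M) (y : Fin n → K) (s : ℕ) : M :=
  ∑ i : Fin n, (-1 : K) ^ (i : ℕ) • Matrix.det (Matrix.of fun a b : Fin (n - 1) =>
      y (skipCol i b) ^ p ^ skip s a) • X i

theorem msval_succ (X : Fin (n + 1) → M) (y : Fin (n + 1) → K) (s : ℕ) :
    msval p X y s = ∑ i : Fin (n + 1), (-1 : K) ^ (i : ℕ) •
      Matrix.det (Matrix.of fun a b : Fin n => y (skipCol i b) ^ p ^ skip s a) • X i := rfl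

theorem lval_eq (y : Fin n → K) :
    lval p y = Matrix.det (Matrix.of fun j i : Fin n => y i ^ p ^ (j : ℕ)) := by
  unfold lval lsval
  congr 2
  ext j i
  rw [skip_of_lt j.isLt]

theorem lval_zero (y : Fin 0 → K) : lval p y = 1 := by simp [lval_eq]

/-- Laplace expansion along the last column. -/
theorem lval_snoc (y : Fin n → K) (w : K) :
    lval p (Fin.snoc y w : Fin (n + 1) → K) =
      ∑ s : Fin (n + 1), (-1) ^ (n + (s : ℕ)) * lsval p y s * w ^ p ^ (s : ℕ) := by
  rw [lval_eq, Matrix.det_succ_column _ (Fin.last n)]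
  refine Finset.sum_congr rfl fun s _ => ?_
  have h : (Matrix.of fun j i : Fin (n + 1) =>
      (Fin.snoc y w : Fin (n + 1) → K) i ^ p ^ (j : ℕ)).submatrix s.succAbove
        (Fin.last n).succAbove = Matrix.of fun j i : Fin n => y i ^ p ^ skip s j := by
    ext a b
    simp [coe_succAbove_eq_skip]
  rw [h, ← lsval]
  simp only [Matrix.of_apply, Fin.snoc_last, Fin.val_last]
  ring

theorem sum_lsval_mul_pow_eq_zero (y : Fin n → K) (i : Fin n) :
    ∑ s : Fin (n + 1), (-1) ^ (n + (s : ℕ)) * lsval p y s * y i ^ p ^ (s : ℕ) = 0 := by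
  rw [← lval_snoc, lval_eq]
  refine Matrix.det_zero_of_column_eq (i := i.castSucc) (j := Fin.last n)
    (Fin.castSucc_lt_last i).ne fun j => ?_
  simp

/-- Two Laplace expansions: the cofactor of x is L_n, and each remaining minor still contains the
column of powers of w, along which it is expanded. -/
theorem msval_snoc (X : Fin n → M) (y : Fin n → K) (x : M) (w : K) :
    msval p (Fin.snoc X x : Fin (n + 1) → M) (Fin.snoc y w : Fin (n + 1) → K) n =
      (-1 : K) ^ n • (lval p y • x +
        ∑ j : Fin n, (-1 : K) ^ ((j : ℕ) + 1) • w ^ p ^ (j : ℕ) • msval p X y j) := by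
  rw [msval_succ, Fin.sum_univ_castSucc, smul_add, add_comm]
  congr 1
  · rw [Fin.snoc_last, Fin.val_last]
    congr 2
    rw [lval_eq]
    congr 2
    ext a b
    rw [skipCol_eq_succAbove, Fin.succAbove_last, Fin.snoc_castSucc]
    exact congrArg (fun e => y b ^ p ^ e) (skip_of_lt a.isLt)
  · obtain _ | n := n
    · simp
    · simp only [msval_succ, Finset.smul_sum]
      rw [Finset.sum_comm]
      refine Finset.sum_congr rfl fun i _ => ?_
      have h : Matrix.det (Matrix.of fun a b : Fin (n + 1) =>
          (Fin.snoc y w : Fin (n + 1 + 1) → K) (skipCol i.castSucc b) ^ p ^ skip (n + 1) a) =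
          ∑ j : Fin (n + 1), (-1) ^ ((j : ℕ) + n) * w ^ p ^ (j : ℕ) *
            Matrix.det (Matrix.of fun a b : Fin n => y (skipCol i b) ^ p ^ skip j a) := by
        refine (Matrix.det_succ_column (n := n) _ (Fin.last n)).trans ?_
        refine Finset.sum_congr rfl fun j _ => ?_
        congr 2
        · change (Fin.snoc y w : Fin (n + 1 + 1) → K) (skipCol i.castSucc (Fin.last n)) ^
            p ^ skip (n + 1) j = _
          rw [skip_of_lt j.isLt, skipCol_eq_succAbove, Fin.succAbove_of_le_castSucc, Fin.succ_last,
            Fin.snoc_last]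
          exact Fin.castSucc_le_castSucc_iff.2 (Fin.le_last i)
        · ext a b
          change (Fin.snoc y w : Fin (n + 1 + 1) → K)
            (skipCol i.castSucc ((Fin.last n).succAbove b)) ^ p ^ skip (n + 1) (j.succAbove a) = _
          rw [skip_of_lt (j.succAbove a).isLt, coe_succAbove_eq_skip, skipCol_eq_succAbove,
            Fin.succAbove_last, Fin.castSucc_succAbove_castSucc, Fin.snoc_castSucc]
          rw [← skipCol_eq_succAbove]
          rfl
      rw [h, Fin.snoc_castSucc, Finset.sum_smul, Finset.smul_sum]
      refine Finset.sum_congr rfl fun j _ => ?_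
      simp only [smul_smul, Fin.val_castSucc]
      congr 1
      ring

/-- This is adj(A) A = det(A) for the Moore matrix A. By `msval_snoc` it says that M_{n+1,n}
vanishes when its last pair repeats (x_i, y_i). -/
theorem lval_smul_add_sum_msval (X : Fin n → M) (y : Fin n → K) (i : Fin n) :
    lval p y • X i +
      ∑ j : Fin n, (-1 : K) ^ ((j : ℕ) + 1) • y i ^ p ^ (j : ℕ) • msval p X y j = 0 := by
  obtain _ | n := n
  · exact i.elim0
  set A : Matrix (Fin (n + 1)) (Fin (n + 1)) K := Matrix.of fun j i => y i ^ p ^ (j : ℕ) with hA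
  have hadj : ∀ l j, A.adjugate l j = (-1) ^ ((j : ℕ) + (l : ℕ)) *
      Matrix.det (Matrix.of fun a b : Fin n => y (skipCol l b) ^ p ^ skip j a) := by
    intro l j
    rw [Matrix.adjugate_fin_succ_eq_det_submatrix]
    congr 2
    ext a b
    simp [hA, coe_succAbove_eq_skip, skipCol_eq_succAbove]
  have h1 : ∀ l, ∑ j, A.adjugate l j * A j i = if l = i then lval p y else 0 := by
    intro l
    rw [← Matrix.mul_apply, Matrix.adjugate_mul, Matrix.smul_apply, Matrix.one_apply, lval_eq]
    simp [hA]
  have h2 : ∑ j : Fin (n + 1), (-1 : K) ^ ((j : ℕ) + 1) • y i ^ p ^ (j : ℕ) • msval p X y j =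
      - ∑ l, (∑ j, A.adjugate l j * A j i) • X l := by
    simp only [msval_succ, Finset.smul_sum, Finset.sum_smul]
    rw [Finset.sum_comm, ← Finset.sum_neg_distrib]
    refine Finset.sum_congr rfl fun l _ => ?_
    rw [← Finset.sum_neg_distrib]
    refine Finset.sum_congr rfl fun j _ => ?_
    rw [hadj, ← neg_smul]
    simp only [smul_smul, hA, Matrix.of_apply]
    congr 1
    ring
  rw [h2]
  simp [h1]

end Moore

/-! ### Additive polynomials and the composition laws of V. -/

section Additive

variable (p : ℕ) [Fact p.Prime] {K M : Type*} [Field K] [Algebra (ZMod p) K] [CharP K p]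
  [AddCommGroup M] [Module K M]

omit [CharP K p] in
/-- A polynomial whose evaluation is additive, which vanishes at more linearly independent points
over `𝔽_p` than its degree permits, is zero. -/
theorem eq_zero_of_additive {ι : Type*} [Fintype ι] {v : ι → K}
    (hv : LinearIndependent (ZMod p) v) {P : Polynomial K}
    (hadd : ∀ a b, P.eval (a + b) = P.eval a + P.eval b) (hP : ∀ i, P.eval (v i) = 0)
    (hdeg : P.natDegree < p ^ Fintype.card ι) : P = 0 := by
  classical
  -- Additivity is linearity over 𝔽_p, so all p^r combinations of r independent zeros are zeros.
  let F : K →ₗ[ZMod p] K := AddMonoidHom.toZModLinearMap p (AddMonoidHom.mk' (fun a => P.eval a) hadd)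
  have hF : ∀ a, F a = P.eval a := fun _ => rfl
  refine Polynomial.eq_zero_of_natDegree_lt_card_of_eval_eq_zero P
    (f := fun c : ι → ZMod p => ∑ i, c i • v i) ?_ ?_ ?_
  · exact fun c d h => linearIndependent_iff_injective_fintypeLinearCombination.1 hv (by
      simpa [Fintype.linearCombination_apply] using h)
  · intro c
    rw [← hF, map_sum]
    exact Finset.sum_eq_zero fun i _ => by rw [map_smul, hF, hP, smul_zero]
  · rwa [Fintype.card_fun, ZMod.card]

variable {n : ℕ}

omit [Algebra (ZMod p) K] in
theorem eval_sum_C_mul_X_pow_add {ι : Type*} (s : Finset ι) (c : ι → K) (e : ι → ℕ) (a b : K) :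
    (∑ j ∈ s, Polynomial.C (c j) * Polynomial.X ^ p ^ e j).eval (a + b) =
      (∑ j ∈ s, Polynomial.C (c j) * Polynomial.X ^ p ^ e j).eval a +
      (∑ j ∈ s, Polynomial.C (c j) * Polynomial.X ^ p ^ e j).eval b := by
  simp only [Polynomial.eval_finsetSum, Polynomial.eval_mul, Polynomial.eval_C,
    Polynomial.eval_pow, Polynomial.eval_X, ← Finset.sum_add_distrib, add_pow_char_pow, mul_add]

omit [Algebra (ZMod p) K] [CharP K p] in
theorem natDegree_sum_C_mul_X_pow_lt (c : Fin n → K) :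
    (∑ j, Polynomial.C (c j) * Polynomial.X ^ p ^ (j : ℕ)).natDegree < p ^ n := by
  have hp := (Fact.out : p.Prime).one_lt
  rcases Nat.eq_zero_or_pos n with rfl | hn
  · simp
  · refine (Polynomial.natDegree_sum_le_of_forall_le (n := p ^ (n - 1)) _ _ fun j _ => ?_).trans_lt
      (Nat.pow_lt_pow_right hp (by omega))
    refine (Polynomial.natDegree_C_mul_X_pow_le _ _).trans ?_
    exact Nat.pow_le_pow_right hp.le (by omega)

/-- A linear relation between the rows of the Moore matrix is an additive polynomial of degree below
p^n with n independent zeros. -/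
theorem lval_ne_zero {y : Fin n → K} (hy : LinearIndependent (ZMod p) y) : lval p y ≠ 0 := by
  rw [lval_eq]
  intro h
  obtain ⟨v, hv, h⟩ := Matrix.exists_vecMul_eq_zero_iff.2 h
  have hp := (Fact.out : p.Prime).one_lt
  have h0 := eq_zero_of_additive p hy
    (P := ∑ j : Fin n, Polynomial.C (v j) * Polynomial.X ^ p ^ (j : ℕ))
    (eval_sum_C_mul_X_pow_add p _ _ _) (fun i => by
      have := congrFun h i
      simpa [Matrix.vecMul, dotProduct, Polynomial.eval_finsetSum] using this)
    (by simpa using natDegree_sum_C_mul_X_pow_lt p v)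
  apply hv
  ext j
  have := congrArg (fun P => P.coeff (p ^ (j : ℕ))) h0
  simpa [Polynomial.finsetSum_coeff, Polynomial.coeff_X_pow, Nat.pow_right_inj hp,
    (Nat.pow_right_injective hp).eq_iff, Fin.val_inj] using this

/-- The value of `Q_{n,s}` at `y_1, …, y_n`. -/
noncomputable def qval (y : Fin n → K) (s : ℕ) : K := lsval p y s / lval p y

/-- The polynomial `V_{n+1}(y_1, …, y_n, X)`. -/
noncomputable def vpoly (y : Fin n → K) : Polynomial K :=
  ∑ s : Fin (n + 1), Polynomial.C ((-1) ^ (n + (s : ℕ)) * qval p y s) * Polynomial.X ^ p ^ (s : ℕ)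

/-- The value `V_{n+1}(y_1, …, y_n, w)`. -/
noncomputable def vval (y : Fin n → K) (w : K) : K := (vpoly p y).eval w

omit [Fact p.Prime] [Algebra (ZMod p) K] [CharP K p] in
theorem vval_eq (y : Fin n → K) (w : K) :
    vval p y w = ∑ s : Fin (n + 1), (-1) ^ (n + (s : ℕ)) * qval p y s * w ^ p ^ (s : ℕ) := by
  simp [vval, vpoly, Polynomial.eval_finsetSum]

omit [Fact p.Prime] [Algebra (ZMod p) K] [CharP K p] in
theorem lval_mul_vval {y : Fin n → K} (hy : lval p y ≠ 0) (w : K) :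
    lval p y * vval p y w = lval p (Fin.snoc y w : Fin (n + 1) → K) := by
  rw [vval_eq, lval_snoc, Finset.mul_sum]
  refine Finset.sum_congr rfl fun s _ => ?_
  rw [qval]
  field_simp

omit [Fact p.Prime] [Algebra (ZMod p) K] [CharP K p] in
theorem vval_self (y : Fin n → K) (i : Fin n) : vval p y (y i) = 0 := by
  have h := congrArg (· / lval p y) (sum_lsval_mul_pow_eq_zero p y i)
  simp only [zero_div, Finset.sum_div] at h
  rw [vval_eq, ← h]
  refine Finset.sum_congr rfl fun s _ => ?_
  rw [qval]
  ring

omit [Algebra (ZMod p) K] in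
theorem vval_add (y : Fin n → K) (a b : K) : vval p y (a + b) = vval p y a + vval p y b :=
  eval_sum_C_mul_X_pow_add p _ _ _ a b

omit [Algebra (ZMod p) K] in
theorem vval_zero (y : Fin n → K) : vval p y 0 = 0 := by
  have := vval_add p y 0 0
  simpa using this

theorem vval_sum_smul (y : Fin n → K) {ι : Type*} (s : Finset ι) (c : ι → ZMod p) (v : ι → K) :
    vval p y (∑ i ∈ s, c i • v i) = ∑ i ∈ s, c i • vval p y (v i) := by
  let F : K →ₗ[ZMod p] K :=
    AddMonoidHom.toZModLinearMap p (AddMonoidHom.mk' (vval p y) (vval_add p y))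
  exact (map_sum F _ _).trans (Finset.sum_congr rfl fun i _ => map_smul F _ _)

omit [Fact p.Prime] [Algebra (ZMod p) K] [CharP K p] in
theorem qval_self {y : Fin n → K} (hy : lval p y ≠ 0) : qval p y n = 1 := div_self hy

-- The rows of L_{n,0} are the p-th powers of those of L_n, so L_{n,0} = L_n^p by Frobenius.
omit [Algebra (ZMod p) K] in
theorem qval_zero {y : Fin n → K} (hy : lval p y ≠ 0) : qval p y 0 = lval p y ^ (p - 1) := by
  have hp := (Fact.out : p.Prime).one_lt
  have h : lsval p y 0 = lval p y ^ p := by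
    rw [lval_eq, ← frobenius_def, RingHom.map_det]
    unfold lsval
    congr 1
    ext j i
    simp [frobenius_def, skip, pow_succ, pow_mul]
  rw [qval, h, div_eq_iff hy, ← pow_succ, Nat.sub_add_cancel hp.le]

omit [Algebra (ZMod p) K] [CharP K p] in
theorem vpoly_monic_natDegree {y : Fin n → K} (hy : lval p y ≠ 0) :
    (vpoly p y).Monic ∧ (vpoly p y).natDegree = p ^ n := by
  have h : vpoly p y = Polynomial.X ^ p ^ n + ∑ s : Fin n,
      Polynomial.C ((-1) ^ (n + (s : ℕ)) * qval p y s) * Polynomial.X ^ p ^ (s : ℕ) := by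
    rw [vpoly, Fin.sum_univ_castSucc, add_comm]
    simp [qval_self p hy, ← two_mul]
  have hlt := natDegree_sum_C_mul_X_pow_lt p fun s : Fin n => (-1) ^ (n + (s : ℕ)) * qval p y s
  have hlt' := Polynomial.degree_le_natDegree.trans_lt (Nat.cast_lt.2 hlt)
  rw [h]
  refine ⟨Polynomial.monic_X_pow_add hlt', ?_⟩
  rw [Polynomial.natDegree_add_eq_left_of_natDegree_lt, Polynomial.natDegree_X_pow]
  rwa [Polynomial.natDegree_X_pow]

/-- The kernel of V_{n+1}(y, -) is no larger than the span of y: a vanishing combination of the z_j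
would be an (n+1)-st independent root of an additive polynomial of degree p^n. -/
theorem linearIndependent_vval {κ : Type*} [Fintype κ] {y : Fin n → K} {z : κ → K}
    (h : LinearIndependent (ZMod p) (Sum.elim y z)) :
    LinearIndependent (ZMod p) fun j => vval p y (z j) := by
  have hy : LinearIndependent (ZMod p) y := h.comp Sum.inl Sum.inl_injective
  have hp := (Fact.out : p.Prime).one_lt
  rw [Fintype.linearIndependent_iff]
  intro c hc
  rw [← vval_sum_smul] at hc
  by_contra hne
  have hspan : LinearIndependent (ZMod p)
      (Fin.snoc y (∑ j, c j • z j) : Fin (n + 1) → K) := by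
    rw [linearIndependent_finSnoc]
    refine ⟨hy, fun hmem => hne ?_⟩
    obtain ⟨d, hd⟩ := (Submodule.mem_span_range_iff_exists_fun (ZMod p)).1 hmem
    have := Fintype.linearIndependent_iff.1 h (Sum.elim d fun j => - c j) (by simp [hd])
    intro j
    simpa using this (Sum.inr j)
  have hz := eq_zero_of_additive p hspan (P := vpoly p y) (vval_add p y) (by
    intro i
    refine Fin.lastCases ?_ (fun i => ?_) i
    · rw [Fin.snoc_last]; exact hc
    · rw [Fin.snoc_castSucc]; exact vval_self p y i) (by
    rw [(vpoly_monic_natDegree p (lval_ne_zero p hy)).2, Fintype.card_fin]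
    exact Nat.pow_lt_pow_right hp (Nat.lt_succ_self n))
  exact (vpoly_monic_natDegree p (lval_ne_zero p hy)).1.ne_zero hz

omit [CharP K p] in
theorem eq_of_monic_additive {ι : Type*} [Fintype ι] {v : ι → K}
    (hv : LinearIndependent (ZMod p) v) {P P' : Polynomial K} (hP : P.Monic) (hP' : P'.Monic)
    (dP : P.natDegree = p ^ Fintype.card ι) (dP' : P'.natDegree = p ^ Fintype.card ι)
    (aP : ∀ a b, P.eval (a + b) = P.eval a + P.eval b)
    (aP' : ∀ a b, P'.eval (a + b) = P'.eval a + P'.eval b)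
    (rP : ∀ i, P.eval (v i) = 0) (rP' : ∀ i, P'.eval (v i) = 0) : P = P' := by
  refine sub_eq_zero.1 (eq_zero_of_additive p hv (fun a b => ?_) (fun i => ?_) ?_)
  · simp only [Polynomial.eval_sub, aP, aP']
    ring
  · rw [Polynomial.eval_sub, rP, rP', sub_zero]
  · have := Polynomial.degree_sub_lt_left (p := P) (q := P')
      (by rw [Polynomial.degree_eq_natDegree hP.ne_zero, Polynomial.degree_eq_natDegree hP'.ne_zero,
        dP, dP']) hP.ne_zero (by rw [hP.leadingCoeff, hP'.leadingCoeff])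
    rcases eq_or_ne (P - P') 0 with h0 | h0
    · rw [h0, Polynomial.natDegree_zero]
      exact Nat.pow_pos (Fact.out : p.Prime).pos
    · rw [← dP]
      exact Polynomial.natDegree_lt_natDegree h0 this

omit [CharP K p] in
theorem linearIndependent_sum_swap {ι κ : Type*} {y : ι → K} {z : κ → K}
    (h : LinearIndependent (ZMod p) (Sum.elim y z)) :
    LinearIndependent (ZMod p) (Sum.elim z y) := by
  have := h.comp Sum.swap Sum.swap_leftInverse.injective
  convert this using 1
  ext (i | i) <;> rfl

/-- As polynomials in w, both sides are monic and additive of degree p^(n+k) and vanish at all y_i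
and z_j; these properties determine the polynomial. -/
theorem vval_vval {k : ℕ} {y : Fin n → K} {z : Fin k → K}
    (h : LinearIndependent (ZMod p) (Sum.elim y z)) (w : K) :
    vval p (fun j => vval p y (z j)) (vval p y w) =
      vval p (fun i => vval p z (y i)) (vval p z w) := by
  have hp := (Fact.out : p.Prime).pos
  have hy : LinearIndependent (ZMod p) y := h.comp Sum.inl Sum.inl_injective
  have hz : LinearIndependent (ZMod p) z := h.comp Sum.inr Sum.inr_injective
  obtain ⟨m1, d1⟩ := vpoly_monic_natDegree p (lval_ne_zero p hy)
  obtain ⟨m2, d2⟩ := vpoly_monic_natDegree p (lval_ne_zero p hz)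
  obtain ⟨m3, d3⟩ := vpoly_monic_natDegree p (lval_ne_zero p (linearIndependent_vval p h))
  obtain ⟨m4, d4⟩ := vpoly_monic_natDegree p
    (lval_ne_zero p (linearIndependent_vval p (linearIndependent_sum_swap p h)))
  have hpos : ∀ m, 0 < p ^ m := fun m => Nat.pow_pos hp
  have key : (vpoly p fun j => vval p y (z j)).comp (vpoly p y) =
      (vpoly p fun i => vval p z (y i)).comp (vpoly p z) := by
    have e : ∀ (m m' : ℕ) (u : Fin m → K) (u' : Fin m' → K) (a : K),
        ((vpoly p u).comp (vpoly p u')).eval a = vval p u (vval p u' a) :=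
      fun m m' u u' a => Polynomial.eval_comp
    refine eq_of_monic_additive p h (m3.comp m1 (by rw [d1]; exact (hpos _).ne'))
      (m4.comp m2 (by rw [d2]; exact (hpos _).ne')) ?_ ?_ ?_ ?_ ?_ ?_
    · rw [Polynomial.natDegree_comp, d3, d1, ← pow_add, add_comm, Fintype.card_sum,
        Fintype.card_fin, Fintype.card_fin]
    · rw [Polynomial.natDegree_comp, d4, d2, ← pow_add, Fintype.card_sum,
        Fintype.card_fin, Fintype.card_fin]
    · intro a b; rw [e, e, e, vval_add, vval_add]
    · intro a b; rw [e, e, e, vval_add, vval_add]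
    · rintro (i | j)
      · rw [e, Sum.elim_inl, vval_self, vval_zero]
      · rw [e, Sum.elim_inr]
        exact vval_self p (fun j => vval p y (z j)) j
    · rintro (i | j)
      · rw [e, Sum.elim_inl]
        exact vval_self p (fun i => vval p z (y i)) i
      · rw [e, Sum.elim_inr, vval_self, vval_zero]
  have := congrArg (Polynomial.eval w) key
  rwa [Polynomial.eval_comp, Polynomial.eval_comp] at this

/-- Again uniqueness of the monic additive polynomial with given independent roots, here z_1, …,
z_n, w. -/
theorem vval_snoc {z : Fin n → K} {w : K}
    (h : LinearIndependent (ZMod p) (Fin.snoc z w : Fin (n + 1) → K)) (t : K) :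
    vval p (Fin.snoc z w : Fin (n + 1) → K) t =
      vval p (fun _ : Fin 1 => vval p z w) (vval p z t) := by
  have hz : LinearIndependent (ZMod p) z := (linearIndependent_finSnoc.1 h).1
  have hzw : LinearIndependent (ZMod p) (Sum.elim z fun _ : Fin 1 => w) := by
    have := h.comp (finSumFinEquiv : Fin n ⊕ Fin 1 ≃ Fin (n + 1)) (Equiv.injective _)
    convert this using 1
    ext (i | i)
    · simp only [Sum.elim_inl, Function.comp_apply, finSumFinEquiv_apply_left]
      exact (Fin.snoc_castSucc (α := fun _ => K) w z i).symm
    · simp only [Sum.elim_inr, Function.comp_apply, finSumFinEquiv_apply_right]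
      rw [Subsingleton.elim i 0]
      exact (Fin.snoc_last (α := fun _ => K) w z).symm
  obtain ⟨m1, d1⟩ := vpoly_monic_natDegree p (lval_ne_zero p h)
  obtain ⟨m2, d2⟩ := vpoly_monic_natDegree p (lval_ne_zero p hz)
  obtain ⟨m3, d3⟩ := vpoly_monic_natDegree p (lval_ne_zero p (linearIndependent_vval p hzw))
  have key : vpoly p (Fin.snoc z w : Fin (n + 1) → K) =
      (vpoly p fun _ : Fin 1 => vval p z w).comp (vpoly p z) := by
    have e : ∀ (m m' : ℕ) (u : Fin m → K) (u' : Fin m' → K) (a : K),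
        ((vpoly p u).comp (vpoly p u')).eval a = vval p u (vval p u' a) :=
      fun m m' u u' a => Polynomial.eval_comp
    refine eq_of_monic_additive p h m1
      (m3.comp m2 (by rw [d2]; exact (Nat.pow_pos (Fact.out : p.Prime).pos).ne')) ?_ ?_ ?_ ?_ ?_ ?_
    · rw [d1, Fintype.card_fin]
    · rw [Polynomial.natDegree_comp, d3, d2, ← pow_add, Fintype.card_fin, add_comm]
    · exact vval_add p _
    · intro a b; rw [e, e, e, vval_add, vval_add]
    · exact vval_self p _
    · intro i
      rw [e]
      refine Fin.lastCases ?_ (fun i => ?_) i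
      · rw [Fin.snoc_last]
        exact vval_self p (fun _ : Fin 1 => vval p z w) 0
      · rw [Fin.snoc_castSucc, vval_self, vval_zero]
  have := congrArg (Polynomial.eval t) key
  rwa [Polynomial.eval_comp] at this

theorem lval_mul_lval_vval_fin_one (a b : K) (ha : LinearIndependent (ZMod p) fun _ : Fin 1 => a)
    (hb : LinearIndependent (ZMod p) fun _ : Fin 1 => b) :
    lval p (fun _ : Fin 1 => a) * vval p (fun _ : Fin 1 => a) b =
      -(lval p (fun _ : Fin 1 => b) * vval p (fun _ : Fin 1 => b) a) := by
  rw [lval_mul_vval p (lval_ne_zero p ha), lval_mul_vval p (lval_ne_zero p hb), lval_eq, lval_eq,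
    Matrix.det_fin_two, Matrix.det_fin_two]
  simp only [Matrix.of_apply]
  have h1 : ∀ c d : K, (Fin.snoc (fun _ : Fin 1 => c) d : Fin (1 + 1) → K) 0 = c := fun c d => rfl
  have h2 : ∀ c d : K, (Fin.snoc (fun _ : Fin 1 => c) d : Fin (1 + 1) → K) 1 = d := fun c d => rfl
  simp only [h1, h2]
  ring

/-- Inductive step for the exchange of two blocks. The signs `c` and `c'` are left free because the
step serves two inductions: a single y against many z, and then the general case. -/
theorem lval_mul_lval_vval_snoc {k : ℕ} {y : Fin n → K} {z : Fin k → K} {w : K}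
    (h : LinearIndependent (ZMod p) (Sum.elim y (Fin.snoc z w : Fin (k + 1) → K))) {c c' : K}
    (hk : lval p y * lval p (fun j => vval p y (z j)) =
      c * (lval p z * lval p (fun i => vval p z (y i))))
    (h1 : lval p (fun i => vval p z (y i)) *
        vval p (fun i => vval p z (y i)) (vval p z w) =
      c' * (vval p z w * lval p (fun i => vval p (fun _ : Fin 1 => vval p z w) (vval p z (y i))))) :
    lval p y * lval p (fun j => vval p y ((Fin.snoc z w : Fin (k + 1) → K) j)) =
      c * c' * (lval p (Fin.snoc z w : Fin (k + 1) → K) *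
        lval p (fun i => vval p (Fin.snoc z w : Fin (k + 1) → K) (y i))) := by
  have hzw : LinearIndependent (ZMod p) (Fin.snoc z w : Fin (k + 1) → K) :=
    h.comp Sum.inr Sum.inr_injective
  have hz : LinearIndependent (ZMod p) z := (linearIndependent_finSnoc.1 hzw).1
  have hyz : LinearIndependent (ZMod p) (Sum.elim y z) := by
    have := h.comp (Sum.map id Fin.castSucc)
      (Sum.map_injective.2 ⟨Function.injective_id, Fin.castSucc_injective k⟩)
    convert this using 1
    ext (i | i) <;> simp
  have e1 : (fun j => vval p y ((Fin.snoc z w : Fin (k + 1) → K) j)) =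
      (Fin.snoc (fun j => vval p y (z j)) (vval p y w) : Fin (k + 1) → K) := by
    ext j
    refine Fin.lastCases ?_ (fun i => ?_) j <;> simp
  have e2 := lval_mul_vval p (lval_ne_zero p (linearIndependent_vval p hyz)) (vval p y w)
  have e3 := lval_mul_vval p (lval_ne_zero p hz) w
  simp only [vval_snoc p hzw]
  rw [e1, ← e2, ← e3, vval_vval p hyz]
  linear_combination vval p (fun i => vval p z (y i)) (vval p z w) * hk +
    c * lval p z * h1

/-- Each product is a Moore determinant of all n + k elements, with the blocks in opposite orders,
and the block exchange has sign (-1)^(nk). The proof moves one element of z at a time; the case n =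
1 (`hone`) supplies the factor (-1)^n of each move. -/
theorem lval_mul_lval_vval {k : ℕ} {y : Fin n → K} {z : Fin k → K}
    (h : LinearIndependent (ZMod p) (Sum.elim y z)) :
    lval p y * lval p (fun j => vval p y (z j)) =
      (-1) ^ (n * k) * (lval p z * lval p (fun i => vval p z (y i))) := by
  have l1 : ∀ a : K, lval p (fun _ : Fin 1 => a) = a := fun a => by
    rw [lval_eq, Matrix.det_fin_one]
    simp
  have l0 : ∀ (z : Fin 0 → K) a, vval p z a = a := fun z a => by
    simp [vval_eq, qval, lval_zero, lsval]
  have hfn : ∀ (m k : ℕ) (z : Fin k → K) (w : K) (y : Fin m → K),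
      LinearIndependent (ZMod p) (Sum.elim y (Fin.snoc z w : Fin (k + 1) → K)) →
      LinearIndependent (ZMod p)
        (Sum.elim (fun _ : Fin 1 => vval p z w) (fun i => vval p z (y i))) := by
    intro m k z w y h
    have h2 : LinearIndependent (ZMod p) (Sum.elim z (Sum.elim (fun _ : Fin 1 => w) y)) := by
      have := h.comp (Sum.elim (fun i => Sum.inr (Fin.castSucc i))
        (Sum.elim (fun _ : Fin 1 => Sum.inr (Fin.last k)) Sum.inl)) (by
          rintro (i | i | i) (j | j | j) hij <;>
            simp [(Fin.castSucc_lt_last _).ne, (Fin.castSucc_lt_last _).ne'] at hij ⊢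
          · exact hij
          · exact Subsingleton.elim _ _
          · exact hij)
      convert this using 1
      ext (i | i | i) <;> simp
    convert linearIndependent_vval p h2 using 1
    ext (i | i) <;> rfl
  have hone : ∀ (k : ℕ) (z : Fin k → K) (a : K),
      LinearIndependent (ZMod p) (Sum.elim (fun _ : Fin 1 => a) z) →
      a * lval p (fun j => vval p (fun _ : Fin 1 => a) (z j)) =
        (-1) ^ k * (lval p z * vval p z a) := by
    intro k
    induction k with
    | zero => intro z a _; simp [lval_zero, l0]
    | succ k ih =>
      intro z a
      obtain ⟨z, w, rfl⟩ : ∃ z' w, z = (Fin.snoc z' w : Fin (k + 1) → K) :=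
        ⟨Fin.init z, z (Fin.last k), (Fin.snoc_init_self z).symm⟩
      intro h
      have h3 := hfn _ _ _ _ _ h
      have h4 := lval_mul_lval_vval_snoc p h (c := (-1) ^ k) (c' := -1) (by
        rw [l1, l1, ih]
        have := h.comp (Sum.map id Fin.castSucc)
          (Sum.map_injective.2 ⟨Function.injective_id, Fin.castSucc_injective k⟩)
        convert this using 1
        ext (i | i) <;> simp) (by
        have := lval_mul_lval_vval_fin_one p (vval p z a) (vval p z w)
          (h3.comp Sum.inr Sum.inr_injective) (h3.comp Sum.inl Sum.inl_injective)
        simp only [l1] at this ⊢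
        rw [this]
        ring)
      simp only [l1] at h4
      rw [h4, pow_succ]
  induction k with
  | zero => simp [lval_zero, l0]
  | succ k ih =>
    obtain ⟨z, w, rfl⟩ : ∃ z' w, z = (Fin.snoc z' w : Fin (k + 1) → K) :=
      ⟨Fin.init z, z (Fin.last k), (Fin.snoc_init_self z).symm⟩
    have h4 := lval_mul_lval_vval_snoc p h (c := (-1) ^ (n * k)) (c' := (-1) ^ n) (by
        rw [ih]
        have := h.comp (Sum.map id Fin.castSucc)
          (Sum.map_injective.2 ⟨Function.injective_id, Fin.castSucc_injective k⟩)
        convert this using 1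
        ext (i | i) <;> simp) (by
        rw [hone _ _ _ (hfn _ _ _ _ _ h), ← mul_assoc, ← pow_add, ← two_mul, pow_mul]
        simp)
    rw [h4, ← pow_add, Nat.mul_succ]

end Additive

/-! ### The odd invariant U and its composition law. -/

section Umap

variable (p : ℕ) {K M : Type*} [Field K] [AddCommGroup M] [Module K M] {n : ℕ}

/-- The value of `M̃_{n,s}` at `(x_1, y_1), …, (x_n, y_n)`. -/
def mtval (X : Fin n → M) (y : Fin n → K) (s : ℕ) : M :=
  lval p y ^ (half p - 1) • msval p X y s

/-- The value of `U_{n+1}` at `(x_1, y_1), …, (x_n, y_n), (x, w)`. -/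
def uval (X : Fin n → M) (y : Fin n → K) (x : M) (w : K) : M :=
  (-1 : K) ^ n • (lval p y ^ half p • x +
    ∑ j : Fin n, (-1 : K) ^ ((j : ℕ) + 1) • w ^ p ^ (j : ℕ) • mtval p X y j)

theorem uval_eq_msval (hh : 0 < half p) (X : Fin n → M) (y : Fin n → K) (x : M) (w : K) :
    uval p X y x w = lval p y ^ (half p - 1) •
      msval p (Fin.snoc X x : Fin (n + 1) → M) (Fin.snoc y w : Fin (n + 1) → K) n := by
  rw [msval_snoc, smul_comm, uval]
  congr 1
  rw [smul_add, smul_smul, ← pow_succ, Nat.sub_add_cancel hh, Finset.smul_sum]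
  congr 1
  refine Finset.sum_congr rfl fun j _ => ?_
  rw [mtval, smul_comm (lval p y ^ (half p - 1)), smul_comm (lval p y ^ (half p - 1))]

theorem lval_smul_add_sum_mtval (hh : 0 < half p) (X : Fin n → M) (y : Fin n → K) (i : Fin n) :
    lval p y ^ half p • X i +
      ∑ j : Fin n, (-1 : K) ^ ((j : ℕ) + 1) • y i ^ p ^ (j : ℕ) • mtval p X y j = 0 := by
  rw [← smul_zero (lval p y ^ (half p - 1)), ← lval_smul_add_sum_msval p X y i, smul_add,
    smul_smul, ← pow_succ, Nat.sub_add_cancel hh, Finset.smul_sum]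
  congr 1
  refine Finset.sum_congr rfl fun j _ => ?_
  rw [mtval, smul_comm (lval p y ^ (half p - 1)), smul_comm (lval p y ^ (half p - 1))]

theorem uval_self (hh : 0 < half p) (X : Fin n → M) (y : Fin n → K) (i : Fin n) :
    uval p X y (X i) (y i) = 0 := by
  rw [uval, lval_smul_add_sum_mtval p hh, smul_zero]

variable [Fact p.Prime]

theorem uval_zero (X : Fin n → M) (y : Fin n → K) : uval p X y 0 0 = 0 := by
  have hp := (Fact.out : p.Prime).ne_zero
  simp [uval, hp]

/-- The polynomial in `w` with value `φ (U_{n+1}(x, w)) - φ (U_{n+1}(x, 0))`. -/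
noncomputable def upoly (φ : M →ₗ[K] K) (X : Fin n → M) (y : Fin n → K) : Polynomial K :=
  ∑ j : Fin n, Polynomial.C ((-1) ^ n * ((-1) ^ ((j : ℕ) + 1) * φ (mtval p X y j))) *
    Polynomial.X ^ p ^ (j : ℕ)

omit [Fact p.Prime] in
theorem apply_uval (φ : M →ₗ[K] K) (X : Fin n → M) (y : Fin n → K) (x : M) (w : K) :
    φ (uval p X y x w) = (-1) ^ n * lval p y ^ half p * φ x + (upoly p φ X y).eval w := by
  simp only [uval, upoly, map_smul, map_add, map_sum, smul_eq_mul, Polynomial.eval_finsetSum,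
    Polynomial.eval_mul, Polynomial.eval_C, Polynomial.eval_pow, Polynomial.eval_X, mul_add,
    Finset.mul_sum]
  congr 1
  · ring
  · exact Finset.sum_congr rfl fun j _ => by ring

variable [Algebra (ZMod p) K] [CharP K p] {k : ℕ}

/-- Apply a linear functional to the difference of the two sides. The coefficients of x cancel by
the h-th power of `lval_mul_lval_vval`, the source of the sign. What remains is an additive
polynomial in w alone, of degree below p^(n+k), with the n + k independent zeros y_i and z_j. -/
theorem uval_uval (hh : 0 < half p) {X : Fin n → M} {y : Fin n → K} {Z : Fin k → M} {z : Fin k → K}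
    (h : LinearIndependent (ZMod p) (Sum.elim y z)) (x : M) (w : K) :
    uval p (fun j => uval p X y (Z j) (z j)) (fun j => vval p y (z j)) (uval p X y x w)
        (vval p y w) =
      (-1 : K) ^ (n * k * half p) •
        uval p (fun i => uval p Z z (X i) (y i)) (fun i => vval p z (y i)) (uval p Z z x w)
          (vval p z w) := by
  have hp := (Fact.out : p.Prime).one_lt
  have hy : LinearIndependent (ZMod p) y := h.comp Sum.inl Sum.inl_injective
  have hz : LinearIndependent (ZMod p) z := h.comp Sum.inr Sum.inr_injective
  have d1 := (vpoly_monic_natDegree p (lval_ne_zero p hy)).2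
  have d2 := (vpoly_monic_natDegree p (lval_ne_zero p hz)).2
  have hl := lval_mul_lval_vval p h
  set X' := fun j => uval p X y (Z j) (z j)
  set y' := fun j => vval p y (z j)
  set Z' := fun i => uval p Z z (X i) (y i)
  set z' := fun i => vval p z (y i)
  set ε : K := (-1) ^ (n * k * half p) with hε
  have hl' : (lval p y * lval p y') ^ half p = ε * (lval p z * lval p z') ^ half p := by
    rw [hl, mul_pow, ← pow_mul]
  rw [← sub_eq_zero, ← Module.forall_dual_apply_eq_zero_iff K]
  intro φ
  let D : Polynomial K := Polynomial.C ((-1) ^ k * lval p y' ^ half p) * upoly p φ X y +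
    (upoly p φ X' y').comp (vpoly p y) -
    Polynomial.C ε * (Polynomial.C ((-1) ^ n * lval p z' ^ half p) * upoly p φ Z z +
    (upoly p φ Z' z').comp (vpoly p z))
  have heval : ∀ x w, φ (uval p X' y' (uval p X y x w) (vval p y w) -
      ε • uval p Z' z' (uval p Z z x w) (vval p z w)) = D.eval w := by
    intro x w
    simp only [D, map_sub, map_smul, apply_uval, Polynomial.eval_sub, Polynomial.eval_add,
      Polynomial.eval_mul, Polynomial.eval_C, Polynomial.eval_comp, smul_eq_mul, vval]
    have : (-1) ^ k * lval p y' ^ half p * ((-1) ^ n * lval p y ^ half p * φ x) =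
        ε * ((-1) ^ n * lval p z' ^ half p * ((-1) ^ k * lval p z ^ half p * φ x)) := by
      linear_combination ((-1) ^ k * (-1) ^ n * φ x) * hl'
    linear_combination this
  have hU : ∀ (m : ℕ) (W : Fin m → M) (v : Fin m → K) (a b : K), (upoly p φ W v).eval (a + b) =
      (upoly p φ W v).eval a + (upoly p φ W v).eval b := fun m W v a b =>
    eval_sum_C_mul_X_pow_add p _ _ _ a b
  have hdeg : ∀ (m : ℕ) (W : Fin m → M) (v : Fin m → K), (upoly p φ W v).natDegree < p ^ m :=
    fun m W v => natDegree_sum_C_mul_X_pow_lt p _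
  have hmono : ∀ a b, p ^ a ≤ p ^ (a + b) := fun a b => Nat.pow_le_pow_right hp.le (by omega)
  have h0 : D = 0 := by
    refine eq_zero_of_additive p h (fun a b => ?_) ?_ ?_
    · simp only [D, Polynomial.eval_sub, Polynomial.eval_add, Polynomial.eval_mul,
        Polynomial.eval_C, Polynomial.eval_comp, hU]
      have e1 := vval_add p y a b
      have e2 := vval_add p z a b
      rw [vval, vval, vval] at e1 e2
      rw [e1, e2, hU, hU]
      ring
    -- The value of `D` does not depend on x. Choosing x = X_i at y_i, or x = Z_j at z_j, makes one
    -- inner pair zero and the other a repeated pair, so both terms vanish.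
    · rintro (i | j)
      · rw [← heval (X i), Sum.elim_inl, uval_self p hh, vval_self, uval_zero, zero_sub]
        change φ (-(ε • uval p Z' z' (Z' i) (z' i))) = 0
        rw [uval_self p hh, smul_zero, neg_zero, map_zero]
      · rw [← heval (Z j), Sum.elim_inr, uval_self p hh Z z, vval_self p z, uval_zero, smul_zero,
          sub_zero]
        change φ (uval p X' y' (X' j) (y' j)) = 0
        rw [uval_self p hh, map_zero]
    · rw [Fintype.card_sum, Fintype.card_fin, Fintype.card_fin]
      have b1 : ∀ (a : K) (m : ℕ) (W : Fin m → M) (v : Fin m → K),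
          (Polynomial.C a * upoly p φ W v).natDegree < p ^ m := fun a m W v =>
        (Polynomial.natDegree_C_mul_le _ _).trans_lt (hdeg m W v)
      have c1 : ((upoly p φ X' y').comp (vpoly p y)).natDegree < p ^ (n + k) := by
        rw [Polynomial.natDegree_comp, d1, pow_add, mul_comm]
        exact Nat.mul_lt_mul_of_pos_left (hdeg _ _ _) (Nat.pow_pos (by omega))
      have c2 : ((upoly p φ Z' z').comp (vpoly p z)).natDegree < p ^ (n + k) := by
        rw [Polynomial.natDegree_comp, d2, pow_add]
        exact Nat.mul_lt_mul_of_pos_right (hdeg _ _ _) (Nat.pow_pos (by omega))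
      have c3 := (b1 ((-1) ^ k * lval p y' ^ half p) n X y).trans_le (hmono n k)
      have c4 := (b1 ((-1) ^ n * lval p z' ^ half p) k Z z).trans_le (hmono k n)
      rw [add_comm k n] at c4
      refine (Polynomial.natDegree_sub_le _ _).trans_lt (max_lt ?_ ?_)
      · exact (Polynomial.natDegree_add_le _ _).trans_lt (max_lt c3 c1)
      · refine (Polynomial.natDegree_C_mul_le _ _).trans_lt ?_
        exact (Polynomial.natDegree_add_le _ _).trans_lt (max_lt c4 c2)
  rw [heval, h0, Polynomial.eval_zero]

end Umap

/-! ### The Dickson and Mùi invariants -/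

/-- Q and V are chosen quotients, so their degrees can be read only from the products that define
them. Comparing homogeneous components and cancelling f suffices. -/
theorem isHomogeneous_of_mul {σ R : Type*} [CommRing R] [IsDomain R] {f g : MvPolynomial σ R}
    {d e : ℕ} (hf : f.IsHomogeneous d) (h0 : f ≠ 0) (h : (f * g).IsHomogeneous (d + e)) :
    g.IsHomogeneous e := by
  have hc : ∀ i, i ≠ e → MvPolynomial.homogeneousComponent i g = 0 := by
    intro i hi
    have h1 : MvPolynomial.homogeneousComponent (d + i) (f * g) =
        f * MvPolynomial.homogeneousComponent i g := by
      conv_lhs => rw [← MvPolynomial.sum_homogeneousComponent g, Finset.mul_sum, map_sum]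
      have h2 : ∀ j, MvPolynomial.homogeneousComponent (d + i)
          (f * MvPolynomial.homogeneousComponent j g) =
          if j = i then f * MvPolynomial.homogeneousComponent i g else 0 := by
        intro j
        rw [MvPolynomial.homogeneousComponent_of_mem
          (hf.mul (MvPolynomial.homogeneousComponent_isHomogeneous j g))]
        by_cases hj : j = i
        · subst hj; simp
        · simp [hj, Ne.symm hj]
      simp only [h2, Finset.sum_ite_eq', Finset.mem_range]
      split_ifs with h3
      · rfl
      · rw [MvPolynomial.homogeneousComponent_eq_zero _ _ (by omega), mul_zero]
    rw [MvPolynomial.homogeneousComponent_of_mem h, if_neg (by omega)] at h1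
    exact (mul_eq_zero.1 h1.symm).resolve_left h0
  rw [← MvPolynomial.sum_homogeneousComponent g]
  refine MvPolynomial.IsHomogeneous.sum _ _ _ fun i _ => ?_
  by_cases hi : i = e
  · exact hi ▸ MvPolynomial.homogeneousComponent_isHomogeneous i g
  · rw [hc i hi]
    exact MvPolynomial.isHomogeneous_zero _ _ _

theorem isHomogeneous_det {σ R : Type*} [CommRing R] {k : ℕ}
    (A : Matrix (Fin k) (Fin k) (MvPolynomial σ R)) (e : Fin k → ℕ)
    (h : ∀ i j, (A i j).IsHomogeneous (e i)) : A.det.IsHomogeneous (∑ i, e i) := by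
  rw [← Matrix.det_transpose, Matrix.det_apply]
  refine MvPolynomial.IsHomogeneous.sum _ _ _ fun s _ => ?_
  rw [Units.smul_def, ← Int.cast_smul_eq_zsmul R, MvPolynomial.smul_eq_C_mul]
  refine MvPolynomial.IsHomogeneous.C_mul ?_ _
  have h1 := MvPolynomial.IsHomogeneous.prod Finset.univ (fun i => A.transpose (s i) i) e
    fun i _ => h i (s i)
  exact h1

theorem exactQuot_spec {σ R : Type} [CommRing R] {a b : MvPolynomial σ R} (h : b ∣ a) :
    b * exactQuot a b = a := by
  rw [exactQuot, dif_pos h]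
  exact h.choose_spec.symm

/-! ### Divisibility by the Moore determinant. -/

section Divisibility

variable (p : ℕ) [Fact p.Prime] {A K : Type*} [CommRing A] [IsDomain A] [Field K]
  [Algebra A K] [IsFractionRing A K] [Algebra (ZMod p) K] [CharP K p]

omit [IsFractionRing A K] in
/-- The polynomial `V_{k+1}(y_1, …, y_k, X)` has coefficients in any subring that contains
the `y_i`. -/
theorem exists_vpoly_eq_map [Algebra (ZMod p) A] [IsScalarTower (ZMod p) A K] {k : ℕ} {y : Fin k → A}
    (hy : LinearIndependent (ZMod p) fun i => algebraMap A K (y i)) :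
    ∃ G : Polynomial A, vpoly p (fun i => algebraMap A K (y i)) = G.map (algebraMap A K) := by
  classical
  obtain ⟨m1, d1⟩ := vpoly_monic_natDegree p (lval_ne_zero p hy)
  set P := vpoly p fun i => algebraMap A K (y i)
  let f : (Fin k → ZMod p) → A := fun c => ∑ i, c i • y i
  -- The product over all 𝔽_p-combinations of the y_i has the same degree, leading coefficient and
  -- roots as V, and its coefficients visibly lie in `A`.
  let G : Polynomial A := ∏ c, (Polynomial.X - Polynomial.C (f c))
  refine ⟨G, ?_⟩
  have mG : (G.map (algebraMap A K)).Monic :=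
    (Polynomial.monic_prod_of_monic _ _ fun c _ => Polynomial.monic_X_sub_C (f c)).map _
  have dG : (G.map (algebraMap A K)).natDegree = p ^ k := by
    rw [Polynomial.Monic.natDegree_map
      (Polynomial.monic_prod_of_monic _ _ fun c _ => Polynomial.monic_X_sub_C (f c)),
      Polynomial.natDegree_prod_of_monic _ _ fun c _ => Polynomial.monic_X_sub_C (f c)]
    simp [ZMod.card]
  have hf : ∀ c, algebraMap A K (f c) = ∑ i, c i • algebraMap A K (y i) := by
    intro c
    simp only [f, map_sum]
    exact Finset.sum_congr rfl fun i _ => by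
      rw [Algebra.smul_def, map_mul, ← IsScalarTower.algebraMap_apply, ← Algebra.smul_def]
  refine sub_eq_zero.1 (Polynomial.eq_zero_of_natDegree_lt_card_of_eval_eq_zero _
    (f := fun c => algebraMap A K (f c)) ?_ (fun c => ?_) ?_)
  · intro c d h
    simp only [hf] at h
    exact linearIndependent_iff_injective_fintypeLinearCombination.1 hy (by
      simpa [Fintype.linearCombination_apply] using h)
  · rw [Polynomial.eval_sub]
    have h1 : P.eval (algebraMap A K (f c)) = 0 := by
      rw [hf]
      refine (vval_sum_smul p _ _ _ _).trans (Finset.sum_eq_zero fun i _ => ?_)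
      rw [vval_self p (fun i => algebraMap A K (y i)), smul_zero]
    have h2 : (G.map (algebraMap A K)).eval (algebraMap A K (f c)) = 0 := by
      rw [Polynomial.eval_map_algebraMap, Polynomial.aeval_algebraMap_apply,
        Polynomial.coe_aeval_eq_eval, Polynomial.eval_prod,
        Finset.prod_eq_zero (Finset.mem_univ c) (by simp), map_zero]
    rw [h1, h2, sub_zero]
  · rw [Fintype.card_fun, ZMod.card, Fintype.card_fin]
    have := Polynomial.degree_sub_lt_left (p := P) (q := G.map (algebraMap A K))
      (by rw [Polynomial.degree_eq_natDegree m1.ne_zero, Polynomial.degree_eq_natDegree mG.ne_zero,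
        d1, dG]) m1.ne_zero (by rw [m1.leadingCoeff, mG.leadingCoeff])
    rcases eq_or_ne (P - G.map (algebraMap A K)) 0 with h0 | h0
    · rw [h0, Polynomial.natDegree_zero]
      exact Nat.pow_pos (Fact.out : p.Prime).pos
    · rw [← d1]
      exact Polynomial.natDegree_lt_natDegree h0 this

omit [IsDomain A] [IsFractionRing A K] [Fact p.Prime] [Algebra (ZMod p) K] [CharP K p] in
theorem algebraMap_lsval {k : ℕ} (y : Fin k → A) (s : ℕ) :
    algebraMap A K (lsval p y s) = lsval p (fun i => algebraMap A K (y i)) s := by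
  rw [lsval, lsval, RingHom.map_det]
  congr 1
  ext j i
  simp

/-- Up to sign the quotient is a coefficient of V_{k+1}(y, X), a polynomial already defined over
`A`. -/
theorem lval_dvd_lsval [Algebra (ZMod p) A] [IsScalarTower (ZMod p) A K] {k : ℕ} {y : Fin k → A}
    (hy : LinearIndependent (ZMod p) fun i => algebraMap A K (y i)) {s : ℕ} (hs : s ≤ k) :
    lval p y ∣ lsval p y s := by
  obtain ⟨G, hG⟩ := exists_vpoly_eq_map p hy
  have hp := (Fact.out : p.Prime).one_lt
  refine ⟨(-1) ^ (k + s) * G.coeff (p ^ s), IsFractionRing.injective A K ?_⟩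
  have h1 := congrArg (fun P => P.coeff (p ^ s)) hG
  have h2 : (vpoly p fun i => algebraMap A K (y i)).coeff (p ^ s) =
      (-1) ^ (k + s) * qval p (fun i => algebraMap A K (y i)) s := by
    rw [vpoly, Polynomial.finsetSum_coeff, Finset.sum_eq_single ⟨s, by omega⟩]
    · rw [Polynomial.coeff_C_mul_X_pow, if_pos rfl]
    · intro j _ hj
      rw [Polynomial.coeff_C_mul_X_pow, if_neg]
      intro h
      exact hj (Fin.ext ((Nat.pow_right_injective hp) h.symm))
    · simp
  simp only [h2, Polynomial.coeff_map] at h1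
  have h3 := lval_ne_zero p hy
  rw [map_mul, map_mul, ← h1, lval, algebraMap_lsval, algebraMap_lsval, qval, ← lval, ← mul_assoc
    (algebraMap A K _), map_pow, map_neg, map_one, ← pow_add, ← two_mul, pow_mul]
  field_simp
  simp

theorem lval_dvd_lval_snoc [Algebra (ZMod p) A] [IsScalarTower (ZMod p) A K] {k : ℕ} {y : Fin k → A}
    (hy : LinearIndependent (ZMod p) fun i => algebraMap A K (y i)) (w : A) :
    lval p y ∣ lval p (Fin.snoc y w : Fin (k + 1) → A) := by
  obtain ⟨G, hG⟩ := exists_vpoly_eq_map p hy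
  refine ⟨G.eval w, IsFractionRing.injective A K ?_⟩
  have h1 := lval_mul_vval p (lval_ne_zero p hy) (algebraMap A K w)
  rw [vval, hG, Polynomial.eval_map_algebraMap, Polynomial.aeval_algebraMap_apply,
    Polynomial.coe_aeval_eq_eval] at h1
  rw [map_mul, lval, lval, algebraMap_lsval, algebraMap_lsval]
  refine Eq.trans ?_ h1.symm
  unfold lval
  congr 1
  ext j
  refine Fin.lastCases ?_ (fun i => ?_) j <;> simp

end Divisibility

section Invariants

variable {p : ℕ} [Fact p.Prime] {k N : ℕ}

theorem Ls_eq_lsval (hk : k ≤ N) (s : ℕ) :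
    Ls p hk s = lsval p (fun i => (MvPolynomial.X (Fin.castLE hk i) :
      MvPolynomial (Fin N) (ZMod p))) s := rfl

theorem L_eq_lval (hk : k ≤ N) :
    L p hk = lval p (fun i => (MvPolynomial.X (Fin.castLE hk i) :
      MvPolynomial (Fin N) (ZMod p))) := rfl

theorem linearIndependent_castLE {K : Type*} [Field K] [Algebra (ZMod p) K] {y : Fin N → K}
    (hy : AlgebraicIndependent (ZMod p) y) (hk : k ≤ N) :
    LinearIndependent (ZMod p) fun i : Fin k => y (Fin.castLE hk i) :=
  hy.linearIndependent.comp _ (Fin.castLE_injective hk)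

theorem charP_of_algebra_zmod (K : Type*) [Field K] [Algebra (ZMod p) K] : CharP K p :=
  charP_of_injective_algebraMap (algebraMap (ZMod p) K).injective p

theorem linearIndependent_algebraMap_X (hk : k ≤ N) : LinearIndependent (ZMod p) fun i : Fin k =>
    algebraMap (MvPolynomial (Fin N) (ZMod p)) (FractionRing (MvPolynomial (Fin N) (ZMod p)))
      (MvPolynomial.X (Fin.castLE hk i)) :=
  linearIndependent_castLE (y := fun i => algebraMap (MvPolynomial (Fin N) (ZMod p))
    (FractionRing (MvPolynomial (Fin N) (ZMod p))) (MvPolynomial.X i))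
    ((MvPolynomial.algebraicIndependent_X (Fin N) (ZMod p)).map'
      (f := IsScalarTower.toAlgHom (ZMod p) (MvPolynomial (Fin N) (ZMod p))
        (FractionRing (MvPolynomial (Fin N) (ZMod p)))) (IsFractionRing.injective _ _)) hk

theorem L_dvd_Ls (hk : k ≤ N) {s : ℕ} (hs : s ≤ k) : L p hk ∣ Ls p hk s :=
  have := charP_of_algebra_zmod (p := p) (FractionRing (MvPolynomial (Fin N) (ZMod p)))
  lval_dvd_lsval p (linearIndependent_algebraMap_X hk) hs

theorem snoc_X (hk : k + 1 ≤ N) {B : Type*} (f : Fin N → B) :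
    (Fin.snoc (fun i : Fin k => f (Fin.castLE ((Nat.le_succ k).trans hk) i)) (f ⟨k, hk⟩) :
      Fin (k + 1) → B) = fun i => f (Fin.castLE hk i) := by
  ext i
  refine Fin.lastCases ?_ (fun i => ?_) i
  · rw [Fin.snoc_last]
    rfl
  · rw [Fin.snoc_castSucc]
    rfl

theorem L_dvd_L_succ (hk : k + 1 ≤ N) : L p ((Nat.le_succ k).trans hk) ∣ L p hk := by
  have := charP_of_algebra_zmod (p := p) (FractionRing (MvPolynomial (Fin N) (ZMod p)))
  have := lval_dvd_lval_snoc p (linearIndependent_algebraMap_X (p := p) ((Nat.le_succ k).trans hk))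
    (MvPolynomial.X ⟨k, hk⟩)
  rwa [snoc_X hk] at this

theorem L_ne_zero (hk : k ≤ N) : L p hk ≠ 0 := by
  have := charP_of_algebra_zmod (p := p) (FractionRing (MvPolynomial (Fin N) (ZMod p)))
  intro h
  apply lval_ne_zero p (linearIndependent_algebraMap_X (p := p) hk)
  have h1 := congrArg (algebraMap _ (FractionRing (MvPolynomial (Fin N) (ZMod p)))) h
  rw [map_zero, L_eq_lval, lval, algebraMap_lsval] at h1
  exact h1

theorem L_mul_Q (hk : k ≤ N) {s : ℕ} (hs : s ≤ k) : L p hk * Q p hk s = Ls p hk s :=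
  exactQuot_spec (L_dvd_Ls hk hs)

theorem L_mul_V (hk : k + 1 ≤ N) : L p ((Nat.le_succ k).trans hk) * V p hk = L p hk :=
  exactQuot_spec (L_dvd_L_succ hk)

/-! ### Degrees -/

/-- The degree `1 + p + ⋯ + p ^ (k - 1)` of `L_k`. -/
def degL (p k : ℕ) : ℕ := ∑ j ∈ Finset.range k, p ^ j

omit [Fact p.Prime] in
theorem sum_skip (k s : ℕ) (hs : s ≤ k) : ∑ j : Fin k, p ^ skip s j + p ^ s = degL p (k + 1) := by
  rw [degL, ← Fin.sum_univ_eq_sum_range (fun j => p ^ j) (k + 1),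
    Fin.sum_univ_succAbove _ ⟨s, by omega⟩, add_comm]
  congr 1
  refine Finset.sum_congr rfl fun j _ => ?_
  rw [coe_succAbove_eq_skip]

-- The power h = (p-1)/2 in the definitions makes h · deg L_k = (p^k - 1)/2; this is why U_{k+1} has
-- total degree p^k.
omit [Fact p.Prime] in
theorem two_mul_half_mul_degL (hp : Odd p) : ∀ k, 2 * (half p * degL p k) + 1 = p ^ k := by
  have h : 2 * half p + 1 = p := by
    obtain ⟨m, hm⟩ := hp
    rw [half]
    omega
  intro k
  induction k with
  | zero => simp [degL]
  | succ k ih =>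
    rw [degL, Finset.sum_range_succ, ← degL, pow_succ]
    have h2 : p ^ k * p = (2 * (half p * degL p k) + 1) * (2 * half p + 1) := by rw [ih, h]
    rw [h2, ← ih]
    ring

theorem isHomogeneous_Ls (hk : k ≤ N) {s : ℕ} (hs : s ≤ k) :
    (Ls p hk s).IsHomogeneous (degL p (k + 1) - p ^ s) := by
  have h := isHomogeneous_det (Matrix.of fun j i : Fin k =>
    (MvPolynomial.X (Fin.castLE hk i) : MvPolynomial (Fin N) (ZMod p)) ^ p ^ skip s j)
    (fun j => p ^ skip s j) fun j i => MvPolynomial.isHomogeneous_X_pow _ _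
  rw [← sum_skip k s hs, Nat.add_sub_cancel]
  exact h

omit [Fact p.Prime] in
theorem degL_succ (k : ℕ) : degL p (k + 1) = degL p k + p ^ k := Finset.sum_range_succ _ _

theorem isHomogeneous_L (hk : k ≤ N) : (L p hk).IsHomogeneous (degL p k) := by
  have := isHomogeneous_Ls (p := p) hk le_rfl
  rwa [degL_succ, Nat.add_sub_cancel] at this

theorem isHomogeneous_Q (hk : k ≤ N) {s : ℕ} (hs : s ≤ k) :
    (Q p hk s).IsHomogeneous (p ^ k - p ^ s) := by
  refine isHomogeneous_of_mul (isHomogeneous_L hk) (L_ne_zero hk) ?_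
  rw [L_mul_Q hk hs]
  convert isHomogeneous_Ls (p := p) hk hs using 1
  have := Nat.pow_le_pow_right (Fact.out : p.Prime).pos hs
  rw [degL_succ]
  omega

theorem isHomogeneous_V (hk : k + 1 ≤ N) : (V p hk).IsHomogeneous (p ^ k) := by
  refine isHomogeneous_of_mul (isHomogeneous_L ((Nat.le_succ k).trans hk)) (L_ne_zero _) ?_
  rw [L_mul_V hk, ← degL_succ]
  exact isHomogeneous_L hk

theorem isBihom_Ms (hk : k ≤ N) {s : ℕ} (hs : s < k) :
    IsBihom 1 (degL p k - p ^ s) (Ms p hk s) := by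
  obtain _ | k := k
  · omega
  rw [Ms, bracketOne]
  refine IsBihom.sum _ _ fun i _ => ?_
  refine IsBihom.smul _ ?_
  rw [← sum_skip k s (by omega), Nat.add_sub_cancel]
  have h := isHomogeneous_det (Matrix.of fun a b : Fin k =>
    (MvPolynomial.X (Fin.castLE hk (skipCol i b)) : MvPolynomial (Fin N) (ZMod p)) ^ p ^ skip s a)
    (fun j => p ^ skip s j) fun j i => MvPolynomial.isHomogeneous_X_pow _ _
  have := (IsBihom.odd (p := p) (Fin.castLE hk i)).mul (IsBihom.poly h)
  rw [zero_add] at this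
  exact this

theorem isBihom_poly_L_pow (hk : k ≤ N) (e : ℕ) : IsBihom 0 (e * degL p k) (poly (L p hk ^ e)) := by
  have := (isHomogeneous_L (p := p) hk).pow e
  rw [mul_comm] at this
  exact IsBihom.poly this

theorem isBihom_Mtil (hh : 0 < half p) (hk : k ≤ N) {s : ℕ} (hs : s < k) :
    IsBihom 1 (half p * degL p k - p ^ s) (Mtil p hk s) := by
  have h := (isBihom_Ms (p := p) hk hs).mul (isBihom_poly_L_pow hk (half p - 1))
  rw [Mtil, if_neg (by omega), Int.toNat_natCast]
  convert h using 1
  have h1 : p ^ s ≤ degL p k :=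
    Finset.single_le_sum (f := fun j => p ^ j) (fun _ _ => Nat.zero_le _) (Finset.mem_range.2 hs)
  obtain ⟨m, hm⟩ : ∃ m, half p = m + 1 := ⟨half p - 1, by omega⟩
  rw [hm, Nat.add_sub_cancel, add_mul, one_mul]
  omega

theorem isBihom_Ltil (hk : k ≤ N) : IsBihom 0 (half p * degL p k) (poly (Ltil p hk)) :=
  isBihom_poly_L_pow hk _

theorem isBihom_U (hh : 0 < half p) (hk : k + 1 ≤ N) :
    IsBihom 1 (half p * degL p k) (U p hk) := by
  have h := (isBihom_Ms (p := p) hk (Nat.lt_succ_self k)).mul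
    (isBihom_poly_L_pow ((Nat.le_succ k).trans hk) (half p - 1))
  rw [U]
  convert h using 1
  rw [degL_succ, Nat.add_sub_cancel]
  obtain ⟨m, hm⟩ : ∃ m, half p = m + 1 := ⟨half p - 1, by omega⟩
  rw [hm, Nat.add_sub_cancel]
  ring

/-! ### Values -/

variable {K M : Type*} [Field K] [Algebra (ZMod p) K] [AddCommGroup M] [Module K M]
  [Module (ZMod p) M] [IsScalarTower (ZMod p) K M]

theorem aeval_Ls (y : Fin N → K) (hk : k ≤ N) (s : ℕ) :
    MvPolynomial.aeval y (Ls p hk s) = lsval p (fun i => y (Fin.castLE hk i)) s := by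
  rw [Ls_eq_lsval, lsval, lsval, AlgHom.map_det]
  congr 1
  ext j i
  simp

theorem aeval_L (y : Fin N → K) (hk : k ≤ N) :
    MvPolynomial.aeval y (L p hk) = lval p (fun i => y (Fin.castLE hk i)) := aeval_Ls y hk k

theorem aeval_Q (y : Fin N → K) (hk : k ≤ N) (hy : lval p (fun i => y (Fin.castLE hk i)) ≠ 0)
    {s : ℕ} (hs : s ≤ k) :
    MvPolynomial.aeval y (Q p hk s) = qval p (fun i => y (Fin.castLE hk i)) s := by
  have := congrArg (MvPolynomial.aeval y) (L_mul_Q (p := p) hk hs)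
  rw [map_mul, aeval_L, aeval_Ls] at this
  rw [qval, eq_div_iff hy, mul_comm, this]

theorem aeval_V (y : Fin N → K) (hk : k + 1 ≤ N)
    (hy : lval p (fun i => y (Fin.castLE ((Nat.le_succ k).trans hk) i)) ≠ 0) :
    MvPolynomial.aeval y (V p hk) =
      vval p (fun i => y (Fin.castLE ((Nat.le_succ k).trans hk) i)) (y ⟨k, hk⟩) := by
  have := congrArg (MvPolynomial.aeval y) (L_mul_V (p := p) hk)
  rw [map_mul, aeval_L, aeval_L, ← snoc_X hk, ← lval_mul_vval p hy] at this
  exact mul_left_cancel₀ hy this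

theorem ev_Ms (X : Fin N → M) (y : Fin N → K) (hk : k ≤ N) (s : ℕ) :
    ev p X y (Ms p hk s) = ExteriorAlgebra.ι K
      (msval p (fun i => X (Fin.castLE hk i)) (fun i => y (Fin.castLE hk i)) s) := by
  rw [Ms, bracketOne, map_sum, msval, map_sum]
  refine Finset.sum_congr rfl fun i _ => ?_
  rw [map_smul, map_mul, ev_odd, ev_poly, ← Algebra.commutes, ← Algebra.smul_def,
    ← algebraMap_smul K, map_pow, map_neg, map_one, map_smul, map_smul, AlgHom.map_det]
  congr 3
  ext a b
  simp

theorem ev_Mtil (X : Fin N → M) (y : Fin N → K) (hk : k ≤ N) (s : ℕ) :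
    ev p X y (Mtil p hk s) = ExteriorAlgebra.ι K
      (mtval p (fun i => X (Fin.castLE hk i)) (fun i => y (Fin.castLE hk i)) s) := by
  rw [Mtil, if_neg (by omega), Int.toNat_natCast, map_mul, ev_Ms, ev_poly, ← Algebra.commutes,
    ← Algebra.smul_def, mtval, map_smul, map_pow, aeval_L]

theorem ev_U (hh : 0 < half p) (X : Fin N → M) (y : Fin N → K) (hk : k + 1 ≤ N) :
    ev p X y (U p hk) = ExteriorAlgebra.ι K
      (uval p (fun i => X (Fin.castLE ((Nat.le_succ k).trans hk) i))
        (fun i => y (Fin.castLE ((Nat.le_succ k).trans hk) i)) (X ⟨k, hk⟩) (y ⟨k, hk⟩)) := by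
  rw [uval_eq_msval p hh, snoc_X hk, snoc_X hk, U, map_mul, ev_Ms, ev_poly, ← Algebra.commutes,
    ← Algebra.smul_def, map_smul, map_pow, aeval_L]

theorem ev_MQ (X : Fin N → M) (y : Fin N → K) (hk : k ≤ N)
    (hy : lval p (fun i => y (Fin.castLE hk i)) ≠ 0) (S : Finset (Fin k)) (e : Fin k → ℕ) :
    ev p X y (MQ p hk S e) =
      (∏ i : Fin k, (if (i : ℕ) = 0 then lval p (fun i => y (Fin.castLE hk i)) ^ half p
        else qval p (fun i => y (Fin.castLE hk i)) i) ^ e i) •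
      wedge K (fun s : Fin k => mtval p (fun i => X (Fin.castLE hk i))
        (fun i => y (Fin.castLE hk i)) s) S := by
  rw [MQ, map_mul, ev_poly, ← Algebra.commutes, ← Algebra.smul_def, map_list_prod, List.map_map,
    map_prod]
  congr 1
  · refine Finset.prod_congr rfl fun i _ => ?_
    rw [map_pow]
    congr 1
    split_ifs
    · rw [Ltil, map_pow, aeval_L]
    · rw [aeval_Q y hk hy i.isLt.le]
  · rw [wedge]
    congr 2
    ext s
    exact ev_Mtil X y hk s

end Invariants

/-! ### The operations in terms of the invariants -/

/-- R* keeps r_i as the exponent of Q_{n,i} for 0 < i < n, drops r_n because Q_{n,n} = 1, and gives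
the remaining degree to L̃_n. For n = 0 there is no slot for L̃_0, so ℓ must be 1. -/
theorem prod_star {K : Type*} [CommRing K] {n : ℕ} {ℓ : K} {q : ℕ → K} (hq : q n = 1)
    (hn : n = 0 → ℓ = 1) {e t : ℕ} {R : Fin n → ℕ} (h : t + 2 * ∑ i, R i ≤ e) :
    ℓ ^ (t + 2 * ∑ i, R i) * ∏ i : Fin n, (if (i : ℕ) = 0 then ℓ else q i) ^
        (star ((e : ℤ) - t) R i).toNat = ℓ ^ e * ∏ i : Fin n, q (i + 1) ^ R i := by
  obtain _ | n := n
  · simp [hn rfl]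
  rw [Fin.prod_univ_succ, Fin.prod_univ_castSucc (f := fun i : Fin (n + 1) => q (i + 1) ^ R i)]
  have h0 : (star ((e : ℤ) - t) R 0).toNat = e - (t + 2 * ∑ i, R i) := by
    rw [star, if_pos (by simp)]
    push_cast [← Nat.cast_sum]
    omega
  have h1 : ∀ i : Fin n, (star ((e : ℤ) - t) R i.succ).toNat = R i.castSucc := by
    intro i
    rw [star, if_neg (by simp)]
    simp
    rfl
  simp only [h0, h1, Fin.val_zero, if_true, Fin.val_succ, Fin.val_castSucc, Fin.val_last, hq,
    one_pow, mul_one, Nat.succ_ne_zero, if_false]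
  rw [← mul_assoc, ← pow_add, Nat.add_sub_cancel' h]

/-- The denominators of the τ's and ξ's contribute ℓ^-(t + 2Σr_i), which the factor ℓ^(a + 2b) from
rescaling absorbs; their signs multiply to (-1)^r(S,R). -/
theorem scalar_identity {K : Type*} [Field K] {n : ℕ} {ℓ : K} (hℓ : ℓ ≠ 0) {q : ℕ → K}
    (hq : q n = 1) (hn : n = 0 → ℓ = 1) {a b : ℕ} {S : Finset (Fin n)} {R : Fin n → ℕ}
    (h : S.card + 2 * ∑ i, R i ≤ a + 2 * b) :
    ((-1) ^ n * ℓ) ^ a * ((-1) ^ n * ℓ ^ 2) ^ b *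
        ((∏ i : Fin n, ((-1) ^ ((i : ℕ) + 1) * q (i + 1) / ℓ ^ 2) ^ R i) *
          ∏ s ∈ S, ℓ⁻¹ * (-1) ^ ((s : ℕ) + 1)) =
      (-1) ^ (n * (a + b)) * (-1) ^ rr S R * ∏ i : Fin n, (if (i : ℕ) = 0 then ℓ else q i) ^
        (star (((a + 2 * b : ℕ) : ℤ) - S.card) R i).toNat := by
  have h1 : ∏ s ∈ S, ℓ⁻¹ * (-1) ^ ((s : ℕ) + 1) =
      (ℓ ^ S.card)⁻¹ * (-1) ^ (S.card + ∑ s ∈ S, (s : ℕ)) := by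
    rw [Finset.prod_mul_distrib, Finset.prod_const, inv_pow, Finset.prod_pow_eq_pow_sum,
      Finset.sum_add_distrib, Finset.sum_const, smul_eq_mul, mul_one, add_comm S.card]
  have h2 : ∏ i : Fin n, ((-1) ^ ((i : ℕ) + 1) * q (i + 1) / ℓ ^ 2) ^ R i =
      (ℓ ^ (2 * ∑ i, R i))⁻¹ * (-1) ^ (∑ i : Fin n, ((i : ℕ) + 1) * R i) *
        ∏ i : Fin n, q (i + 1) ^ R i := by
    rw [pow_mul, ← Finset.prod_pow_eq_pow_sum, ← Finset.prod_pow_eq_pow_sum,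
      ← Finset.prod_inv_distrib, ← Finset.prod_mul_distrib, ← Finset.prod_mul_distrib]
    refine Finset.prod_congr rfl fun i _ => ?_
    rw [div_pow, mul_pow, pow_mul]
    ring
  have h3 := prod_star hq hn h
  have h4 : ∏ i : Fin n, q (i + 1) ^ R i = (ℓ ^ (a + 2 * b))⁻¹ * (ℓ ^ (S.card + 2 * ∑ i, R i) *
      ∏ i : Fin n, (if (i : ℕ) = 0 then ℓ else q i) ^
        (star (((a + 2 * b : ℕ) : ℤ) - S.card) R i).toNat) := by
    rw [h3, inv_mul_cancel_left₀ (pow_ne_zero _ hℓ)]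
  rw [h1, h2, h4, rr]
  simp only [mul_pow, pow_add, ← pow_mul, mul_add]
  field_simp

section Expansion

variable (p : ℕ) [Fact p.Prime] {K M : Type*} [Field K] [Algebra (ZMod p) K] [CharP K p]
  [AddCommGroup M] [Module K M] [Module (ZMod p) M] [IsScalarTower (ZMod p) K M] {n N : ℕ}

/-- Milnor's coaction, in the form that expresses the total operation by the invariants. -/
theorem ev_uval_vval (hp : Odd p) {X : Fin n → M} {y : Fin n → K} (hy : lval p y ≠ 0)
    (X' : Fin N → M) (y' : Fin N → K) {a b : ℕ} {z : H p N} (hz : IsBihom a b z)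
    (T : Finset (Fin n) → Finset (Fin n → ℕ))
    (hT : ∀ S R, R ∈ T S ↔ S.card + 2 * ∑ i, R i ≤ a + 2 * b) :
    ev p (fun j => uval p X y (X' j) (y' j)) (fun j => vval p y (y' j)) z =
      ∑ S, ∑ R ∈ T S, ((-1 : K) ^ (n * (a + b)) * (-1) ^ rr S R) •
        (ev p X y (MQ p (le_refl n) S
            fun i => (star (((a + 2 * b : ℕ) : ℤ) - S.card) R i).toNat) *
          ev p X' y' (St S R z)) := by
  have hhalf : half p * 2 = p - 1 := by
    obtain ⟨m, hm⟩ := hp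
    rw [half]
    omega
  set ℓ := lval p y ^ half p with hℓdef
  have hℓ : ℓ ≠ 0 := pow_ne_zero _ hy
  have hq0 : qval p y 0 = ℓ ^ 2 := by rw [qval_zero p hy, hℓdef, ← pow_mul, hhalf]
  have hqn : qval p y n = 1 := qval_self p hy
  -- The parameters are chosen so that the coaction becomes x ↦ U, y ↦ V after division by (-1)^n ℓ
  -- and (-1)^n ℓ²; the latter is the coefficient of w in V because Q_{n,0} = ℓ².
  let τ : Fin n → M := fun s => (ℓ⁻¹ * (-1) ^ ((s : ℕ) + 1)) • mtval p X y s
  let ξ : Fin n → K := fun i => (-1) ^ ((i : ℕ) + 1) * qval p y (i + 1) / ℓ ^ 2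
  let Xt : Fin n ⊕ₗ Fin N → M := fun i => Sum.elim τ X' (ofLex i)
  let yt : Fin n ⊕ₗ Fin N → K := fun i => Sum.elim ξ y' (ofLex i)
  have hu : (fun j => uval p X y (X' j) (y' j)) = fun j => ((-1) ^ n * ℓ) •
      (X' j + ∑ i : Fin n, y' j ^ p ^ (i : ℕ) • τ i) := by
    funext j
    rw [uval, mul_smul, smul_add ℓ (X' j), Finset.smul_sum]
    congr 2
    refine Finset.sum_congr rfl fun i _ => ?_
    simp only [τ, smul_smul]
    congr 1
    field_simp
  have hv : (fun j => vval p y (y' j)) = fun j => ((-1) ^ n * ℓ ^ 2) *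
      (y' j + ∑ i : Fin n, ξ i * y' j ^ p ^ ((i : ℕ) + 1)) := by
    ext j
    rw [vval_eq, Fin.sum_univ_succ, mul_add, Finset.mul_sum]
    congr 1
    · simp [hq0]
    · refine Finset.sum_congr rfl fun i _ => ?_
      simp only [ξ, Fin.val_succ, pow_add]
      field_simp
  have h1 := ev_coaction Xt yt z
  have h2 := ev_eq_sum_component Xt yt (coaction p n N z) T fun S R hR => by
    rw [← St_eq_component]
    exact St_eq_zero hz (not_le.1 fun h => hR ((hT S R).2 h))
  rw [h1] at h2
  rw [hu, hv, hz.ev_smul]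
  refine (congrArg _ h2).trans ?_
  rw [Finset.smul_sum]
  refine Finset.sum_congr rfl fun S _ => ?_
  rw [Finset.smul_sum]
  refine Finset.sum_congr rfl fun R hR => ?_
  rw [ev_MQ X y (le_refl n) hy]
  change _ • (∏ i, ξ i ^ R i) • (wedge K τ S * ev p X' y' (component S R (coaction p n N z))) = _
  rw [← St_eq_component, wedge_smul, smul_mul_assoc, smul_smul, smul_smul, smul_mul_assoc,
    smul_smul]
  congr 1
  have h3 := scalar_identity (S := S) (R := R) hℓ hqn (fun hn => by subst hn; simp [hℓdef, lval_zero])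
    ((hT S R).1 hR)
  exact (mul_assoc _ _ _).trans h3

end Expansion

/-! ### Independence of the monomials in the invariants -/

section Independence

variable (p : ℕ) [Fact p.Prime] {K : Type*} [Field K] [Algebra (ZMod p) K] [CharP K p]

/-- The even invariants `L̃_k, Q_{k,1}, …, Q_{k,k-1}, V_{k+1}`. -/
noncomputable def evenval {k : ℕ} (y : Fin k → K) (w : K) : Fin (k + 1) → K :=
  Fin.snoc (fun i : Fin k => if (i : ℕ) = 0 then lval p y ^ half p else qval p y i) (vval p y w)

/-- w is a root of V_{k+1}(X) - V_{k+1}(w), which has coefficients in `B` and positive degree p^k.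
-/
theorem isAlgebraic_of_vpoly {k : ℕ} {y : Fin k → K} (hy : lval p y ≠ 0) (B : Subalgebra (ZMod p) K)
    (hq : ∀ s : Fin (k + 1), qval p y s ∈ B) {w : K} (hw : vval p y w ∈ B) : IsAlgebraic B w := by
  let P : Polynomial B := ∑ s : Fin (k + 1),
    Polynomial.C ((-1) ^ (k + (s : ℕ)) * ⟨qval p y s, hq s⟩) * Polynomial.X ^ p ^ (s : ℕ)
  have hP : P.map (algebraMap B K) = vpoly p y := by
    simp only [P, Polynomial.map_sum, Polynomial.map_mul, Polynomial.map_C, Polynomial.map_pow,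
      Polynomial.map_X, vpoly, map_mul, map_pow, map_neg, map_one, Polynomial.map_neg,
      Polynomial.map_one]
    rfl
  have hP' : (P - Polynomial.C (⟨vval p y w, hw⟩ : B)).map (algebraMap B K) =
      vpoly p y - Polynomial.C (vval p y w) := by
    rw [Polynomial.map_sub, hP, Polynomial.map_C]
    rfl
  refine ⟨P - Polynomial.C (⟨vval p y w, hw⟩ : B), fun h => ?_, ?_⟩
  · rw [h, Polynomial.map_zero, eq_comm, sub_eq_zero] at hP'
    have h1 := (vpoly_monic_natDegree p hy).2
    rw [hP', Polynomial.natDegree_C] at h1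
    exact (pow_pos (Fact.out : p.Prime).pos k).ne h1
  · rw [← Polynomial.eval_map_algebraMap, hP']
    simp [vval]

/-- All k + 1 variables are algebraic over the algebra generated by these k + 1 invariants. A
generating set of that size, with transcendence degree at least k + 1, is a transcendence basis. -/
theorem algebraicIndependent_evenval (hp : Odd p) {K : Type} [Field K]
    [Algebra (ZMod p) K] [CharP K p] {k : ℕ} [Algebra (MvPolynomial (Fin (k + 1)) (ZMod p)) K]
    [IsScalarTower (ZMod p) (MvPolynomial (Fin (k + 1)) (ZMod p)) K]
    [IsFractionRing (MvPolynomial (Fin (k + 1)) (ZMod p)) K] :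
    AlgebraicIndependent (ZMod p) (evenval p
      (fun i : Fin k => algebraMap (MvPolynomial (Fin (k + 1)) (ZMod p)) K
        (MvPolynomial.X i.castSucc))
      (algebraMap (MvPolynomial (Fin (k + 1)) (ZMod p)) K (MvPolynomial.X (Fin.last k)))) := by
  set Y : Fin (k + 1) → K := fun i =>
    algebraMap (MvPolynomial (Fin (k + 1)) (ZMod p)) K (MvPolynomial.X i) with hYdef
  have hY : AlgebraicIndependent (ZMod p) Y :=
    (MvPolynomial.algebraicIndependent_X (Fin (k + 1)) (ZMod p)).map'
      (f := IsScalarTower.toAlgHom (ZMod p) _ K) (IsFractionRing.injective _ K)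
  have hy : lval p (fun i : Fin k => Y i.castSucc) ≠ 0 :=
    lval_ne_zero p (hY.linearIndependent.comp _ (Fin.castSucc_injective k))
  set v := evenval p (fun i : Fin k => Y i.castSucc) (Y (Fin.last k)) with hv
  let B := Algebra.adjoin (ZMod p) (Set.range v)
  have hvB : ∀ i, v i ∈ B := fun i => Algebra.subset_adjoin ⟨i, rfl⟩
  have hq : ∀ s : Fin (k + 1), qval p (fun i : Fin k => Y i.castSucc) s ∈ B := by
    intro s
    refine Fin.lastCases ?_ (fun s => ?_) s
    · rw [Fin.val_last, qval_self p hy]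
      exact one_mem _
    · have h1 := hvB s.castSucc
      rw [hv, evenval, Fin.snoc_castSucc] at h1
      split_ifs at h1 with h0
      · rw [Fin.val_castSucc, h0, qval_zero p hy]
        have : half p * 2 = p - 1 := by
          obtain ⟨m, hm⟩ := hp
          rw [half]
          omega
        rw [← this, pow_mul]
        exact pow_mem h1 2
      · exact h1
  have hYalg : ∀ i, IsAlgebraic B (Y i) := by
    intro i
    refine Fin.lastCases ?_ (fun i => ?_) i
    · refine isAlgebraic_of_vpoly p hy B hq ?_
      have h1 := hvB (Fin.last k)
      rwa [hv, evenval, Fin.snoc_last] at h1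
    · refine isAlgebraic_of_vpoly p hy B hq ?_
      rw [vval_self p (fun i : Fin k => Y i.castSucc) i]
      exact zero_mem _
  have hpoly : ∀ f : MvPolynomial (Fin (k + 1)) (ZMod p), IsAlgebraic B (algebraMap _ K f) := by
    intro f
    induction f using MvPolynomial.induction_on with
    | C a =>
      have : algebraMap (MvPolynomial (Fin (k + 1)) (ZMod p)) K (MvPolynomial.C a) =
          algebraMap B K (algebraMap (ZMod p) B a) := by
        rw [← IsScalarTower.algebraMap_apply, ← MvPolynomial.algebraMap_eq,
          ← IsScalarTower.algebraMap_apply]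
      rw [this]
      exact isAlgebraic_algebraMap _
    | add f g hf hg => rw [map_add]; exact hf.add hg
    | mul_X f i hf => rw [map_mul]; exact hf.mul (hYalg i)
  have : Algebra.IsAlgebraic B K := by
    refine ⟨fun x => ?_⟩
    obtain ⟨f, g, -, rfl⟩ := IsFractionRing.div_surjective (MvPolynomial (Fin (k + 1)) (ZMod p)) x
    rw [div_eq_mul_inv]
    exact (hpoly f).mul (hpoly g).inv
  exact (Algebra.IsAlgebraic.isTranscendenceBasis_of_le_trdeg_of_finite (ZMod p) v
    hY.cardinalMk_le_trdeg).1

/-- The odd invariants `M̃_{k,0}, …, M̃_{k,k-1}, U_{k+1}`. -/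
noncomputable def oddval {M : Type*} [AddCommGroup M] [Module K M] {k : ℕ} (X : Fin k → M)
    (y : Fin k → K) (x : M) (w : K) : Fin (k + 1) → M :=
  Fin.snoc (fun i : Fin k => mtval p X y i) (uval p X y x w)

/-- Up to the invertible factor L̃_k, each basis vector is a combination of these k + 1 vectors: the
last one by the definition of U, the others by the vanishing of U at repeated pairs. Spanning then
gives independence. -/
theorem linearIndependent_oddval (hh : 0 < half p) {M : Type*} [AddCommGroup M] [Module K M] {k : ℕ}
    (b : Module.Basis (Fin (k + 1)) K M) {y : Fin k → K} (hy : lval p y ≠ 0) (w : K) :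
    LinearIndependent K (oddval p (fun i => b i.castSucc) y (b (Fin.last k)) w) := by
  have hfin : Module.Finite K M := Module.Finite.of_basis b
  set W := oddval p (fun i => b i.castSucc) y (b (Fin.last k)) w with hW
  have hmt : ∀ j : Fin k, mtval p (fun i => b i.castSucc) y j ∈ Submodule.span K (Set.range W) := by
    intro j
    refine Submodule.subset_span ⟨j.castSucc, ?_⟩
    rw [hW, oddval, Fin.snoc_castSucc]
  have hu : uval p (fun i => b i.castSucc) y (b (Fin.last k)) w ∈
      Submodule.span K (Set.range W) := by
    refine Submodule.subset_span ⟨Fin.last k, ?_⟩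
    rw [hW, oddval, Fin.snoc_last]
  have hsum : ∀ c : Fin k → K, ∑ j : Fin k, (-1 : K) ^ ((j : ℕ) + 1) • c j •
      mtval p (fun i => b i.castSucc) y j ∈ Submodule.span K (Set.range W) := fun c =>
    Submodule.sum_mem _ fun j _ => Submodule.smul_mem _ _ (Submodule.smul_mem _ _ (hmt j))
  have hℓ : lval p y ^ half p ≠ 0 := pow_ne_zero _ hy
  have key : ∀ x : M, lval p y ^ half p • x ∈ Submodule.span K (Set.range W) →
      x ∈ Submodule.span K (Set.range W) := fun x hx => by
    have := Submodule.smul_mem _ (lval p y ^ half p)⁻¹ hx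
    rwa [smul_smul, inv_mul_cancel₀ hℓ, one_smul] at this
  refine linearIndependent_of_top_le_span_of_card_eq_finrank ?_
    (Module.finrank_eq_card_basis b).symm
  rw [← b.span_eq, Submodule.span_le]
  rintro _ ⟨i, rfl⟩
  refine key _ ?_
  refine Fin.lastCases ?_ (fun i => ?_) i
  · have h1 : (-1 : K) ^ k • uval p (fun i => b i.castSucc) y (b (Fin.last k)) w =
        lval p y ^ half p • b (Fin.last k) + ∑ j : Fin k, (-1 : K) ^ ((j : ℕ) + 1) •
          w ^ p ^ (j : ℕ) • mtval p (fun i => b i.castSucc) y j := by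
      rw [uval, smul_smul, ← mul_pow, neg_one_mul, neg_neg, one_pow, one_smul]
    rw [← add_sub_cancel_right (lval p y ^ half p • b (Fin.last k)), ← h1]
    exact Submodule.sub_mem _ (Submodule.smul_mem _ _ hu) (hsum _)
  · rw [eq_neg_of_add_eq_zero_left
      (lval_smul_add_sum_mtval p hh (fun i : Fin k => b i.castSucc) y i)]
    exact Submodule.neg_mem _ (hsum _)

end Independence

/-! ### Values of the monomials in the invariants. -/

section Monomials

variable (p : ℕ) [Fact p.Prime] {K M : Type*} [Field K] [Algebra (ZMod p) K] [CharP K p]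
  [AddCommGroup M] [Module K M] [Module (ZMod p) M] [IsScalarTower (ZMod p) K M] {k : ℕ}

/-- The exponents of the odd invariants in the monomial with a given index. -/
def oddIndex (S : Finset (Fin k)) (e : Fin 2) : Finset (Fin (k + 1)) :=
  S.map Fin.castSuccEmb ∪ if e = 1 then {Fin.last k} else ∅

theorem oddIndex_injective : Function.Injective fun c : Finset (Fin k) × Fin 2 =>
    oddIndex c.1 c.2 := by
  rintro ⟨S, e⟩ ⟨S', e'⟩ h
  have hm : ∀ (T : Finset (Fin k)) (f : Fin 2) (i : Fin k),
      i.castSucc ∈ oddIndex T f ↔ i ∈ T := by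
    intro T f i
    by_cases hf : f = 1 <;> simp [oddIndex, hf, Fin.castSucc_ne_last]
  have hl : ∀ (T : Finset (Fin k)) (f : Fin 2), Fin.last k ∈ oddIndex T f ↔ f = 1 := by
    intro T f
    by_cases hf : f = 1 <;> simp [oddIndex, hf, Fin.castSucc_ne_last]
  have h1 : S = S' := by
    ext i
    rw [← hm S e, ← hm S' e']
    exact iff_of_eq (congrArg (i.castSucc ∈ ·) h)
  have h2 : e = 1 ↔ e' = 1 := by
    rw [← hl S e, ← hl S' e']
    exact iff_of_eq (congrArg (Fin.last k ∈ ·) h)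
  rw [Prod.mk.injEq]
  refine ⟨h1, ?_⟩
  clear h h1 hm hl
  revert h2
  fin_cases e <;> fin_cases e' <;> simp

theorem wedge_oddval (X : Fin k → M) (y : Fin k → K) (x : M) (w : K) (S : Finset (Fin k))
    (e : Fin 2) :
    wedge K (oddval p X y x w) (oddIndex S e) =
      wedge K (fun i : Fin k => mtval p X y i) S * ExteriorAlgebra.ι K (uval p X y x w) ^ (e : ℕ) := by
  have h1 : (fun i : Fin k => mtval p X y i) = oddval p X y x w ∘ Fin.castSuccOrderEmb := by
    funext i
    simp [oddval]
  have h2 : wedge K (oddval p X y x w) (if e = 1 then {Fin.last k} else ∅) =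
      ExteriorAlgebra.ι K (uval p X y x w) ^ (e : ℕ) := by
    fin_cases e <;> simp [wedge, oddval]
  rw [h1, wedge_comp, ← h2]
  refine wedge_eq_mul_of_lt K _ (fun a => ?_) fun a ha b hb => ?_
  · rw [oddIndex, Finset.mem_union]
    rfl
  · obtain ⟨i, -, rfl⟩ := Finset.mem_map.1 ha
    split_ifs at hb
    · rw [Finset.mem_singleton.1 hb]
      exact Fin.castSucc_lt_last i
    · simp at hb

/-- The exponents of the even invariants. -/
noncomputable def evenIndex (e : Fin k → ℕ) (j : ℕ) : Fin (k + 1) →₀ ℕ :=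
  Finsupp.equivFunOnFinite.symm (Fin.snoc e j)

theorem evenIndex_injective : Function.Injective fun c : (Fin k → ℕ) × ℕ =>
    evenIndex c.1 c.2 := by
  rintro ⟨e, j⟩ ⟨e', j'⟩ h
  have h1 := Finsupp.equivFunOnFinite.symm.injective h
  rw [Prod.mk.injEq]
  exact Fin.snoc_injective2 h1

theorem ev_MQUV (hh : 0 < half p) (X : Fin (k + 1) → M) (y : Fin (k + 1) → K)
    (hy : lval p (fun i : Fin k => y i.castSucc) ≠ 0)
    (c : Finset (Fin k) × (Fin k → ℕ) × Fin 2 × ℕ) :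
    ev p X y (MQUV p k c) =
      (∏ i, evenval p (fun i : Fin k => y i.castSucc) (y (Fin.last k)) i ^
        evenIndex c.2.1 c.2.2.2 i) •
      wedge K (oddval p (fun i : Fin k => X i.castSucc) (fun i : Fin k => y i.castSucc)
        (X (Fin.last k)) (y (Fin.last k))) (oddIndex c.1 c.2.2.1) := by
  rw [MQUV, map_mul, map_mul, map_pow, ev_MQ X y (Nat.le_succ k) hy, ev_U hh, ev_poly, map_pow,
    aeval_V y le_rfl hy, wedge_oddval, Fin.prod_univ_castSucc, ← Algebra.commutes,
    ← Algebra.smul_def, smul_mul_assoc, smul_smul, mul_comm]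
  simp only [evenval, evenIndex, Finsupp.equivFunOnFinite_symm_apply_apply, Fin.snoc_castSucc,
    Fin.snoc_last]
  rfl

end Monomials

section Independence

variable (p : ℕ) [Fact p.Prime] (k : ℕ)

theorem linearIndependent_prod_smul_wedge (hp : Odd p) (hh : 0 < half p) (K : Type) [Field K]
    [Algebra (ZMod p) K] [CharP K p] {k : ℕ} [Algebra (MvPolynomial (Fin (k + 1)) (ZMod p)) K]
    [IsScalarTower (ZMod p) (MvPolynomial (Fin (k + 1)) (ZMod p)) K]
    [IsFractionRing (MvPolynomial (Fin (k + 1)) (ZMod p)) K] {X : Fin (k + 1) → Fin (k + 1) → K}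
    (hX : X = fun i => Pi.single i 1) {y : Fin (k + 1) → K}
    (hy : y = fun i => algebraMap (MvPolynomial (Fin (k + 1)) (ZMod p)) K (MvPolynomial.X i))
    (hy' : lval p (fun i : Fin k => y i.castSucc) ≠ 0) :
    LinearIndependent (ZMod p) fun c : Finset (Fin k) × (Fin k → ℕ) × Fin 2 × ℕ =>
      (∏ i, evenval p (fun i : Fin k => y i.castSucc) (y (Fin.last k)) i ^
        evenIndex c.2.1 c.2.2.2 i) •
      wedge K (oddval p (fun i : Fin k => X i.castSucc) (fun i : Fin k => y i.castSucc)
        (X (Fin.last k)) (y (Fin.last k))) (oddIndex c.1 c.2.2.1) := by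
  have h1 := linearIndependent_wedge (linearIndependent_oddval p hh (Pi.basisFun K (Fin (k + 1)))
    hy' (y (Fin.last k)))
  have h2 : LinearIndependent (ZMod p) fun b : Fin (k + 1) →₀ ℕ =>
      ∏ i, evenval p (fun i : Fin k => y i.castSucc) (y (Fin.last k)) i ^ b i := by
    subst hy
    exact linearIndependent_prod_pow p (algebraicIndependent_evenval p hp (K := K) (k := k))
  have h3 := (linearIndependent_smul h2 h1).comp
    (fun c : Finset (Fin k) × (Fin k → ℕ) × Fin 2 × ℕ =>
      (evenIndex c.2.1 c.2.2.2, oddIndex c.1 c.2.2.1)) ?_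
  · simp only [Pi.basisFun_apply] at h3
    subst hX
    exact h3
  · rintro ⟨S, e, ε, j⟩ ⟨S', e', ε', j'⟩ h
    rw [Prod.mk.injEq] at h
    have h4 := evenIndex_injective (a₁ := (e, j)) (a₂ := (e', j')) h.1
    have h5 := oddIndex_injective (a₁ := (S, ε)) (a₂ := (S', ε')) h.2
    simp_all

theorem linearIndependent_MQUV (hp : Odd p) (hh : 0 < half p) :
    LinearIndependent (ZMod p) (MQUV p k) := by
  let K := FractionRing (MvPolynomial (Fin (k + 1)) (ZMod p))
  have : CharP K p := charP_of_algebra_zmod K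
  let X : Fin (k + 1) → Fin (k + 1) → K := fun i => Pi.single i 1
  let y : Fin (k + 1) → K := fun i => algebraMap (MvPolynomial (Fin (k + 1)) (ZMod p)) K (MvPolynomial.X i)
  have hy : lval p (fun i : Fin k => y i.castSucc) ≠ 0 :=
    lval_ne_zero p (linearIndependent_algebraMap_X (Nat.le_succ k))
  refine LinearIndependent.of_comp (ev p X y).toLinearMap ?_
  have h := linearIndependent_prod_smul_wedge p hp hh K (X := X) rfl (y := y) rfl hy
  rwa [← funext (ev_MQUV p hh X y hy)] at h

/-- These are the monomials without U and V, evaluated with one unused variable added, so the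
previous family contains them. -/
theorem linearIndependent_MQ (hp : Odd p) (hh : 0 < half p) :
    LinearIndependent (ZMod p) fun c : Finset (Fin k) × (Fin k → ℕ) =>
      MQ p (le_refl k) c.1 c.2 := by
  let K := FractionRing (MvPolynomial (Fin (k + 1)) (ZMod p))
  have : CharP K p := charP_of_algebra_zmod K
  let X : Fin (k + 1) → Fin (k + 1) → K := fun i => Pi.single i 1
  let y : Fin (k + 1) → K := fun i => algebraMap (MvPolynomial (Fin (k + 1)) (ZMod p)) K (MvPolynomial.X i)
  have hy : lval p (fun i : Fin k => y i.castSucc) ≠ 0 :=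
    lval_ne_zero p (linearIndependent_algebraMap_X (Nat.le_succ k))
  refine LinearIndependent.of_comp
    (ev p (fun i : Fin k => X i.castSucc) (fun i : Fin k => y i.castSucc)).toLinearMap ?_
  have h := (linearIndependent_prod_smul_wedge p hp hh K (X := X) rfl (y := y) rfl hy).comp
    (fun c : Finset (Fin k) × (Fin k → ℕ) => (c.1, c.2, 0, 0)) fun c c' h => by
      simpa [Prod.ext_iff] using h
  convert h using 1
  funext c
  refine (ev_MQ (fun i : Fin k => X i.castSucc) (fun i : Fin k => y i.castSucc) (le_refl k) hy
    c.1 c.2).trans ?_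
  refine Eq.trans ?_ (ev_MQUV p hh X y hy (c.1, c.2, 0, 0))
  rw [MQUV, Fin.val_zero, pow_zero, pow_zero, poly_one, mul_one, mul_one,
    ev_MQ X y (Nat.le_succ k) hy]
  rfl

end Independence

/-! ### The two expansions of the iterated total operation -/

/-- `U_{k+1} ^ δ V_{k+1} ^ (1 - δ)`. -/
noncomputable def uvClass (p k δ : ℕ) : H p (k + 1) :=
  U p (le_refl (k + 1)) ^ δ * poly (V p (le_refl (k + 1))) ^ (1 - δ)

/-- `M̃_{n,s} ^ δ Q_{n,s} ^ (1 - δ)`. -/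
noncomputable def mqClass (p n δ : ℕ) (s : ℤ) : H p n :=
  Mtil p (le_refl n) s ^ δ * poly (Q p (le_refl n) s.toNat) ^ (1 - δ)

/-- The exponent of `U_{k+1}` in the monomial dual to `γ_{p^s}(v_{k+1})`. -/
def uExp (s : ℤ) : Fin 2 := if s = -1 then 1 else 0

/-- The exponent of `V_{k+1}` in the monomial dual to `γ_{p^s}(v_{k+1})`. -/
def vExp (p : ℕ) (s : ℤ) : ℕ := if s = -1 then 0 else p ^ s.toNat

/-- The sequences of natural numbers with `t + 2 ∑ r_i ≤ q`. -/
def boundedSeq (m q t : ℕ) : Finset (Fin m → ℕ) :=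
  (Fintype.piFinset fun _ : Fin m => Finset.range (q + 1)).filter fun R => t + 2 * ∑ i, R i ≤ q

theorem mem_boundedSeq {m q t : ℕ} {R : Fin m → ℕ} :
    R ∈ boundedSeq m q t ↔ t + 2 * ∑ i, R i ≤ q := by
  rw [boundedSeq, Finset.mem_filter, and_iff_right_of_imp]
  intro h
  refine Fintype.mem_piFinset.2 fun i => Finset.mem_range.2 ?_
  have := Finset.single_le_sum (f := R) (fun _ _ => Nat.zero_le _) (Finset.mem_univ i)
  omega

theorem mem_admissible {p n k δ t : ℕ} (hδ : δ ≤ 1) {R : Fin n → ℕ} :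
    R ∈ admissible p n k δ t ↔ t + 2 * ∑ i, R i ≤ (2 - δ) * p ^ k := by
  rw [admissible, Finset.mem_filter, and_iff_right_of_imp]
  intro h
  refine Fintype.mem_piFinset.2 fun i => Finset.mem_range.2 ?_
  have h1 := Finset.single_le_sum (f := R) (fun _ _ => Nat.zero_le _) (Finset.mem_univ i)
  have h2 : (2 - δ) * p ^ k ≤ 2 * p ^ k := Nat.mul_le_mul_right _ (by omega)
  omega

theorem br_natCast (p s : ℕ) : br p s = -2 * (p : ℤ) ^ s := by
  rw [br, zpow_natCast]
  exact_mod_cast Int.floor_intCast (R := ℚ) (-2 * (p : ℤ) ^ s)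

theorem br_neg_one {p : ℕ} (hp : 2 ≤ p) : br p (-1) = -1 := by
  have h : (2 : ℚ) ≤ p := by exact_mod_cast hp
  rw [br, Int.floor_eq_iff, zpow_neg_one]
  have h0 : (0 : ℚ) < p := by linarith
  constructor
  · rw [← div_eq_mul_inv, le_div_iff₀ h0]
    push_cast
    linarith
  · rw [← div_eq_mul_inv, div_lt_iff₀ h0]
    push_cast
    linarith

/-! ### Bidegrees and parities of the two classes. -/

section Degrees

variable {p : ℕ} [Fact p.Prime]

theorem half_pos (hp : Odd p) : 0 < half p := by
  have h2 := (Fact.out : p.Prime).two_le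
  obtain ⟨m, hm⟩ := hp
  rw [half]
  omega

theorem degL_mod_two (hp : Odd p) (k : ℕ) : degL p k % 2 = k % 2 := by
  induction k with
  | zero => rfl
  | succ k ih =>
    have h1 := Nat.odd_iff.1 (hp.pow (n := k))
    rw [degL_succ]
    omega

theorem neg_one_pow_congr {R : Type*} [Ring R] {a b : ℕ} (h : a % 2 = b % 2) :
    (-1 : R) ^ a = (-1) ^ b := by
  rw [neg_one_pow_eq_pow_mod_two, h, ← neg_one_pow_eq_pow_mod_two]

theorem mul_mod_two_congr {a b c d : ℕ} (h : a % 2 = b % 2) (h' : c % 2 = d % 2) :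
    a * c % 2 = b * d % 2 := Nat.ModEq.mul h h'

theorem isBihom_uvClass (hp : Odd p) (k : ℕ) {δ : ℕ} (hδ : δ ≤ 1) :
    ∃ b, IsBihom δ b (uvClass p k δ) ∧ δ + 2 * b = (2 - δ) * p ^ k ∧
      (δ + b) % 2 = (1 + half p * k * δ) % 2 := by
  interval_cases δ
  · refine ⟨p ^ k, ?_, by omega, ?_⟩
    · simpa [uvClass] using IsBihom.poly (isHomogeneous_V (p := p) (le_refl (k + 1)))
    · have := Nat.odd_iff.1 (hp.pow (n := k))
      omega
  · refine ⟨half p * degL p k, ?_, ?_, ?_⟩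
    · simpa [uvClass] using isBihom_U (half_pos hp) (le_refl (k + 1))
    · have := two_mul_half_mul_degL hp k
      omega
    · have := mul_mod_two_congr (rfl : half p % 2 = half p % 2) (degL_mod_two hp k)
      omega

/-- Here s = i - δ, so s = -1 occurs only for i = 0, δ = 1, where the class is L̃_n of odd degree 0;
`uExp` makes this correction. The total degree is the index in R*, and the parity of a + b decides
the sign of the rescaling. -/
theorem isBihom_mqClass (hp : Odd p) {n δ : ℕ} (hδ : δ ≤ 1) {i : ℕ} (hi : i ≤ n) :
    ∃ b, IsBihom (δ - (uExp (i - δ : ℤ) : ℕ)) b (mqClass p n δ (i - δ : ℤ)) ∧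
      ((δ - (uExp (i - δ : ℤ) : ℕ) + 2 * b : ℕ) : ℤ) =
        (2 - (δ : ℤ)) * (p : ℤ) ^ n + br p (i - δ : ℤ) ∧
      (δ - (uExp (i - δ : ℤ) : ℕ) + b) % 2 = half p * n * δ % 2 := by
  interval_cases δ
  · have hle : p ^ i ≤ p ^ n := Nat.pow_le_pow_right (Fact.out : p.Prime).pos hi
    have h1 : ((i : ℤ) - (0 : ℕ)) = i := by simp
    have h2 : uExp (i : ℤ) = 0 := if_neg (by omega)
    rw [h1, h2]
    refine ⟨p ^ n - p ^ i, ?_, ?_, ?_⟩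
    · simpa [mqClass] using IsBihom.poly (isHomogeneous_Q (p := p) (le_refl n) hi)
    · rw [br_natCast]
      push_cast [hle]
      simp
      ring
    · have := Nat.odd_iff.1 (hp.pow (n := n))
      have := Nat.odd_iff.1 (hp.pow (n := i))
      simp
      omega
  · have hmod := mul_mod_two_congr (rfl : half p % 2 = half p % 2) (degL_mod_two hp n)
    have hdeg := two_mul_half_mul_degL hp n
    obtain _ | s := i
    · have h1 : (((0 : ℕ) : ℤ) - (1 : ℕ)) = -1 := by simp
      have h2 : uExp (-1) = 1 := if_pos rfl
      rw [h1, h2]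
      refine ⟨half p * degL p n, ?_, ?_, ?_⟩
      · simpa [mqClass, Mtil] using isBihom_Ltil (p := p) (le_refl n)
      · rw [br_neg_one (Fact.out : p.Prime).two_le]
        zify at hdeg
        push_cast
        simp
        linarith
      · simpa using hmod
    · have h1 : (((s + 1 : ℕ) : ℤ) - (1 : ℕ)) = s := by simp
      have h2 : uExp (s : ℤ) = 0 := if_neg (by omega)
      rw [h1, h2]
      have hle : p ^ s ≤ half p * degL p n := by
        refine le_trans ?_ (Nat.le_mul_of_pos_left _ (half_pos hp))
        exact Finset.single_le_sum (f := fun j => p ^ j) (fun _ _ => Nat.zero_le _)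
          (Finset.mem_range.2 hi)
      refine ⟨half p * degL p n - p ^ s, ?_, ?_, ?_⟩
      · simpa [mqClass] using isBihom_Mtil (half_pos hp) (le_refl n) hi
      · rw [br_natCast]
        zify at hdeg
        push_cast [hle]
        simp
        linarith
      · have := Nat.odd_iff.1 (hp.pow (n := s))
        simp only [Fin.val_zero]
        omega

end Degrees

section Expansions

variable (p : ℕ) [Fact p.Prime] {K M : Type*} [Field K] [Algebra (ZMod p) K] [CharP K p]
  [AddCommGroup M] [Module K M] [Module (ZMod p) M] [IsScalarTower (ZMod p) K M] {n k : ℕ}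

theorem ev_MQ_castSucc (Z : Fin (k + 1) → M) (z : Fin (k + 1) → K)
    (hz : lval p (fun i : Fin k => z i.castSucc) ≠ 0) (S : Finset (Fin k)) (e : Fin k → ℕ) :
    ev p (fun i : Fin k => Z i.castSucc) (fun i : Fin k => z i.castSucc) (MQ p (le_refl k) S e) =
      ev p Z z (MQ p (Nat.le_succ k) S e) :=
  (ev_MQ _ _ (le_refl k) hz S e).trans (ev_MQ Z z (Nat.le_succ k) hz S e).symm

theorem ev_MQ_mul_ev_St {m : ℕ} (Z : Fin m → M) (z : Fin m → K) (X : Fin n → M) (y : Fin n → K)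
    (hk : k ≤ m) (hz : lval p (fun i => z (Fin.castLE hk i)) ≠ 0) {a b : ℕ} {G : H p n}
    (hG : IsBihom a b G) (S : Finset (Fin k)) (e : Fin k → ℕ)
    (R : Fin k → ℕ) :
    ev p Z z (MQ p hk S e) * ev p X y (St S R G) =
      (-1 : K) ^ ((a + S.card) * S.card) •
        (ev p X y (St S R G) * ev p Z z (MQ p hk S e)) := by
  rw [ev_MQ Z z hk hz, smul_mul_assoc, wedge_mul_of_involute K _ _ _ _ (involute_ev_St hG S R X y),
    mul_smul_comm, smul_comm]

/-- The total operation on `H^*(BE^n)`, expressed by the invariants of rank `k`. -/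
theorem ev_uval_vval_swap (hp : Odd p) {Z : Fin (k + 1) → M} {z : Fin (k + 1) → K}
    (hz : lval p (fun i : Fin k => z i.castSucc) ≠ 0) (X : Fin n → M) (y : Fin n → K) {a b q : ℕ}
    {G : H p n} (hG : IsBihom a b G) (hq : a + 2 * b = q) :
    ev p (fun i => uval p (fun j : Fin k => Z j.castSucc) (fun j : Fin k => z j.castSucc)
          (X i) (y i)) (fun i => vval p (fun j : Fin k => z j.castSucc) (y i)) G =
      (-1 : K) ^ (k * (a + b)) • ∑ S : Finset (Fin k), ∑ R ∈ boundedSeq k q S.card,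
        (-1 : K) ^ (rr S R + (a + S.card) * S.card) • (ev p X y (St S R G) *
          ev p Z z (MQ p (Nat.le_succ k) S fun i => (star ((q : ℤ) - S.card) R i).toNat)) := by
  subst hq
  rw [ev_uval_vval p hp hz X y hG (fun S => boundedSeq k (a + 2 * b) S.card)
    fun S R => mem_boundedSeq, Finset.smul_sum]
  refine Finset.sum_congr rfl fun S _ => ?_
  rw [Finset.smul_sum]
  refine Finset.sum_congr rfl fun R _ => ?_
  rw [ev_MQ_castSucc p Z z hz, ev_MQ_mul_ev_St p Z z X y (Nat.le_succ k) hz hG S, smul_smul,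
    smul_smul, pow_add, mul_assoc]

/-- The composition laws exchange the two blocks; then the outer V_{n+1} or U_{n+1} is expanded in
its last argument. For δ = 1 the summand i = 0 is the term L̃_n · U_{k+1}. -/
theorem ev_uval_vval_uvClass (hp : Odd p) {X : Fin n → M} {y : Fin n → K} {Z : Fin (k + 1) → M}
    {z : Fin (k + 1) → K} (h : LinearIndependent (ZMod p) (Sum.elim y z)) {δ : ℕ} (hδ : δ ≤ 1) :
    ev p (fun j => uval p X y (Z j) (z j)) (fun j => vval p y (z j)) (uvClass p k δ) =
      (-1 : K) ^ (n + n * half p * k * δ) • ∑ i : Fin (n + 1), (-1 : K) ^ (i : ℕ) •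
        (ev p (fun i => uval p (fun j : Fin k => Z j.castSucc) (fun j : Fin k => z j.castSucc)
            (X i) (y i)) (fun i => vval p (fun j : Fin k => z j.castSucc) (y i))
          (mqClass p n δ ((i : ℕ) - δ : ℤ)) *
        ev p Z z (U p (le_refl (k + 1)) ^ (uExp ((i : ℕ) - δ : ℤ) : ℕ) *
          poly (V p (le_refl (k + 1)) ^ vExp p ((i : ℕ) - δ : ℤ)))) := by
  have hh := half_pos hp
  have h0 : LinearIndependent (ZMod p) (Sum.elim y fun i : Fin k => z i.castSucc) := by
    have := h.comp (Sum.map id Fin.castSucc)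
      (Sum.map_injective.2 ⟨Function.injective_id, Fin.castSucc_injective k⟩)
    convert this using 1
    ext (i | i) <;> rfl
  have hz : lval p (fun i : Fin k => z i.castSucc) ≠ 0 :=
    lval_ne_zero p (h0.comp _ Sum.inr_injective)
  have hy' : lval p (fun i => vval p (fun j : Fin k => z j.castSucc) (y i)) ≠ 0 :=
    lval_ne_zero p (linearIndependent_vval p (linearIndependent_sum_swap p h0))
  have hz' : lval p (fun j : Fin k => vval p y (z j.castSucc)) ≠ 0 :=
    lval_ne_zero p (linearIndependent_vval p h0)
  have hV : ev p Z z (poly (V p (le_refl (k + 1)))) =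
      algebraMap K _ (vval p (fun j : Fin k => z j.castSucc) (z (Fin.last k))) := by
    rw [ev_poly, aeval_V z (le_refl (k + 1)) hz]
    rfl
  have hU := ev_U hh Z z (le_refl (k + 1))
  interval_cases δ
  · have h1 := aeval_V (fun j => vval p y (z j)) (le_refl (k + 1)) hz'
    have h2 := vval_vval p h0 (z (Fin.last k))
    have hL : ev p (fun j => uval p X y (Z j) (z j)) (fun j => vval p y (z j)) (uvClass p k 0) =
        algebraMap K _ (vval p (fun i => vval p (fun j : Fin k => z j.castSucc) (y i))
          (vval p (fun j : Fin k => z j.castSucc) (z (Fin.last k)))) := by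
      rw [uvClass, pow_zero, one_mul, tsub_zero, pow_one, ev_poly, h1, ← h2]
      rfl
    rw [hL, vval_eq, map_sum, Finset.smul_sum]
    refine Finset.sum_congr rfl fun i _ => ?_
    have h3 : (((i : ℕ) : ℤ) - (0 : ℕ)) = (i : ℕ) := by simp
    have h4 : uExp ((i : ℕ) : ℤ) = 0 := if_neg (by omega)
    have h5 : vExp p ((i : ℕ) : ℤ) = p ^ (i : ℕ) := by simp [vExp]
    rw [h3, h4, h5, mqClass, pow_zero, one_mul, tsub_zero, pow_one, Int.toNat_natCast, ev_poly,
      aeval_Q _ (le_refl n) hy' i.is_le, Fin.val_zero, pow_zero, one_mul, poly_pow, map_pow, hV,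
      ← map_pow, ← map_mul, Algebra.smul_def, Algebra.smul_def, ← map_mul, ← map_mul, mul_zero,
      add_zero, pow_add, ← mul_assoc, ← mul_assoc]
    rfl
  · have h1 := ev_U hh (fun j => uval p X y (Z j) (z j)) (fun j => vval p y (z j)) (le_refl (k + 1))
    have h2 := uval_uval p hh (X := X) (Z := fun j : Fin k => Z j.castSucc) h0 (Z (Fin.last k))
      (z (Fin.last k))
    have hL : ev p (fun j => uval p X y (Z j) (z j)) (fun j => vval p y (z j)) (uvClass p k 1) =
        (-1 : K) ^ (n * k * half p) • ExteriorAlgebra.ι K (uval p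
          (fun i => uval p (fun j : Fin k => Z j.castSucc) (fun j : Fin k => z j.castSucc)
            (X i) (y i)) (fun i => vval p (fun j : Fin k => z j.castSucc) (y i))
          (uval p (fun j : Fin k => Z j.castSucc) (fun j : Fin k => z j.castSucc)
            (Z (Fin.last k)) (z (Fin.last k)))
          (vval p (fun j : Fin k => z j.castSucc) (z (Fin.last k)))) := by
      rw [uvClass, pow_one, tsub_self, pow_zero, mul_one, h1, ← map_smul, ← h2]
      rfl
    rw [hL, uval, map_smul, map_add, map_smul, map_sum, smul_smul, ← pow_add, Fin.sum_univ_succ]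
    congr 1
    · congr 1
      ring
    congr 1
    · have h3 : (((0 : Fin (n + 1)) : ℕ) : ℤ) - (1 : ℕ) = -1 := by simp
      have h4 : uExp (-1) = 1 := if_pos rfl
      have h5 : vExp p (-1) = 0 := if_pos rfl
      rw [h3, h4, h5, mqClass, pow_one, tsub_self, pow_zero, mul_one, Mtil, if_pos rfl, Ltil,
        poly_pow, map_pow, ev_poly, aeval_L, Fin.val_one, pow_one, pow_zero, poly_one, mul_one, hU,
        Fin.val_zero, pow_zero, one_smul, ← map_pow, ← Algebra.smul_def]
      rfl
    · refine Finset.sum_congr rfl fun i _ => ?_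
      have h3 : ((i.succ : ℕ) : ℤ) - (1 : ℕ) = (i : ℕ) := by simp
      have h4 : uExp ((i : ℕ) : ℤ) = 0 := if_neg (by omega)
      have h5 : vExp p ((i : ℕ) : ℤ) = p ^ (i : ℕ) := by simp [vExp]
      rw [h3, h4, h5, mqClass, pow_one, tsub_self, pow_zero, mul_one, ev_Mtil, Fin.val_zero,
        pow_zero, one_mul, poly_pow, map_pow, hV, ← map_pow, ← Algebra.commutes, ← Algebra.smul_def,
        map_smul, map_smul, Fin.val_succ]
      rfl

end Expansions

/-! ### The main identity -/

theorem neg_one_pow_smul_eq {R K M : Type*} [Ring R] [Ring K] [AddCommGroup M] [Module R M]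
    [Module K M] (a : ℕ) (x : M) : (-1 : K) ^ a • x = (-1 : R) ^ a • x := by
  obtain h | h := Nat.even_or_odd a
  · rw [h.neg_one_pow, h.neg_one_pow, one_smul, one_smul]
  · rw [h.neg_one_pow, h.neg_one_pow, neg_one_smul, neg_one_smul]

section Identity

variable (p : ℕ) [Fact p.Prime] {K M : Type*} [Field K] [Algebra (ZMod p) K]
  [AddCommGroup M] [Module K M] [Module (ZMod p) M] [IsScalarTower (ZMod p) K M] {n k : ℕ}

/-- The index of the monomial dual to `m̃_S q̃_{R^*_{(2-δ)p^n + [-2p^s] - t}} ⊗ γ_{p^s}(v_{k+1})`. -/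
def uvIndex (p n δ : ℕ) (s : ℤ) (S : Finset (Fin k)) (R : Fin k → ℕ) :
    Finset (Fin k) × (Fin k → ℕ) × Fin 2 × ℕ :=
  (S, fun i => (star ((2 - (δ : ℤ)) * (p : ℤ) ^ n + br p s - S.card) R i).toNat, uExp s, vExp p s)

/-- Both sides expand, up to one common sign, the value of U_{k+1}^δ V_{k+1}^(1-δ) at the rank n
substitution: the left one directly, the right one after the exchange of the blocks and a second,
rank k, expansion. -/
theorem sum_ev_MQ_mul_ev_St [CharP K p] (hp : Odd p) {X : Fin n → M} {y : Fin n → K}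
    {Z : Fin (k + 1) → M} {z : Fin (k + 1) → K} (h : LinearIndependent (ZMod p) (Sum.elim y z))
    {δ : ℕ} (hδ : δ ≤ 1) :
    ∑ S' : Finset (Fin n), ∑ R' ∈ admissible p n k δ S'.card, (-1 : K) ^ rr S' R' •
        (ev p X y (MQ p (le_refl n) S' fun i =>
            (star ((2 - (δ : ℤ)) * (p : ℤ) ^ k - S'.card) R' i).toNat) *
          ev p Z z (St S' R' (uvClass p k δ))) =
      ∑ i : Fin (n + 1), ∑ S : Finset (Fin k),
        ∑ R ∈ boundedSeq k ((2 - (δ : ℤ)) * (p : ℤ) ^ n + br p ((i : ℕ) - δ : ℤ)).toNat S.card,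
        (-1 : K) ^ (n * half p * k * δ + i + (rr S R +
            (δ - (uExp ((i : ℕ) - δ : ℤ) : ℕ) + S.card) * S.card)) •
          (ev p X y (St S R (mqClass p n δ ((i : ℕ) - δ : ℤ))) *
            ev p Z z (MQUV p k (uvIndex p n δ ((i : ℕ) - δ : ℤ) S R))) := by
  have hy : lval p y ≠ 0 := lval_ne_zero p (h.comp _ Sum.inl_injective)
  have hz : lval p (fun i : Fin k => z i.castSucc) ≠ 0 :=
    lval_ne_zero p ((h.comp _ Sum.inr_injective).comp _ (Fin.castSucc_injective k))
  obtain ⟨b, hb, hab, hpar⟩ := isBihom_uvClass hp k hδ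
  have h1 := ev_uval_vval p hp (X := X) hy Z z hb (fun S' => admissible p n k δ S'.card)
    fun S' R' => by rw [mem_admissible hδ, hab]
  rw [ev_uval_vval_uvClass p hp h hδ] at h1
  have hcast : ((δ + 2 * b : ℕ) : ℤ) = (2 - (δ : ℤ)) * (p : ℤ) ^ k := by
    rw [hab]
    push_cast [show δ ≤ 2 by omega]
    ring
  -- The rescaling sign of the left expansion equals the sign of the exchange, so these two cancel.
  have hn : (-1 : K) ^ (n * (δ + b)) = (-1) ^ (n + n * half p * k * δ) := by
    refine neg_one_pow_congr ?_
    rw [show n + n * half p * k * δ = n * (1 + half p * k * δ) by ring]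
    exact mul_mod_two_congr rfl hpar
  have hsq : ∀ m : ℕ, (-1 : K) ^ m * (-1) ^ m = 1 := fun m => by
    rw [← mul_pow, neg_one_mul, neg_neg, one_pow]
  have h2 := congrArg ((-1 : K) ^ (n + n * half p * k * δ) • ·) h1.symm
  simp only [smul_smul, Finset.smul_sum, hcast, hn, ← mul_assoc, hsq, one_mul] at h2
  rw [h2]
  refine Finset.sum_congr rfl fun i _ => ?_
  obtain ⟨b', hb', hab', hpar'⟩ := isBihom_mqClass hp hδ i.is_le
  have hq : δ - (uExp ((i : ℕ) - δ : ℤ) : ℕ) + 2 * b' =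
      ((2 - (δ : ℤ)) * (p : ℤ) ^ n + br p ((i : ℕ) - δ : ℤ)).toNat := by
    rw [← hab', Int.toNat_natCast]
  rw [ev_uval_vval_swap p hp hz X y hb' hq, ← hq, smul_mul_assoc, Finset.sum_mul, smul_smul,
    Finset.smul_sum]
  refine Finset.sum_congr rfl fun S _ => ?_
  rw [Finset.sum_mul, Finset.smul_sum]
  refine Finset.sum_congr rfl fun R _ => ?_
  rw [smul_mul_assoc, smul_smul, mul_assoc, mul_assoc (ev p X y _), ← map_mul, hab']
  -- The term nhkδ of σ is the sign of this second rescaling, in rank k.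
  have hk : (-1 : K) ^ (k * (δ - (uExp ((i : ℕ) - δ : ℤ) : ℕ) + b')) =
      (-1) ^ (n * half p * k * δ) := by
    refine neg_one_pow_congr ?_
    rw [show n * half p * k * δ = k * (half p * n * δ) by ring]
    exact mul_mod_two_congr rfl hpar'
  rw [hk, pow_add _ _ (rr S R + _), pow_add _ (n * half p * k * δ), ← mul_assoc]
  rw [MQUV, uvIndex, mul_assoc (MQ p _ _ _)]
  congr 1
  ring

variable {m : ℕ}

/-- The product of the values of two classes in disjoint sets of variables. -/
noncomputable def evProd (X : Fin n ⊕ₗ Fin m → M) (y : Fin n ⊕ₗ Fin m → K) :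
    H p n ⊗[ZMod p] H p m →ₗ[ZMod p] ExteriorAlgebra K M :=
  TensorProduct.lift ((LinearMap.mul (ZMod p) (ExteriorAlgebra K M)).compl₁₂
    (ev p (fun i => X (toLex (Sum.inl i))) (fun i => y (toLex (Sum.inl i)))).toLinearMap
    (ev p (fun i => X (toLex (Sum.inr i))) (fun i => y (toLex (Sum.inr i)))).toLinearMap)

theorem evProd_tmul (X : Fin n ⊕ₗ Fin m → M) (y : Fin n ⊕ₗ Fin m → K) (u : H p n) (v : H p m) :
    evProd p X y (u ⊗ₜ v) = ev p (fun i => X (toLex (Sum.inl i))) (fun i => y (toLex (Sum.inl i))) u *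
      ev p (fun i => X (toLex (Sum.inr i))) (fun i => y (toLex (Sum.inr i))) v := rfl

theorem evProd_injective {X : Fin n ⊕ₗ Fin m → M} {y : Fin n ⊕ₗ Fin m → K}
    (hX : LinearIndependent K X) (hy : AlgebraicIndependent (ZMod p) y) :
    Function.Injective (evProd p X y) := by
  let b := (monomialBasis p (Fin n)).tensorProduct (monomialBasis p (Fin m))
  have h1 : ∀ c, evProd p X y (b c) =
      ev p X y (monomialBasis p _ (joinIndex c.1.1 c.1.2 c.2)) := by
    intro c
    rw [Module.Basis.tensorProduct_apply', evProd_tmul, ev_monomialBasis_joinIndex,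
      ev_monomialBasis p _ _ c.1, smul_mul_assoc]
  have h2 : LinearIndependent (ZMod p) fun c => evProd p X y (b c) := by
    simp only [h1]
    refine (((monomialBasis p (Fin n ⊕ₗ Fin m)).linearIndependent.map'
      (ev p X y).toLinearMap (LinearMap.ker_eq_bot.2 (ev_injective p hX hy)))).comp
      (fun c : (Finset (Fin n) × (Fin n →₀ ℕ)) × Finset (Fin m) × (Fin m →₀ ℕ) =>
        joinIndex c.1.1 c.1.2 c.2) ?_
    rintro ⟨⟨S, R⟩, c⟩ ⟨⟨S', R'⟩, c'⟩ h
    obtain ⟨rfl, hR, rfl⟩ := joinIndex_inj h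
    obtain rfl : R = R' := DFunLike.coe_injective hR
    rfl
  have h3 : ∀ u, Finsupp.linearCombination (ZMod p) (fun c => evProd p X y (b c)) (b.repr u) =
      evProd p X y u := by
    intro u
    conv_rhs => rw [← b.linearCombination_repr u, Finsupp.apply_linearCombination]
    rfl
  intro u v huv
  refine b.repr.injective (h2 ?_)
  rw [h3, h3, huv]

end Identity

section Tensor

variable (p : ℕ) [Fact p.Prime] {n k : ℕ}

/-- The preceding identity at generic values, namely the variables in their fraction field and the
standard basis vectors, where evaluation is injective on the tensor product. -/
theorem sum_MQ_tmul_St (hp : Odd p) {δ : ℕ} (hδ : δ ≤ 1) :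
    ∑ S' : Finset (Fin n), ∑ R' ∈ admissible p n k δ S'.card, (-1 : ZMod p) ^ rr S' R' •
        (MQ p (le_refl n) S' (fun i =>
            (star ((2 - (δ : ℤ)) * (p : ℤ) ^ k - S'.card) R' i).toNat) ⊗ₜ[ZMod p]
          St S' R' (uvClass p k δ)) =
      ∑ i : Fin (n + 1), ∑ S : Finset (Fin k),
        ∑ R ∈ boundedSeq k ((2 - (δ : ℤ)) * (p : ℤ) ^ n + br p ((i : ℕ) - δ : ℤ)).toNat S.card,
        (-1 : ZMod p) ^ (n * half p * k * δ + i + (rr S R +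
            (δ - (uExp ((i : ℕ) - δ : ℤ) : ℕ) + S.card) * S.card)) •
          (St S R (mqClass p n δ ((i : ℕ) - δ : ℤ)) ⊗ₜ[ZMod p]
            MQUV p k (uvIndex p n δ ((i : ℕ) - δ : ℤ) S R)) := by
  let I := Fin n ⊕ₗ Fin (k + 1)
  let K := FractionRing (MvPolynomial I (ZMod p))
  have : CharP K p := charP_of_algebra_zmod K
  let X : I → I → K := fun i => Pi.single i 1
  let y : I → K := fun i => algebraMap (MvPolynomial I (ZMod p)) K (MvPolynomial.X i)
  have hX : LinearIndependent K X := by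
    have := (Pi.basisFun K I).linearIndependent
    rwa [show ⇑(Pi.basisFun K I) = X from funext fun i => Pi.basisFun_apply K I i] at this
  have hy : AlgebraicIndependent (ZMod p) y :=
    (MvPolynomial.algebraicIndependent_X I (ZMod p)).map'
      (f := IsScalarTower.toAlgHom (ZMod p) _ K) (IsFractionRing.injective _ K)
  have h : LinearIndependent (ZMod p) (Sum.elim (fun i : Fin n => y (toLex (Sum.inl i)))
      fun i : Fin (k + 1) => y (toLex (Sum.inr i))) := by
    rw [show Sum.elim (fun i : Fin n => y (toLex (Sum.inl i)))
      (fun i : Fin (k + 1) => y (toLex (Sum.inr i))) = y ∘ toLex by ext (i | i) <;> rfl]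
    exact hy.linearIndependent.comp _ (toLex (α := Fin n ⊕ Fin (k + 1))).injective
  refine evProd_injective p hX hy ?_
  have h1 := sum_ev_MQ_mul_ev_St p hp (X := fun i : Fin n => X (toLex (Sum.inl i)))
    (Z := fun i : Fin (k + 1) => X (toLex (Sum.inr i))) h hδ
  simp only [neg_one_pow_smul_eq (R := ZMod p) (K := K)] at h1
  simpa only [map_sum, map_smul, evProd_tmul] using h1

end Tensor

/-! ### Dual functionals -/

theorem exists_dual {F W ι : Type*} [Field F] [AddCommGroup W] [Module F W] {b : ι → W}
    (hb : LinearIndependent F b) (i : ι) :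
    ∃ g : W →ₗ[F] F, g (b i) = 1 ∧ ∀ j, j ≠ i → g (b j) = 0 := by
  obtain ⟨g, hg⟩ := LinearMap.exists_extend ((Finsupp.lapply i).comp hb.repr)
  have h : ∀ j, g (b j) = Finsupp.single j (1 : F) i := by
    intro j
    have h1 := LinearMap.congr_fun hg ⟨b j, Submodule.subset_span ⟨j, rfl⟩⟩
    have h2 := hb.repr_eq_single j ⟨b j, Submodule.subset_span ⟨j, rfl⟩⟩ rfl
    simpa [h2] using h1
  exact ⟨g, by rw [h, Finsupp.single_eq_same], fun j hj => by
    rw [h, Finsupp.single_eq_of_ne' hj]⟩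

theorem dualValue_eq {p : ℕ} [Fact p.Prime] {ι W : Type} [AddCommGroup W] [Module (ZMod p) W]
    {b : ι → W} (hb : LinearIndependent (ZMod p) b) {i : ι} {z : W}
    (hz : z ∈ Submodule.span (ZMod p) (Set.range b)) {g : W →ₗ[ZMod p] ZMod p} (hg : g (b i) = 1)
    (hg' : ∀ j, j ≠ i → g (b j) = 0) : dualValue b i z = g z := by
  rw [dualValue, dif_pos ⟨hb, hz⟩]
  have h1 := hb.linearCombination_repr ⟨z, hz⟩
  conv_rhs => rw [← show (⟨z, hz⟩ : Submodule.span (ZMod p) (Set.range b)).1 = z from rfl, ← h1]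
  rw [Finsupp.apply_linearCombination, Finsupp.linearCombination_apply, Finsupp.sum,
    Finset.sum_eq_single i]
  · simp [hg]
  · intro j _ hj
    simp [hg' j hj]
  · intro hi
    simp [Finsupp.notMem_support_iff.1 hi]

/-- `T` is diagonal on the independent vectors φ(b_i), so an eigenvector in their span involves only
those with its own eigenvalue. -/
theorem eq_of_dualValue_ne_zero {p : ℕ} [Fact p.Prime] {ι W E : Type} [AddCommGroup W]
    [Module (ZMod p) W] [AddCommGroup E] [Module (ZMod p) E] (φ : W →ₗ[ZMod p] E) {b : ι → W}
    (hb : LinearIndependent (ZMod p) (φ ∘ b)) (T : E →ₗ[ZMod p] E) {c : ι → ZMod p} {d : ZMod p}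
    (hT : ∀ i, T (φ (b i)) = c i • φ (b i)) {z : W}
    (hz : z ∈ Submodule.span (ZMod p) (Set.range b)) (hd : T (φ z) = d • φ z) {i : ι}
    (hi : dualValue (p := p) b i z ≠ 0) : c i = d := by
  obtain ⟨g, hg, hg'⟩ := exists_dual hb i
  rw [dualValue_eq (hb.of_comp φ) hz (g := g.comp φ) hg hg'] at hi
  have h : ∀ w ∈ Submodule.span (ZMod p) (Set.range b), g (T (φ w)) = c i * g (φ w) := by
    intro w hw
    induction hw using Submodule.span_induction with
    | mem w hw =>
      obtain ⟨j, rfl⟩ := hw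
      rw [hT, map_smul, smul_eq_mul]
      by_cases hj : j = i
      · rw [hj]
      · have : g (φ (b j)) = 0 := hg' j hj
        rw [this, mul_zero, mul_zero]
    | zero => simp
    | add w w' _ _ hw hw' => simp only [map_add, mul_add, hw, hw']
    | smul a w _ hw =>
      simp only [map_smul, smul_eq_mul, hw]
      ring
  have h1 := h z hz
  rw [hd, map_smul, smul_eq_mul] at h1
  exact (mul_right_cancel₀ hi h1).symm

/-- The shifted entries recover all of R except r_m, and the first entry, not truncated under the
bounds, recovers the sum and hence r_m. -/
theorem star_toNat_injOn {m : ℕ} {q : ℤ} {R R' : Fin m → ℕ} (hR : 2 * (∑ i, R i : ℕ) ≤ q)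
    (hR' : 2 * (∑ i, R' i : ℕ) ≤ q)
    (h : (fun i => (star q R i).toNat) = fun i => (star q R' i).toNat) : R = R' := by
  obtain _ | m := m
  · exact Subsingleton.elim _ _
  have h1 : ∀ i : Fin m, R i.castSucc = R' i.castSucc := by
    intro i
    have h2 := congrFun h i.succ
    simp only [star, if_neg (show ¬((i.succ : Fin (m + 1)) : ℕ) = 0 by simp)] at h2
    simp only [Fin.val_succ, add_tsub_cancel_right, Int.toNat_natCast] at h2
    exact h2
  have h0 := congrFun h 0
  simp only [star, Fin.val_zero, if_true, ← Nat.cast_sum] at h0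
  have h3 : ∑ i, R i = ∑ i, R' i := by omega
  rw [Fin.sum_univ_castSucc, Fin.sum_univ_castSucc, Finset.sum_congr rfl fun i _ => h1 i,
    add_right_inj] at h3
  funext i
  refine Fin.lastCases h3 h1 i

/-! ### Extraction of coefficients by dual functionals. -/

section Coefficients

variable (p : ℕ) [Fact p.Prime] {n k : ℕ}

theorem uExp_vExp_injective {s s' : ℤ} (hs : -1 ≤ s) (hs' : -1 ≤ s') (hu : uExp s = uExp s')
    (hv : vExp p s = vExp p s') : s = s' := by
  rw [uExp, uExp] at hu
  rw [vExp, vExp] at hv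
  by_cases h : s = -1 <;> by_cases h' : s' = -1 <;> simp only [h, h', if_true, if_false] at hu hv
  · rw [h, h']
  · exact absurd hu (by decide)
  · exact absurd hu (by decide)
  · have := Nat.pow_right_injective (Fact.out : p.Prime).two_le hv
    omega

/-- A functional dual to one monomial on the left factor of `sum_MQ_tmul_St` leaves a single
operation on one side and a combination of the required monomials on the other. -/
theorem St_uvClass_mem_span (hp : Odd p) {δ : ℕ} (hδ : δ ≤ 1) (S' : Finset (Fin n))
    (R' : Fin n → ℕ) :
    St S' R' (uvClass p k δ) ∈ Submodule.span (ZMod p) (Set.range (MQUV p k)) := by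
  by_cases hR : R' ∈ admissible p n k δ S'.card
  swap
  · obtain ⟨b, hb, hab, -⟩ := isBihom_uvClass hp k hδ
    rw [St_eq_zero hb (by rw [mem_admissible hδ] at hR; omega)]
    exact zero_mem _
  obtain ⟨f, hf, hf'⟩ := exists_dual (linearIndependent_MQ p n hp (half_pos hp))
    (S', fun i => (star ((2 - (δ : ℤ)) * (p : ℤ) ^ k - S'.card) R' i).toNat)
  have h := congrArg ((TensorProduct.lid (ZMod p) (H p (k + 1))).toLinearMap.comp
    (TensorProduct.map f LinearMap.id)) (sum_MQ_tmul_St p (n := n) (k := k) hp hδ)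
  simp only [map_sum, map_smul, LinearMap.comp_apply, TensorProduct.map_tmul, LinearMap.id_apply,
    LinearEquiv.coe_coe, TensorProduct.lid_tmul] at h
  rw [Finset.sum_eq_single S', Finset.sum_eq_single R', hf, one_smul] at h
  · have h1 : St S' R' (uvClass p k δ) =
        (-1 : ZMod p) ^ rr S' R' • (-1 : ZMod p) ^ rr S' R' • St S' R' (uvClass p k δ) := by
      rw [smul_smul, ← mul_pow, neg_one_mul, neg_neg, one_pow, one_smul]
    rw [h1, h]
    refine Submodule.smul_mem _ _ (Submodule.sum_mem _ fun i _ => Submodule.sum_mem _ fun S _ =>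
      Submodule.sum_mem _ fun R _ => Submodule.smul_mem _ _ (Submodule.smul_mem _ _ ?_))
    exact Submodule.subset_span ⟨_, rfl⟩
  · intro R'' hR'' hne
    rw [hf' (S', _) fun he => hne ?_, zero_smul, smul_zero]
    rw [mem_admissible hδ] at hR hR''
    have hc : (((2 - δ) * p ^ k : ℕ) : ℤ) = (2 - (δ : ℤ)) * (p : ℤ) ^ k := by
      push_cast [show δ ≤ 2 by omega]
      ring
    refine star_toNat_injOn ?_ ?_ (Prod.ext_iff.1 he).2 <;> rw [← hc] <;> omega
  · exact fun h => absurd hR h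
  · intro S'' _ hne
    refine Finset.sum_eq_zero fun R'' _ => ?_
    rw [hf' (S'', _) fun he => hne (Prod.ext_iff.1 he).1, zero_smul, smul_zero]
  · exact fun h => absurd (Finset.mem_univ _) h

theorem card_oddIndex (S : Finset (Fin k)) (e : Fin 2) :
    (oddIndex S e).card = S.card + (e : ℕ) := by
  rw [oddIndex, Finset.card_union_of_disjoint, Finset.card_map]
  · fin_cases e <;> simp
  · rw [Finset.disjoint_left]
    intro a ha hb
    obtain ⟨i, -, rfl⟩ := Finset.mem_map.1 ha
    split_ifs at hb
    · exact Fin.castSucc_ne_last i (Finset.mem_singleton.1 hb)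
    · simp at hb

/-- Compare eigenvalues of the grading involution: the operation yields parity δ + t', the monomial
has parity t + e. -/
theorem parity_of_dualValue_ne_zero (hp : Odd p) {δ : ℕ} (hδ : δ ≤ 1) {S' : Finset (Fin n)}
    {R' : Fin n → ℕ} {c : Finset (Fin k) × (Fin k → ℕ) × Fin 2 × ℕ}
    (h : dualValue (p := p) (MQUV p k) c (St S' R' (uvClass p k δ)) ≠ 0) :
    (c.1.card + (c.2.2.1 : ℕ)) % 2 = (δ + S'.card) % 2 := by
  obtain ⟨b, hb, -, -⟩ := isBihom_uvClass hp k hδ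
  have hh := half_pos hp
  let K := FractionRing (MvPolynomial (Fin (k + 1)) (ZMod p))
  have : CharP K p := charP_of_algebra_zmod K
  let X : Fin (k + 1) → Fin (k + 1) → K := fun i => Pi.single i 1
  let y : Fin (k + 1) → K := fun i =>
    algebraMap (MvPolynomial (Fin (k + 1)) (ZMod p)) K (MvPolynomial.X i)
  have hy : lval p (fun i : Fin k => y i.castSucc) ≠ 0 :=
    lval_ne_zero p (linearIndependent_algebraMap_X (Nat.le_succ k))
  have hLI := linearIndependent_prod_smul_wedge p hp hh K (X := X) rfl (y := y) rfl hy
  rw [← funext (ev_MQUV p hh X y hy)] at hLI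
  have h1 := eq_of_dualValue_ne_zero (ev p X y).toLinearMap hLI
    ((CliffordAlgebra.involute (Q := (0 : QuadraticForm K (Fin (k + 1) → K)))).toLinearMap.restrictScalars (ZMod p))
    (c := fun c => (-1) ^ (c.1.card + (c.2.2.1 : ℕ))) (d := (-1) ^ (δ + S'.card)) ?_
    (St_uvClass_mem_span p hp hδ S' R') ?_ h
  · have h2 : (-1 : ZMod p) ≠ 1 := by
      have : Fact (2 < p) := ⟨by
        have := (Fact.out : p.Prime).two_le
        obtain ⟨m, hm⟩ := hp
        omega⟩
      exact ZMod.neg_one_ne_one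
    by_contra hne
    obtain ha | ha := Nat.even_or_odd (c.1.card + (c.2.2.1 : ℕ)) <;>
    obtain hb | hb := Nat.even_or_odd (δ + S'.card) <;>
    rw [ha.neg_one_pow, hb.neg_one_pow] at h1
    · exact hne ((Nat.even_iff.1 ha).trans (Nat.even_iff.1 hb).symm)
    · exact h2 h1.symm
    · exact h2 h1
    · exact hne ((Nat.odd_iff.1 ha).trans (Nat.odd_iff.1 hb).symm)
  · intro c
    change CliffordAlgebra.involute (ev p X y (MQUV p k c)) = _ • ev p X y (MQUV p k c)
    rw [ev_MQUV p hh X y hy, map_smul, involute_wedge, card_oddIndex, smul_comm,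
      neg_one_pow_smul_eq (R := ZMod p)]
  · change CliffordAlgebra.involute (ev p X y _) = _ • ev p X y _
    rw [involute_ev_St hb, neg_one_pow_smul_eq (R := ZMod p)]

/-- The formula before the comparison of signs. -/
theorem sum_dualValue_smul_MQ (hp : Odd p) {δ : ℕ} (hδ : δ ≤ 1) {i : ℕ} (hi : i ≤ n)
    {S : Finset (Fin k)} {R : Fin k → ℕ}
    (hR : R ∈ boundedSeq k ((2 - (δ : ℤ)) * (p : ℤ) ^ n + br p (i - δ : ℤ)).toNat S.card) :
    St S R (mqClass p n δ (i - δ : ℤ)) =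
      ∑ S' : Finset (Fin n), ∑ R' ∈ admissible p n k δ S'.card,
        ((-1 : ZMod p) ^ (n * half p * k * δ + i + (rr S R +
            (δ - (uExp (i - δ : ℤ) : ℕ) + S.card) * S.card) + rr S' R') *
          dualValue (MQUV p k) (uvIndex p n δ (i - δ : ℤ) S R) (St S' R' (uvClass p k δ))) •
        MQ p (le_refl n) S' fun i =>
          (star ((2 - (δ : ℤ)) * (p : ℤ) ^ k - S'.card) R' i).toNat := by
  have hLI := linearIndependent_MQUV p k hp (half_pos hp)
  obtain ⟨b, -, hq, -⟩ := isBihom_mqClass (p := p) hp hδ hi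
  have hq0 : 0 ≤ (2 - (δ : ℤ)) * (p : ℤ) ^ n + br p (i - δ : ℤ) := by
    rw [← hq]
    exact Nat.cast_nonneg _
  obtain ⟨g, hg, hg'⟩ := exists_dual hLI (uvIndex p n δ (i - δ : ℤ) S R)
  have h := congrArg ((TensorProduct.rid (ZMod p) (H p n)).toLinearMap.comp
    (TensorProduct.map LinearMap.id g)) (sum_MQ_tmul_St p (n := n) (k := k) hp hδ)
  simp only [map_sum, map_smul, LinearMap.comp_apply, TensorProduct.map_tmul, LinearMap.id_apply,
    LinearEquiv.coe_coe, TensorProduct.rid_tmul] at h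
  rw [Finset.sum_eq_single (⟨i, Nat.lt_succ_of_le hi⟩ : Fin (n + 1)),
    Finset.sum_eq_single S, Finset.sum_eq_single R, hg, one_smul] at h
  · have h1 := congrArg ((-1 : ZMod p) ^ (n * half p * k * δ + i + (rr S R +
            (δ - (uExp (i - δ : ℤ) : ℕ) + S.card) * S.card)) • ·) h
    dsimp only at h1
    rw [smul_smul, ← mul_pow, neg_one_mul, neg_neg, one_pow, one_smul] at h1
    rw [← h1, Finset.smul_sum]
    refine Finset.sum_congr rfl fun S' _ => ?_
    rw [Finset.smul_sum]
    refine Finset.sum_congr rfl fun R' _ => ?_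
    rw [dualValue_eq hLI (St_uvClass_mem_span p hp hδ S' R') hg hg', smul_smul,
      smul_smul, pow_add _ _ (rr S' R')]
  · intro R'' hR'' hne
    rw [hg' _ fun he => hne ?_, zero_smul, smul_zero]
    rw [mem_boundedSeq] at hR hR''
    refine star_toNat_injOn ?_ ?_ (Prod.ext_iff.1 (Prod.ext_iff.1 he).2).1 <;>
      dsimp only at * <;> omega
  · exact fun h => absurd hR h
  · intro S'' _ hne
    refine Finset.sum_eq_zero fun R'' _ => ?_
    rw [hg' _ fun he => hne (Prod.ext_iff.1 he).1, zero_smul, smul_zero]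
  · exact fun h => absurd (Finset.mem_univ _) h
  · intro j _ hne
    refine Finset.sum_eq_zero fun S'' _ => Finset.sum_eq_zero fun R'' _ => ?_
    rw [hg' _ fun he => hne ?_, zero_smul, smul_zero]
    have h1 := uExp_vExp_injective p (s := (j : ℕ) - (δ : ℤ)) (s' := i - (δ : ℤ)) (by omega) (by omega)
      (Prod.ext_iff.1 (Prod.ext_iff.1 (Prod.ext_iff.1 he).2).2).1
      (Prod.ext_iff.1 (Prod.ext_iff.1 (Prod.ext_iff.1 he).2).2).2
    ext
    dsimp only
    omega
  · exact fun h => absurd (Finset.mem_univ _) h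

end Coefficients

/-! ### Comparison of signs -/

theorem neg_one_pow_eq_negOnePow {R : Type*} [Ring R] {m : ℕ} {z : ℤ} (h : Even ((m : ℤ) - z)) :
    (-1 : R) ^ m = ((z.negOnePow : ℤˣ) : ℤ) := by
  have h1 : z.negOnePow = (m : ℤ).negOnePow := by
    rw [← Int.negOnePow_eq_iff] at h
    exact h.symm
  rw [h1]
  obtain hm | hm := Nat.even_or_odd m
  · rw [hm.neg_one_pow, Int.negOnePow_even _ (by exact_mod_cast hm)]
    simp
  · rw [hm.neg_one_pow, Int.negOnePow_odd _ (by exact_mod_cast hm)]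
    simp

/-- By the parity constraint, δ - ε + t ≡ t', so the first exponent is tt' mod 2. The second exceeds
it by ε(t + t'), which is even because ε = 1 forces δ = 1 and then t ≡ t'. -/
theorem even_swap_sub {δ ε t t' : ℕ} {b : ℤ} (hδ : δ ≤ 1) (hε : ε = 0 ∨ ε = 1 ∧ δ = 1)
    (hb : Even (b - ε)) (h : (t + ε) % 2 = (δ + t') % 2) :
    Even ((((δ - ε + t) * t : ℕ) : ℤ) - ((t + b) * t' + ε * t)) := by
  have h' : Even ((t : ℤ) + ε - (δ + t')) := by
    rw [Int.even_iff]
    omega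
  obtain rfl | ⟨rfl, rfl⟩ := hε
  · interval_cases δ <;> push_cast at * <;>
      simp [parity_simps, ← Int.not_even_iff_odd, ← Nat.not_even_iff_odd] at * <;> tauto
  · push_cast at *
    simp [parity_simps, ← Int.not_even_iff_odd, ← Nat.not_even_iff_odd] at *
    tauto

section Signs

variable (p : ℕ) [Fact p.Prime] {n k : ℕ}

theorem even_br_sub {s : ℤ} (hs : -1 ≤ s) : Even (br p s - (uExp s : ℕ)) := by
  obtain rfl | hs := eq_or_lt_of_le hs
  · rw [br_neg_one (Fact.out : p.Prime).two_le]
    decide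
  · lift s to ℕ using by omega
    rw [br_natCast, uExp, if_neg (by omega)]
    simp

theorem sign_mul_dualValue (hp : Odd p) {δ : ℕ} (hδ : δ ≤ 1) (i : ℕ) (S : Finset (Fin k))
    (R : Fin k → ℕ) (S' : Finset (Fin n)) (R' : Fin n → ℕ) :
    (-1 : ZMod p) ^ (n * half p * k * δ + i + (rr S R +
            (δ - (uExp (i - δ : ℤ) : ℕ) + S.card) * S.card) + rr S' R') *
          dualValue (MQUV p k) (uvIndex p n δ (i - δ : ℤ) S R) (St S' R' (uvClass p k δ)) =
      ((((sgnExp p δ (i - δ : ℤ) S R S' R').negOnePow : ℤˣ) : ℤ) : ZMod p) *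
        ((-1) ^ ((uExp (i - δ : ℤ) : ℕ) * S.card) *
          dualValue (MQUV p k) (uvIndex p n δ (i - δ : ℤ) S R) (St S' R' (uvClass p k δ))) := by
  -- The signs are compared only where the coefficient is nonzero, since the parity constraint is
  -- available only there.
  by_cases h0 : dualValue (p := p) (MQUV p k) (uvIndex p n δ (i - δ : ℤ) S R)
      (St S' R' (uvClass p k δ)) = 0
  · rw [h0, mul_zero, mul_zero, mul_zero]
  have h1 := parity_of_dualValue_ne_zero p hp hδ h0
  have h2 : (uExp (i - δ : ℤ) : ℕ) = 0 ∨ (uExp (i - δ : ℤ) : ℕ) = 1 ∧ δ = 1 := by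
    rw [uExp]
    split_ifs
    · exact Or.inr ⟨rfl, by omega⟩
    · exact Or.inl rfl
  have h3 := even_swap_sub hδ h2 (even_br_sub p (s := i - δ) (by omega)) h1
  rw [← mul_assoc]
  congr 1
  dsimp only [uvIndex] at h3
  have h4 : Even (((n * half p * k * δ + i + (rr S R + (δ - (uExp (i - δ : ℤ) : ℕ) + S.card) *
      S.card) + rr S' R' : ℕ) : ℤ) - (sgnExp p δ (i - δ : ℤ) S R S' R' +
        ((uExp (i - δ : ℤ) : ℕ) * S.card : ℕ))) := by
    convert h3 using 1
    rw [sgnExp]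
    push_cast
    ring
  rw [neg_one_pow_eq_negOnePow h4, Int.negOnePow_add, Units.val_mul, Int.cast_mul,
    ← neg_one_pow_eq_negOnePow (m := (uExp (i - δ : ℤ) : ℕ) * S.card)
      (z := ((uExp (i - δ : ℤ) : ℕ) * S.card : ℕ)) (by simp)]

theorem coeffC_of_mem {δ : ℕ} {s : ℤ} {S : Finset (Fin k)} {R : Fin k → ℕ}
    (hR : R ∈ boundedSeq k ((2 - (δ : ℤ)) * (p : ℤ) ^ n + br p s).toNat S.card)
    (hq : 0 ≤ (2 - (δ : ℤ)) * (p : ℤ) ^ n + br p s) (S' : Finset (Fin n)) (R' : Fin n → ℕ) :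
    coeffC p δ s S R S' R' = (-1) ^ ((uExp s : ℕ) * S.card) *
      dualValue (MQUV p k) (uvIndex p n δ s S R) (St S' R' (uvClass p k δ)) := by
  refine if_pos fun j => ?_
  rw [mem_boundedSeq] at hR
  rw [star]
  split_ifs
  · rw [← Nat.cast_sum]
    omega
  · exact Nat.cast_nonneg _

theorem coeffC_of_notMem {δ : ℕ} {s : ℤ} {S : Finset (Fin k)} {R : Fin k → ℕ}
    (hR : R ∉ boundedSeq k ((2 - (δ : ℤ)) * (p : ℤ) ^ n + br p s).toNat S.card)
    (S' : Finset (Fin n)) (R' : Fin n → ℕ) : coeffC p δ s S R S' R' = 0 := by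
  rw [mem_boundedSeq] at hR
  -- For k = 0 there is no first entry of R* that could be negative, but then the bound cannot fail
  -- either.
  obtain _ | k := k
  · refine absurd ?_ hR
    simp [Finset.eq_empty_of_isEmpty S]
  · refine if_neg fun h => ?_
    have h0 := h 0
    rw [star, if_pos (Fin.val_zero _), ← Nat.cast_sum] at h0
    omega

end Signs

end ModularInvariants

open ModularInvariants in
theorem corollary2p2 (p : ℕ) [Fact p.Prime] (hp : Odd p) (n k δ : ℕ) (hδ : δ ≤ 1)
    (s : ℤ) (hs : -(δ : ℤ) ≤ s) (hs' : s ≤ (n : ℤ) - δ)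
    (S : Finset (Fin k)) (R : Fin k → ℕ) :
    -- the monomials `M̃_{S'} Q̃^{H'}` and `M̃_S Q̃^H U_{k+1}^e V_{k+1}^j` are bases of their spans,
    -- and the spans of the latter contain the classes that enter the pairings
    LinearIndependent (ZMod p)
        (fun c : Finset (Fin n) × (Fin n → ℕ) =>
          ModularInvariants.MQ p (le_refl n) c.1 c.2) ∧
    LinearIndependent (ZMod p) (ModularInvariants.MQUV p k) ∧
    (∀ (S' : Finset (Fin n)) (R' : Fin n → ℕ),
      ModularInvariants.St S' R'
          (ModularInvariants.U p (le_refl (k + 1)) ^ δ *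
            ModularInvariants.poly (ModularInvariants.V p (le_refl (k + 1))) ^ (1 - δ)) ∈
        Submodule.span (ZMod p) (Set.range (ModularInvariants.MQUV p k))) ∧
    ModularInvariants.St S R
        (ModularInvariants.Mtil p (le_refl n) s ^ δ *
          ModularInvariants.poly (ModularInvariants.Q p (le_refl n) s.toNat) ^ (1 - δ)) =
      ∑ S' : Finset (Fin n), ∑ R' ∈ ModularInvariants.admissible p n k δ S'.card,
        ((((ModularInvariants.sgnExp p δ s S R S' R').negOnePow : ℤˣ) : ℤ) : ZMod p) •
          (ModularInvariants.coeffC p δ s S R S' R' •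
            ModularInvariants.MQ p (le_refl n) S'
              (fun i => (ModularInvariants.star
                ((2 - (δ : ℤ)) * (p : ℤ) ^ k - S'.card) R' i).toNat)) := by
  refine ⟨linearIndependent_MQ p n hp (half_pos hp), linearIndependent_MQUV p k hp (half_pos hp),
    St_uvClass_mem_span p hp hδ, ?_⟩
  obtain ⟨i, hi⟩ : ∃ i : ℕ, s = i - (δ : ℤ) := ⟨(s + δ).toNat, by omega⟩
  have hin : i ≤ n := by omega
  subst hi
  obtain ⟨b, hb, hq, -⟩ := isBihom_mqClass (p := p) hp hδ hin
  -- Outside this range the left side vanishes by excess, and every coefficient on the right is zero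
  -- by the convention on negative exponents.
  by_cases hR : R ∈ boundedSeq k ((2 - (δ : ℤ)) * (p : ℤ) ^ n + br p (i - δ : ℤ)).toNat S.card
  · refine (sum_dualValue_smul_MQ p hp hδ hin hR).trans ?_
    refine Finset.sum_congr rfl fun S' _ => Finset.sum_congr rfl fun R' _ => ?_
    rw [coeffC_of_mem p hR (hq ▸ Nat.cast_nonneg _), smul_smul, sign_mul_dualValue p hp hδ]
  · refine (St_eq_zero hb ?_).trans (Eq.symm ?_)
    · rw [mem_boundedSeq] at hR
      omega
    · refine Finset.sum_eq_zero fun S' _ => Finset.sum_eq_zero fun R' _ => ?_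
      rw [coeffC_of_notMem p hR, zero_smul, smul_zero]
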